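/- Consider a chiral bosonic conformal field theory on the Riemann sphere $\mathbb P$, with Fock space $\mathcal H$ at $0$: $\mathcal H$ is a vertex operator algebra over $\mathbb C$, graded by the eigenvalues $h\in\{0,1,2,\dots\}$ of $L_0$, with vacuum $\Omega$, fields $V(a,z)$ for $a\in\mathcal H$ and Virasoro field $L(z)=\sum_n L_n z^{-n-2}$; the vacuum is unique ($\ker L_0=\mathbb C\Omega$), there is a Möbius invariant vacuum expectation value $\langle\cdot\rangle:\mathcal H\to\mathbb C$ (that is, $\langle\Omega\rangle=1$ and $\langle L_n\chi\rangle=0$ for $n=-1,0,1$), and a state all of whose amplitudes $\langle V(a_1,z_1)\cdots V(a_l,z_l)\chi\rangle$ vanish is zero. Let $V^h=\{\psi\in\mathcal H: L_0\psi=h\psi,\ L_1\psi=0\}$ be the space of quasiprimary states of weight $h$, assumed finite-dimensional, and write $V(\psi,z)=\sum_n V_n(\psi)z^{-n-h}$ for $\psi\in V^h$. Contour integrals $\oint_0$ are normalized by $1/(2\pi i)$. Let $k\ge 0$ and $X=\{u\in(\mathbb C\setminus\{0\})^k: u_i\ne u_j \text{ for } i\ne j\}$. For $u\in X$ let $O_u\subset\mathcal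 H$ be the span of all $\oint_0 dz\,g(z)V(\psi,z)\chi$, where $\chi\in\mathcal H$, $\psi\in V^h$, $h\ge 0$, and $g$ is a meromorphic function on $\mathbb P$ with $\operatorname{div}(g\,dz^{\otimes(1-h)})\ge -N[0]+\sum_{i}h[u_i]$ for some $N$. Let $$C_k=\operatorname{Span}\{V_{-N-(k-1)h}(\psi)\chi : \chi\in\mathcal H,\ \psi\in V^h,\ h\ge 0,\ N\ge 1\}.$$ For $u\in X$ and $1\le i\le k$ let $L^i(u)=-\oint_0 dz\,f^i_u(z)L(z)$, where $f^i_u$ is any meromorphic function such that $f^i_u\,dz$ is holomorphic on $\mathbb P\setminus\{0\}$ and $(f^i_u-\delta^{ij})\,dz$ vanishes to order at least $2$ at $u_j$ for every $j$. Suppose that $\mathcal H/C_k$ is finite-dimensional. Let $v\in X$, let $U\subset X$ be a simply connected open neighbourhood of $v$, and let any choice of the functions $f^i_u$ ($u\in U$, $1\le i\le k$) as above be given. Then for every linear functional $\eta\in(\mathcal H/O_v)^*$ there is a unique family of linear functionals $\tilde\eta(u)\in(\mathcal H/O_u)^*$, $u\in U$, such that $\tilde\eta(v)=\eta$, the function $u\mapsto\tilde\eta(u)(\chi)$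 is holomorphic on $U$ for every $\chi\in\mathcal H$, and $$\tilde\eta(u)(L^i(u)\chi)=\frac{\partial}{\partial u_i}\,\tilde\eta(u)(\chi)\qquad\text{for all } u\in U,\ \chi\in\mathcal H,\ 1\le i\le k.$$ -/

import Mathlib

open scoped LaurentPolynomial VertexOperator

noncomputable section

/-- A chiral bosonic conformal field theory on the Riemann sphere, presented on its Fock space `H`
at `0`.

The state-field correspondence is `Y`: the field of the state `a` is
`V(a, z) = ∑ n, (Y a)[[n]] z ^ (-n - 1)`, and `V(a, z) b` is a Laurent series in `z` with finitely
many negative powers (this is part of the type `VertexOperator ℂ H`).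
The fields satisfy the standard axioms of a vertex operator algebra (vacuum, creation, the Jacobi
identity in Borcherds' component form, Virasoro algebra of central charge `c`, translation, grading
by the eigenvalues of `L₀` with conformal weights in `ℕ`).
The amplitudes of the theory are the matrix elements `⟨V(a₁, z₁) ⋯ V(aₗ, zₗ)⟩` of the fields, formed
with the vacuum expectation value `vev`. They are invariant under the Möbius group, the vacuum is
unique (cluster decomposition), and the states are obtained from the amplitudes by factorization: a
state all of whose amplitudes with fields vanish is zero. -/
structure ChiralCFT (H : Type*) [AddCommGroup H] [Module ℂ H] where
  /-- the state-field correspondence -/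
  Y : H →ₗ[ℂ] VertexOperator ℂ H
  /-- the vacuum `Ω` -/
  vac : H
  /-- the conformal vector, whose field is the Virasoro field `L(z) = ∑ n, Lₙ z ^ (-n - 2)` -/
  conf : H
  /-- the central charge -/
  c : ℂ
  /-- the vacuum expectation value -/
  vev : H →ₗ[ℂ] ℂ
  vacuum : ∀ (n : ℤ) (b : H), ((Y vac)[[n]]) b = if n = -1 then b else 0
  creation : ∀ a : H, ((Y a)[[-1]]) vac = a
  creation_nonneg : ∀ (a : H) (n : ℤ), 0 ≤ n → ((Y a)[[n]]) vac = 0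
  /-- The Jacobi identity, in components. All sums have finitely many nonzero terms. -/
  borcherds : ∀ (a b d : H) (p q r : ℤ),
    ∑ᶠ j : ℕ, (Ring.choose p j : ℤ) • ((Y (((Y a)[[r + j]]) b))[[p + q - j]]) d =
      ∑ᶠ j : ℕ, ((-1) ^ j * Ring.choose r j : ℤ) •
        (((Y a)[[p + r - j]]) (((Y b)[[q + j]]) d) -
          (r.negOnePow : ℤ) • ((Y b)[[q + r - j]]) (((Y a)[[p + j]]) d))
  /-- The Virasoro algebra, for `Lₙ = (Y conf)[[n + 1]]`. -/
  virasoro : ∀ (m n : ℤ) (b : H),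
    ((Y conf)[[m + 1]]) (((Y conf)[[n + 1]]) b) - ((Y conf)[[n + 1]]) (((Y conf)[[m + 1]]) b) =
      (m - n) • ((Y conf)[[m + n + 1]]) b +
        if m + n = 0 then (c / 12 * ((m : ℂ) ^ 3 - m)) • b else 0
  /-- `V(L₋₁ a, z) = ∂ V(a, z)` -/
  translation : ∀ (a b : H) (n : ℤ),
    ((Y (((Y conf)[[0]]) a))[[n]]) b = (-n) • ((Y a)[[n - 1]]) b
  /-- `H` is the direct sum of the eigenspaces of `L₀` with eigenvalues `0, 1, 2, …`. -/
  grading : DirectSum.IsInternal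
    (fun h : ℕ => Module.End.eigenspace ((Y conf)[[1]]) (h : ℂ))
  /-- The space of quasiprimary states of weight `h` is finite-dimensional. -/
  finite_quasiprimary : ∀ h : ℕ, FiniteDimensional ℂ
    ↥(Module.End.eigenspace ((Y conf)[[1]]) (h : ℂ) ⊓ LinearMap.ker ((Y conf)[[2]]))
  /-- uniqueness of the vacuum -/
  unique_vacuum : Module.End.eigenspace ((Y conf)[[1]]) 0 = Submodule.span ℂ {vac}
  vev_vac : vev vac = 1
  /-- Möbius invariance: `⟨L₋₁ χ⟩ = ⟨L₀ χ⟩ = ⟨L₁ χ⟩ = 0` -/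
  vev_mobius : ∀ n : ℤ, -1 ≤ n → n ≤ 1 → ∀ b : H, vev (((Y conf)[[n + 1]]) b) = 0
  /-- factorization -/
  factorization : ∀ b : H,
    (∀ l : List (H × ℤ), vev ((l.map fun x => (Y x.1)[[x.2]]).prod b) = 0) → b = 0

namespace ChiralCFT

variable {H : Type*} [AddCommGroup H] [Module ℂ H] (T : ChiralCFT H)

/-- The Virasoro mode `Lₙ`. -/
def L (n : ℤ) : Module.End ℂ H := (T.Y T.conf)[[n + 1]]

/-- `V^h`: the Virasoro quasiprimary states of conformal weight `h`. -/
def quasiprimary (h : ℕ) : Submodule ℂ H :=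
  Module.End.eigenspace (T.L 0) (h : ℂ) ⊓ LinearMap.ker (T.L 1)

/-- The mode `Vₙ(ψ)` of the field `V(ψ, z) = ∑ n, Vₙ(ψ) z ^ (-n - h)` of a state `ψ` of conformal
weight `h`. -/
def mode (h : ℕ) (ψ : H) (n : ℤ) : Module.End ℂ H := (T.Y ψ)[[n + h - 1]]

/-- The operator `(2πi)⁻¹ ∮₀ dz g(z) V(a, z)`, that is, the residue at `0`: the coefficient of
`z ^ m` in `g` multiplies the coefficient of `z ^ (-m - 1)` in `V(a, z)`. -/
def residue (g : ℂ[T;T⁻¹]) (a : H) : Module.End ℂ H :=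
  ∑ m ∈ g.coeff.support, g.coeff m • (T.Y a)[[m]]

end ChiralCFT

/-- `ν_w(g) ≥ n` at a point `w ≠ 0` of the complex plane, for the function `g` on `ℂ ∖ {0}`. -/
def VanishesAt (g : ℂ[T;T⁻¹]) (w : ℂ) (n : ℕ) : Prop :=
  (LaurentPolynomial.T 1 - LaurentPolynomial.C w) ^ n ∣ g

/-- `g(z) = O(z ^ d)` as `z → ∞`, that is, `ν_∞(g) ≥ -d`. -/
def GrowthLE (g : ℂ[T;T⁻¹]) (d : ℤ) : Prop :=
  ∀ m ∈ g.coeff.support, m ≤ d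

/-- `div (g dz^{⊗ (1 - h)}) ≥ -N [0] + ∑ i, h [u i]` for some `N`. A meromorphic function on the
sphere without poles outside `{0, ∞}` is a Laurent polynomial; as `div dz = -2 [∞]`, the condition
at `∞` is `ν_∞(g) ≥ 2 (1 - h)`. -/
def IsZhuFunction {k : ℕ} (u : Fin k → ℂ) (h : ℕ) (g : ℂ[T;T⁻¹]) : Prop :=
  (∀ i, VanishesAt g (u i) h) ∧ GrowthLE g (2 * (h : ℤ) - 2)

/-- `f dz` is holomorphic on `ℙ ∖ {0}` (at `∞` this says `ν_∞(f) ≥ 2`), and `(f - δ i j) dz` vanishes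
to order at least `2` at `u j` for every `j`. -/
def IsKZFunction {k : ℕ} (u : Fin k → ℂ) (i : Fin k) (f : ℂ[T;T⁻¹]) : Prop :=
  GrowthLE f (-2) ∧ ∀ j, VanishesAt (f - if i = j then 1 else 0) (u j) 2

/-- The configuration space of `k` distinct points of `ℂ ∖ {0}`. -/
def configSpace (k : ℕ) : Set (Fin k → ℂ) :=
  {u | Function.Injective u ∧ ∀ i, u i ≠ 0}

namespace ChiralCFT

variable {H : Type*} [AddCommGroup H] [Module ℂ H] (T : ChiralCFT H)

/-- The space `O_u`. -/
def zhuO {k : ℕ} (u : Fin k → ℂ) : Submodule ℂ H :=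
  Submodule.span ℂ {x | ∃ (h : ℕ) (ψ : H) (g : ℂ[T;T⁻¹]) (χ : H),
    ψ ∈ T.quasiprimary h ∧ IsZhuFunction u h g ∧ x = T.residue g ψ χ}

/-- The space `C_k`, spanned by the states `V_{-N-(k-1)h}(ψ) χ` with `ψ` quasiprimary of weight `h`
and `N ≥ 1`. -/
def zhuC (k : ℕ) : Submodule ℂ H :=
  Submodule.span ℂ {x | ∃ (h : ℕ) (ψ : H) (N : ℕ) (χ : H),
    ψ ∈ T.quasiprimary h ∧ 1 ≤ N ∧ x = T.mode h ψ (-(N : ℤ) - ((k : ℤ) - 1) * h) χ}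

/-- The operator `-(2πi)⁻¹ ∮₀ dz L(z) f(z)`, which is `L^i(u)` when `f = f^i_u`. -/
def connectionOp (f : ℂ[T;T⁻¹]) : Module.End ℂ H := -T.residue f T.conf

/-- `η'` is a holomorphic section over `U` of the sheaf `A*` dual to `A`, whose fibre at `u` is
`A_u = H / O_u`: for every state `χ` the function `u ↦ η'(u)(χ)` is holomorphic on `U`.
(The values of `η'` outside `U` play no role.) -/
def IsDualSection {k : ℕ} (U : Set (Fin k → ℂ))
    (η' : (u : Fin k → ℂ) → Module.Dual ℂ (H ⧸ T.zhuO u)) : Prop :=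
  ∀ χ : H, DifferentiableOn ℂ (fun u => η' u (Submodule.Quotient.mk χ)) U

/-- The equation `η'(u)(L^i(u) χ) = ∂η'(u)(χ)/∂u_i` on `U`, for all `i` and all `χ`, where the operator
`L^i(u)` is formed with the function `f u i`. -/
def SatisfiesKZ {k : ℕ} (U : Set (Fin k → ℂ)) (f : (Fin k → ℂ) → Fin k → ℂ[T;T⁻¹])
    (η' : (u : Fin k → ℂ) → Module.Dual ℂ (H ⧸ T.zhuO u)) : Prop :=
  ∀ u ∈ U, ∀ (i : Fin k) (χ : H),
    HasDerivAt (fun t : ℂ => η' (Function.update u i t) (Submodule.Quotient.mk χ))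
      (η' u (Submodule.Quotient.mk (T.connectionOp (f u i) χ))) (u i)

end ChiralCFT

end

/-!
The quotients `H / O_u` carry a flat holomorphic connection, and the finiteness of `H / C_k` makes
it a linear system in finitely many unknowns, which has unique solutions over simply connected sets.
The dimension of `H / O_u` is not known in advance to be constant in `u`. The spaces `O_u` are
therefore treated as a family over the ring `A = paramRing k`, generated over `ℂ` by the functions
`u i`, `(u i)⁻¹` and `(u i - u j)⁻¹` on the configuration space, that is, as a submodule `familyO`
of the module `States A H` of families of states.

*Stability and flatness.* The connection is `∇ᵢ = ∂ᵢ + Lⁱ` (`nabla`). The commutator of `∇ᵢ` with a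
smeared quasiprimary field is a sum of smeared fields whose functions have the zeros that the
weights of the states demand, because the vector field `∂ᵢ + fⁱ d/dz` moves the points `u l`
correctly (`KZData.flow`). Some of these states are not quasiprimary, and regularity at infinity is
not visible term by term. Both defects are repaired by `apply_mem_familyO`: an operator that is a
sum of smeared fields with the prescribed zeros and whose range is annihilated by the vacuum
expectation value maps everything into `O_u`. Up to total derivatives such an operator is a sum of
smeared quasiprimary fields, since every state is a combination of `L₋₁`-descendants of quasiprimary
ones, and the two-point function, which is nondegenerate on quasiprimary states, detects exactly the
coefficients that violate regularity at infinity. This gives `nabla_mem_familyO` and, for the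
curvature, `nabla_comm_mem_familyO`.

*Finite generation.* Since the points `u l` are invertible in `A`, the functions
`z ^ m ∏ l, (z - u l) ^ h` express a generator of `C_k` modulo `O_u` by states of smaller weight.
Hence finitely many constant families generate `A ⊗ H` modulo `familyO`
(`exists_finite_span_sup_familyO`).

*The linear system.* As `A` is noetherian, the relations between these generators are finitely
generated. A section of the dual is a function `y` with values in `ℂ ^ n` that satisfies `dy = M y`
and the constraint `ρ y = 0` given by the relations. The system preserves the constraint, and its
curvature vanishes on the constraint, but perhaps not elsewhere, so that the Frobenius theorem does
not apply directly. Solving along the rays of a small ball, the radial solutions stay in the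
constraint, and a comparison by Grönwall's inequality shows that they solve the full system
(`LinearSystem.exists_solution_ball`). The local solutions form a covering of the simply connected
set `U`, which has global sections (`exists_global_section`).
-/

namespace ChiralCFT

variable {H : Type*} [AddCommGroup H] [Module ℂ H] (T : ChiralCFT H)

/-! ### Modes, weights and commutators -/

theorem exists_modes_vanish (a b : H) :
    ∃ J : ℕ, ∀ n : ℤ, (J : ℤ) ≤ n → ((T.Y a)[[n]]) b = 0 := by
  refine ⟨(-((HahnModule.of ℂ).symm ((T.Y a) b)).order).toNat, fun n hn => ?_⟩
  apply VertexOperator.ncoeff_eq_zero_of_lt_order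
  omega

/-- The commutator formula, the case `r = 0` of the Jacobi identity. -/
theorem mode_commutator (a b d : H) (p q : ℤ) (J : ℕ)
    (hJ : ∀ j : ℕ, J ≤ j → ((T.Y a)[[(j : ℤ)]]) b = 0) :
    ((T.Y a)[[p]]) (((T.Y b)[[q]]) d) - ((T.Y b)[[q]]) (((T.Y a)[[p]]) d) =
      ∑ j ∈ Finset.range J,
        (Ring.choose p j : ℤ) • ((T.Y (((T.Y a)[[(j : ℤ)]]) b))[[p + q - j]]) d := by
  have h := T.borcherds a b d p q 0
  rw [finsum_eq_sum_of_support_subset (s := Finset.range J) _ ?_,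
    finsum_eq_single _ 0 ?_] at h
  · simpa using h.symm
  · intro j hj
    rw [Ring.choose_zero_pos _ (Nat.pos_of_ne_zero hj)]
    simp
  · intro j hj
    by_contra hjJ
    simp only [Finset.coe_range, Set.mem_Iio, not_lt] at hjJ
    refine hj ?_
    simp [hJ j hjJ]

/-- The case `a = conf`, `p = n + 1` of the commutator formula, for `n = -1`. -/
theorem L_neg_one_comm (a d : H) (m : ℤ) :
    T.L (-1) (((T.Y a)[[m]]) d) = ((T.Y a)[[m]]) (T.L (-1) d) - m • ((T.Y a)[[m - 1]]) d := by
  obtain ⟨J, hJ⟩ := T.exists_modes_vanish T.conf a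
  have h := T.mode_commutator T.conf a d 0 m (J + 1) (fun j hj => hJ j (by omega))
  rw [Finset.sum_eq_single 0] at h
  · have h2 := T.translation a d m
    simp only [L]
    norm_num at h h2 ⊢
    rw [h2] at h
    rw [← sub_eq_zero] at h ⊢
    rw [← h]
    abel
  · intro j _ hj
    rw [Ring.choose_zero_pos _ (Nat.pos_of_ne_zero hj)]
    simp
  · simp

theorem Y_L_neg_one (a d : H) (m : ℤ) :
    ((T.Y (T.L (-1) a))[[m]]) d = -(m • ((T.Y a)[[m - 1]]) d) := by
  have h2 := T.translation a d m
  simpa [L] using h2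

theorem L_zero_comm (a d : H) (m : ℤ) :
    T.L 0 (((T.Y a)[[m]]) d) = ((T.Y a)[[m]]) (T.L 0 d) + ((T.Y (T.L 0 a))[[m]]) d -
      (m + 1) • ((T.Y a)[[m]]) d := by
  obtain ⟨J, hJ⟩ := T.exists_modes_vanish T.conf a
  have h := T.mode_commutator T.conf a d 1 m (J + 2) (fun j hj => hJ j (by omega))
  rw [Finset.sum_subset_zero_on_sdiff (s₁ := Finset.range 2) (g := fun j =>
    (Ring.choose (1 : ℤ) j : ℤ) • ((T.Y (((T.Y T.conf)[[(j : ℤ)]]) a))[[1 + m - j]]) d)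
    (Finset.range_mono (by omega)) ?_ (fun _ _ => rfl) |>.symm] at h
  · have h2 := T.Y_L_neg_one a d (1 + m)
    simp only [L] at h2 ⊢
    simp only [Finset.sum_range_succ, Finset.sum_range_zero] at h
    norm_num at h h2 ⊢
    rw [h2] at h
    rw [← sub_eq_zero] at h ⊢
    rw [← h, add_comm 1 m]
    abel
  · intro j hj
    simp only [Finset.mem_sdiff, Finset.mem_range] at hj
    have : (Ring.choose (1 : ℤ) j : ℤ) = 0 := by
      have := Ring.choose_natCast (R := ℤ) 1 j
      rw [Nat.choose_eq_zero_of_lt (by omega)] at this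
      simpa using this
    simp [this]

theorem L_one_comm (a d : H) (m : ℤ) :
    T.L 1 (((T.Y a)[[m]]) d) = ((T.Y a)[[m]]) (T.L 1 d) + ((T.Y (T.L 1 a))[[m]]) d +
      (2 : ℤ) • ((T.Y (T.L 0 a))[[m + 1]]) d - (m + 2) • ((T.Y a)[[m + 1]]) d := by
  obtain ⟨J, hJ⟩ := T.exists_modes_vanish T.conf a
  have h := T.mode_commutator T.conf a d 2 m (J + 3) (fun j hj => hJ j (by omega))
  rw [Finset.sum_subset_zero_on_sdiff (s₁ := Finset.range 3) (g := fun j =>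
    (Ring.choose (2 : ℤ) j : ℤ) • ((T.Y (((T.Y T.conf)[[(j : ℤ)]]) a))[[2 + m - j]]) d)
    (Finset.range_mono (by omega)) ?_ (fun _ _ => rfl) |>.symm] at h
  · have h2 := T.Y_L_neg_one a d (2 + m)
    have c2 : Ring.choose (2 : ℤ) 2 = 1 := by simpa using Ring.choose_natCast (R := ℤ) 2 2
    simp only [L] at h2 ⊢
    simp only [Finset.sum_range_succ, Finset.sum_range_zero] at h
    norm_num [c2] at h h2 ⊢
    rw [h2] at h
    rw [← sub_eq_zero] at h ⊢
    rw [← h, add_comm 2 m, show m + 2 - 1 = m + 1 by ring]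
    abel
  · intro j hj
    simp only [Finset.mem_sdiff, Finset.mem_range] at hj
    have : (Ring.choose (2 : ℤ) j : ℤ) = 0 := by
      have := Ring.choose_natCast (R := ℤ) 2 j
      rw [Nat.choose_eq_zero_of_lt (by omega)] at this
      simpa using this
    simp [this]

/-- The states of conformal weight `d`; the weight is an integer so that modes always act between
weight spaces, those of negative weight being zero. -/
def wt (d : ℤ) : Submodule ℂ H := Module.End.eigenspace (T.L 0) (d : ℂ)

theorem mem_wt {d : ℤ} {x : H} : x ∈ T.wt d ↔ T.L 0 x = (d : ℂ) • x :=
  Module.End.mem_eigenspace_iff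

theorem mem_quasiprimary {h : ℕ} {x : H} :
    x ∈ T.quasiprimary h ↔ x ∈ T.wt h ∧ T.L 1 x = 0 := by
  simp [quasiprimary, wt]

theorem iSup_wt : ⨆ h : ℕ, T.wt h = ⊤ := by
  simpa [wt, L] using T.grading.submodule_iSup_eq_top

theorem wt_eq_bot_of_neg {d : ℤ} (hd : d < 0) : T.wt d = ⊥ := by
  have h1 := Module.End.eigenspaces_iSupIndep (T.L 0) (d : ℂ)
  have h2 : (⊤ : Submodule ℂ H) ≤ ⨆ μ, ⨆ (_ : μ ≠ (d : ℂ)), Module.End.eigenspace (T.L 0) μ := by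
    rw [← T.iSup_wt]
    refine iSup_le fun h => ?_
    refine le_iSup₂_of_le (h : ℂ) ?_ (by simp [wt])
    intro hh
    have : ((h : ℤ) : ℂ) = (d : ℂ) := by simpa using hh
    have := Int.cast_injective this
    omega
  have := h1.mono_right h2
  rwa [disjoint_top] at this

theorem mode_mem_wt {h d : ℤ} {a x : H} (ha : a ∈ T.wt h) (hx : x ∈ T.wt d) (m : ℤ) :
    ((T.Y a)[[m]]) x ∈ T.wt (d + h - m - 1) := by
  rw [mem_wt] at *
  rw [L_zero_comm, hx, ha]
  simp only [map_smul, Pi.smul_apply, LinearMap.smul_apply, ← Int.cast_smul_eq_zsmul ℂ]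
  push_cast
  module

theorem L_mem_wt {d : ℤ} {x : H} (hx : x ∈ T.wt d) (hc : T.conf ∈ T.wt 2) (n : ℤ) :
    T.L n x ∈ T.wt (d - n) := by
  have := T.mode_mem_wt hc hx (n + 1)
  rwa [show d + 2 - (n + 1) - 1 = d - n by ring] at this

theorem L_vac {n : ℤ} (hn : -1 ≤ n) : T.L n T.vac = 0 :=
  T.creation_nonneg _ _ (by omega)

theorem L_neg_two_vac : T.L (-2) T.vac = T.conf := T.creation T.conf

theorem L_comm (m n : ℤ) (b : H) :
    T.L m (T.L n b) = T.L n (T.L m b) + (m - n) • T.L (m + n) b +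
      (if m + n = 0 then (T.c / 12 * ((m : ℂ) ^ 3 - m)) • b else 0) := by
  have := T.virasoro m n b
  simp only [L]
  rw [sub_eq_iff_eq_add] at this
  rw [this]
  abel

/-- The conformal vector is quasiprimary of weight `2`. -/
theorem conf_mem_quasiprimary : T.conf ∈ T.quasiprimary 2 := by
  rw [mem_quasiprimary, mem_wt]
  constructor
  · rw [← L_neg_two_vac, L_comm, T.L_vac (by norm_num)]
    norm_num
    rw [← Int.cast_smul_eq_zsmul ℂ]
    norm_num
  · rw [← L_neg_two_vac, L_comm, T.L_vac (by norm_num)]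
    norm_num
    rw [T.L_vac (by norm_num)]
    simp

theorem conf_mem_wt : T.conf ∈ T.wt 2 := (T.mem_quasiprimary.1 T.conf_mem_quasiprimary).1

theorem L_pow_mem_wt {d : ℤ} {x : H} (hx : x ∈ T.wt d) (s : ℕ) :
    (T.L (-1) ^ s) x ∈ T.wt (d + s) := by
  induction s with
  | zero => simpa using hx
  | succ s ih =>
    rw [pow_succ', Module.End.mul_apply]
    have := T.L_mem_wt ih T.conf_mem_wt (-1)
    convert this using 2
    push_cast; ring

/-! ### Decomposition into descendants of quasiprimary states -/

theorem L_one_L_neg_one_pow {h : ℕ} {ψ : H} (hψ : ψ ∈ T.quasiprimary h) (s : ℕ) :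
    T.L 1 ((T.L (-1) ^ (s + 1)) ψ) = (((s + 1) * (2 * h + s) : ℕ) : ℂ) • (T.L (-1) ^ s) ψ := by
  rw [mem_quasiprimary] at hψ
  induction s with
  | zero =>
    have h0 := T.mem_wt.1 hψ.1
    simp only [zero_add, pow_one, pow_zero, Module.End.one_apply]
    rw [L_comm, hψ.2]
    norm_num
    rw [h0, ← Int.cast_smul_eq_zsmul ℂ, smul_smul]
    norm_num
  | succ s ih =>
    rw [pow_succ', Module.End.mul_apply, L_comm, ih]
    have h0 := T.mem_wt.1 (T.L_pow_mem_wt hψ.1 (s + 1))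
    norm_num
    rw [h0, ← Module.End.mul_apply (T.L (-1)), ← pow_succ', ← Int.cast_smul_eq_zsmul ℂ, smul_smul,
      ← add_smul]
    congr 1
    push_cast; ring

/-- The span of the `L₋₁`-descendants of weight `n` of quasiprimary states. -/
def descendants (n : ℕ) : Submodule ℂ H :=
  Submodule.span ℂ {x | ∃ (h s : ℕ) (ψ : H), ψ ∈ T.quasiprimary h ∧ h + s = n ∧
    x = (T.L (-1) ^ s) ψ}

/-- In weight one `L₁ x` is a multiple of the vacuum, and Möbius invariance shows that the multiple
is zero. -/
theorem L_one_eq_of_weight_one {x : H} (hx : x ∈ T.wt 1) : T.L 1 x = 0 := by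
  have h1 := T.L_mem_wt hx T.conf_mem_wt 1
  have h2 : T.L 1 x ∈ Module.End.eigenspace ((T.Y T.conf)[[1]]) 0 := by
    simpa [wt, L] using h1
  rw [T.unique_vacuum, Submodule.mem_span_singleton] at h2
  obtain ⟨c, hc⟩ := h2
  have h3 := T.vev_mobius 1 (by norm_num) le_rfl x
  have h4 : T.vev (T.L 1 x) = 0 := h3
  rw [← hc, map_smul, T.vev_vac] at h4
  rw [← hc]
  simp at h4
  simp [h4]

theorem exists_L_one_L_neg_one_eq {n : ℕ} (hn : 1 ≤ n) {x : H} (hx : x ∈ T.descendants n) :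
    ∃ y ∈ T.descendants n, T.L 1 (T.L (-1) y) = x := by
  induction hx using Submodule.span_induction with
  | mem x hx =>
    obtain ⟨h, s, ψ, hψ, hs, rfl⟩ := hx
    have := T.L_one_L_neg_one_pow hψ s
    rw [pow_succ', Module.End.mul_apply] at this
    refine ⟨((((s + 1) * (2 * h + s) : ℕ) : ℂ)⁻¹) • (T.L (-1) ^ s) ψ,
      Submodule.smul_mem _ _ (Submodule.subset_span ⟨h, s, ψ, hψ, hs, rfl⟩), ?_⟩
    rw [map_smul, map_smul, this, smul_smul, inv_mul_cancel₀, one_smul]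
    have : 2 * h + s ≠ 0 := by omega
    exact_mod_cast Nat.mul_ne_zero (by omega) this
  | zero => exact ⟨0, zero_mem _, by simp⟩
  | add x y _ _ hx hy =>
    obtain ⟨x', hx', rfl⟩ := hx
    obtain ⟨y', hy', rfl⟩ := hy
    exact ⟨x' + y', add_mem hx' hy', by simp⟩
  | smul c x _ hx =>
    obtain ⟨x', hx', rfl⟩ := hx
    exact ⟨c • x', Submodule.smul_mem _ _ hx', by simp⟩

theorem L_neg_one_mem_descendants {n : ℕ} {x : H} (hx : x ∈ T.descendants n) :
    T.L (-1) x ∈ T.descendants (n + 1) := by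
  induction hx using Submodule.span_induction with
  | mem x hx =>
    obtain ⟨h, s, ψ, hψ, hs, rfl⟩ := hx
    refine Submodule.subset_span ⟨h, s + 1, ψ, hψ, by omega, ?_⟩
    rw [pow_succ', Module.End.mul_apply]
  | zero => simp
  | add x y _ _ hx hy => rw [map_add]; exact add_mem hx hy
  | smul c x _ hx => rw [map_smul]; exact Submodule.smul_mem _ _ hx

theorem descendants_le_wt (n : ℕ) : T.descendants n ≤ T.wt n := by
  refine Submodule.span_le.2 ?_
  rintro x ⟨h, s, ψ, hψ, hs, rfl⟩
  have := T.L_pow_mem_wt (T.mem_quasiprimary.1 hψ).1 s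
  rwa [show (h : ℤ) + s = n by exact_mod_cast hs] at this

/-- A weight space is spanned by descendants of quasiprimary states: since `L₁ L₋₁` is onto in
positive weight, a state can be corrected by an element of the range of `L₋₁` to a state killed by
`L₁`. In weight one this uses uniqueness of the vacuum and Möbius invariance instead. -/
theorem wt_eq_descendants (n : ℕ) : T.wt n = T.descendants n := by
  refine le_antisymm ?_ (T.descendants_le_wt n)
  have quasi : ∀ (n : ℕ) (x : H), x ∈ T.wt n → T.L 1 x = 0 → x ∈ T.descendants n := fun n x h1 h2 =>
    Submodule.subset_span ⟨n, 0, x, T.mem_quasiprimary.2 ⟨h1, h2⟩, by simp, by simp⟩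
  induction n with
  | zero =>
    intro x hx
    refine quasi 0 x hx ?_
    have := T.L_mem_wt hx T.conf_mem_wt 1
    rw [T.wt_eq_bot_of_neg (by norm_num)] at this
    simpa using this
  | succ n ih =>
    intro x hx
    rcases Nat.eq_zero_or_pos n with rfl | hn
    · exact quasi _ x hx (T.L_one_eq_of_weight_one (by simpa using hx))
    · have h1 : T.L 1 x ∈ T.wt n := by
        have := T.L_mem_wt hx T.conf_mem_wt 1
        simpa using this
      obtain ⟨y, hy, hyx⟩ := T.exists_L_one_L_neg_one_eq hn (ih h1)
      have hy' := T.L_neg_one_mem_descendants hy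
      have : x - T.L (-1) y ∈ T.descendants (n + 1) := by
        refine quasi _ _ (sub_mem hx (T.descendants_le_wt _ hy')) ?_
        rw [map_sub, hyx, sub_self]
      simpa using add_mem this hy'

/-- A state of positive weight is a total derivative up to a quasiprimary state. -/
theorem exists_quasiprimary_add {n : ℕ} {x : H} (hx : x ∈ T.wt (n + 1 : ℕ)) :
    ∃ y ∈ T.wt n, ∃ ψ ∈ T.quasiprimary (n + 1), x = T.L (-1) y + ψ := by
  rw [wt_eq_descendants] at hx
  induction hx using Submodule.span_induction with
  | mem x hx =>
    obtain ⟨h, s, ψ, hψ, hs, rfl⟩ := hx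
    rcases s with _ | s
    · obtain rfl : h = n + 1 := by simpa using hs
      exact ⟨0, zero_mem _, ψ, hψ, by simp⟩
    · refine ⟨(T.L (-1) ^ s) ψ, ?_, 0, zero_mem _, by
        rw [pow_succ', Module.End.mul_apply, add_zero]⟩
      rw [wt_eq_descendants]
      exact Submodule.subset_span ⟨h, s, ψ, hψ, by omega, rfl⟩
  | zero => exact ⟨0, zero_mem _, 0, zero_mem _, by simp⟩
  | add x y _ _ hx hy =>
    obtain ⟨x', hx', p, hp, rfl⟩ := hx
    obtain ⟨y', hy', q, hq, rfl⟩ := hy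
    exact ⟨x' + y', add_mem hx' hy', p + q, add_mem hp hq, by rw [map_add]; abel⟩
  | smul c x _ hx =>
    obtain ⟨x', hx', p, hp, rfl⟩ := hx
    exact ⟨c • x', Submodule.smul_mem _ _ hx', c • p, Submodule.smul_mem _ _ hp, by simp⟩

theorem mem_quasiprimary_zero {x : H} : x ∈ T.quasiprimary 0 ↔ x ∈ T.wt 0 := by
  rw [mem_quasiprimary]
  refine ⟨fun h => by simpa using h.1, fun h => ⟨by simpa using h, ?_⟩⟩
  have := T.L_mem_wt h T.conf_mem_wt 1
  rw [T.wt_eq_bot_of_neg (by norm_num)] at this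
  simpa using this

/-- Induction over descendants of quasiprimary states. -/
theorem descendant_induction {p : H → Prop} (x : H) (zero : p 0)
    (add : ∀ x y, p x → p y → p (x + y)) (smul : ∀ (c : ℂ) x, p x → p (c • x))
    (desc : ∀ (h s : ℕ) (ψ : H), ψ ∈ T.quasiprimary h → p ((T.L (-1) ^ s) ψ)) : p x := by
  have hx : x ∈ ⨆ h : ℕ, T.wt h := by rw [T.iSup_wt]; trivial
  induction hx using Submodule.iSup_induction' with
  | mem n x hx =>
    rw [wt_eq_descendants] at hx
    induction hx using Submodule.span_induction with
    | mem x hx =>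
      obtain ⟨h, s, ψ, hψ, hs, rfl⟩ := hx
      exact desc h s ψ hψ
    | zero => exact zero
    | add x y _ _ hx hy => exact add _ _ hx hy
    | smul c x _ hx => exact smul _ _ hx
  | zero => exact zero
  | add x y _ _ hx hy => exact add _ _ hx hy

/-! ### The two-point function -/

theorem vev_L {n : ℤ} (h1 : -1 ≤ n) (h2 : n ≤ 1) (b : H) : T.vev (T.L n b) = 0 :=
  T.vev_mobius n h1 h2 b

theorem vev_of_mem_wt {d : ℤ} (hd : d ≠ 0) {x : H} (hx : x ∈ T.wt d) : T.vev x = 0 := by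
  have h := T.vev_L (n := 0) (by norm_num) (by norm_num) x
  rw [T.mem_wt.1 hx, map_smul, smul_eq_mul] at h
  exact (mul_eq_zero.1 h).resolve_left (by exact_mod_cast hd)

theorem vev_mode_L_neg_one (a d : H) (m : ℤ) :
    T.vev (((T.Y a)[[m]]) (T.L (-1) d)) = m * T.vev (((T.Y a)[[m - 1]]) d) := by
  have h := T.vev_L (n := -1) (by norm_num) (by norm_num) (((T.Y a)[[m]]) d)
  rw [L_neg_one_comm, map_sub, sub_eq_zero] at h
  rw [h, ← Int.cast_smul_eq_zsmul ℂ, map_smul, smul_eq_mul]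

theorem vev_mode_L_neg_one_pow (a d : H) (m : ℤ) (s : ℕ) :
    T.vev (((T.Y a)[[m]]) ((T.L (-1) ^ s) d)) =
      (∏ i ∈ Finset.range s, ((m : ℂ) - i)) * T.vev (((T.Y a)[[m - s]]) d) := by
  induction s generalizing m with
  | zero => simp
  | succ s ih =>
    rw [pow_succ', Module.End.mul_apply, vev_mode_L_neg_one, ih, Finset.prod_range_succ',
      show m - 1 - s = m - (s + 1 : ℕ) by push_cast; ring, ← mul_assoc, mul_comm (m : ℂ)]
    push_cast
    congr 2
    · exact Finset.prod_congr rfl fun i _ => by ring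
    · ring

theorem exists_Y_L_neg_one_pow (a : H) (m : ℤ) (s : ℕ) :
    ∃ c : ℂ, ∀ d, ((T.Y ((T.L (-1) ^ s) a))[[m]]) d = c • ((T.Y a)[[m - s]]) d := by
  induction s generalizing m with
  | zero => exact ⟨1, by simp⟩
  | succ s ih =>
    obtain ⟨c, hc⟩ := ih (m - 1)
    refine ⟨-(m * c), fun d => ?_⟩
    rw [pow_succ', Module.End.mul_apply, Y_L_neg_one, hc, ← Int.cast_smul_eq_zsmul ℂ, smul_smul,
      ← neg_smul, show m - 1 - s = m - (s + 1 : ℕ) by push_cast; ring]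

/-- The two-point function of quasiprimary states of weights `h ≠ h'` vanishes, and for `h = h'`
only the mode `2h - 1` contributes. -/
theorem vev_quasiprimary {h h' : ℕ} {ψ φ : H} (hψ : ψ ∈ T.quasiprimary h)
    (hφ : φ ∈ T.quasiprimary h') (m : ℤ) (hm : ¬ (h = h' ∧ m = 2 * h - 1)) :
    T.vev (((T.Y ψ)[[m]]) φ) = 0 := by
  rw [mem_quasiprimary] at hψ hφ
  by_cases hw : (h' : ℤ) + h - m - 1 = 0
  · have h1 := T.vev_L (n := 1) (by norm_num) (by norm_num) (((T.Y ψ)[[m - 1]]) φ)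
    rw [L_one_comm, hψ.2, hφ.2, T.mem_wt.1 hψ.1] at h1
    simp only [map_zero, LinearMap.zero_apply, zero_add, Pi.zero_apply, sub_add_cancel, map_smul,
      LinearMap.smul_apply, ← Int.cast_smul_eq_zsmul ℂ, smul_smul, ← sub_smul, Pi.smul_apply] at h1
    rw [smul_eq_mul] at h1
    refine (mul_eq_zero.1 h1).resolve_left fun h0 => hm ?_
    have : (((2 : ℤ) * (h : ℤ) - (m - 1 + 2) : ℤ) : ℂ) = 0 := by
      push_cast at h0 ⊢
      linear_combination h0
    rw [Int.cast_eq_zero] at this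
    omega
  · exact T.vev_of_mem_wt hw (T.mode_mem_wt hψ.1 hφ.1 m)

/-- The out-vacuum is annihilated by the modes that are regular at infinity. -/
theorem vev_mode_eq_zero {h : ℕ} {ψ : H} (hψ : ψ ∈ T.quasiprimary h) {m : ℤ}
    (hm : m ≤ 2 * h - 2) (χ : H) : T.vev (((T.Y ψ)[[m]]) χ) = 0 := by
  induction χ using T.descendant_induction with
  | zero => simp
  | add x y hx hy => rw [map_add, map_add, hx, hy, add_zero]
  | smul c x hx => rw [map_smul, map_smul, hx, smul_zero]
  | desc h' s φ hφ =>
    rw [vev_mode_L_neg_one_pow, T.vev_quasiprimary hψ hφ _ (by omega), mul_zero]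

/-- Associativity: the states `a ₍ₙ₎ b` span a subspace stable under all modes. -/
theorem mode_mode_mem_span (a c b : H) (m n : ℤ) :
    ((T.Y a)[[m]]) (((T.Y c)[[n]]) b) ∈
      Submodule.span ℂ {x | ∃ (e : H) (r : ℤ), x = ((T.Y e)[[r]]) b} := by
  set S := Submodule.span ℂ {x | ∃ (e : H) (r : ℤ), x = ((T.Y e)[[r]]) b} with hS
  obtain ⟨P, hP⟩ := T.exists_modes_vanish a b
  obtain ⟨Q, hQ⟩ := T.exists_modes_vanish c b
  have key : ∀ (t : ℕ) (m n : ℤ), (Q : ℤ) - n ≤ t → ((T.Y a)[[m]]) (((T.Y c)[[n]]) b) ∈ S := by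
    intro t
    induction t with
    | zero =>
      intro m n hn
      rw [hQ n (by omega), map_zero]
      exact zero_mem _
    | succ t ih =>
      intro m n hn
      have hb := T.borcherds a c b P n (m - P)
      have hl : (∑ᶠ j : ℕ, (Ring.choose (P : ℤ) j : ℤ) •
          ((T.Y (((T.Y a)[[m - P + j]]) c))[[P + n - j]]) b) ∈ S := by
        refine finsum_induction (· ∈ S) (zero_mem _) (fun _ _ => add_mem) fun j => ?_
        refine zsmul_mem ?_ _
        exact Submodule.subset_span ⟨_, _, rfl⟩
      rw [hb, finsum_eq_sum_of_support_subset (s := Finset.range (t + 2)) _ ?_,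
        Finset.sum_range_succ'] at hl
      · rw [Submodule.add_mem_iff_right _ (Submodule.sum_mem _ fun j _ => ?_)] at hl
        · rw [hP _ (by simp)] at hl
          simpa using hl
        · refine zsmul_mem ?_ _
          rw [hP _ (by omega)]
          simpa using ih _ _ (by omega)
      · intro j hj
        by_contra hjt
        simp only [Finset.coe_range, Set.mem_Iio, not_lt] at hjt
        apply hj
        simp only
        rw [hP _ (by omega), hQ _ (by omega)]
        simp
  exact key ((Q : ℤ) - n).toNat m n (by omega)

/-- By associativity, amplitudes with a single field suffice to detect a state. -/
theorem eq_zero_of_vev_mode_eq_zero {b : H}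
    (hb : ∀ (a : H) (n : ℤ), T.vev (((T.Y a)[[n]]) b) = 0) : b = 0 := by
  set S := Submodule.span ℂ {x | ∃ (e : H) (r : ℤ), x = ((T.Y e)[[r]]) b} with hS
  have hbS : b ∈ S := Submodule.subset_span ⟨T.vac, -1, by rw [T.vacuum]; simp⟩
  have hSS : ∀ (a : H) (n : ℤ) (x : H), x ∈ S → ((T.Y a)[[n]]) x ∈ S := by
    intro a n x hx
    induction hx using Submodule.span_induction with
    | mem x hx =>
      obtain ⟨e, r, rfl⟩ := hx
      exact T.mode_mode_mem_span a e b n r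
    | zero => simp
    | add x y _ _ hx hy => rw [map_add]; exact add_mem hx hy
    | smul c x _ hx => rw [map_smul]; exact Submodule.smul_mem _ _ hx
  have hv : S ≤ LinearMap.ker T.vev := by
    refine Submodule.span_le.2 ?_
    rintro x ⟨e, r, rfl⟩
    exact hb e r
  refine T.factorization b fun l => hv ?_
  induction l with
  | nil => simpa using hbS
  | cons x l ih =>
    rw [List.map_cons, List.prod_cons, Module.End.mul_apply]
    exact hSS _ _ _ ih

/-- The two-point function is a nondegenerate pairing on the quasiprimary states of weight `h`. -/
theorem exists_quasiprimary_dual {h : ℕ} (ℓ : Module.Dual ℂ (T.quasiprimary h)) :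
    ∃ φ ∈ T.quasiprimary h, ∀ ψ : T.quasiprimary h,
      T.vev (((T.Y (ψ : H))[[2 * (h : ℤ) - 1]]) φ) = ℓ ψ := by
  have hfin : FiniteDimensional ℂ (T.quasiprimary h) := T.finite_quasiprimary h
  let B : T.quasiprimary h →ₗ[ℂ] Module.Dual ℂ (T.quasiprimary h) :=
    LinearMap.mk₂ ℂ (fun φ ψ => T.vev (((T.Y (ψ : H))[[2 * (h : ℤ) - 1]]) φ))
      (by simp) (by simp) (by simp) (by simp)
  have hB : Function.Injective B := by
    rw [injective_iff_map_eq_zero]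
    rintro ⟨φ, hφ⟩ h0
    rw [Submodule.mk_eq_zero]
    refine T.eq_zero_of_vev_mode_eq_zero fun a n => ?_
    induction a using T.descendant_induction with
    | zero => simp
    | add x y hx hy => simp [hx, hy]
    | smul c x hx => simp [hx]
    | desc h' s ψ hψ =>
      obtain ⟨c, hc⟩ := T.exists_Y_L_neg_one_pow ψ n s
      rw [hc, map_smul]
      by_cases hh : h' = h ∧ n - s = 2 * h' - 1
      · obtain ⟨rfl, hn⟩ := hh
        have := LinearMap.congr_fun h0 ⟨ψ, hψ⟩
        rw [hn]
        simp only [B, LinearMap.mk₂_apply, LinearMap.zero_apply] at this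
        rw [this, smul_zero]
      · rw [T.vev_quasiprimary hψ hφ _ hh, smul_zero]
  have hs := (LinearMap.injective_iff_surjective_of_finrank_eq_finrank
    Subspace.dual_finrank_eq.symm).1 hB ℓ
  obtain ⟨φ, hφ⟩ := hs
  exact ⟨φ, φ.2, fun ψ => by rw [← hφ]; rfl⟩

end ChiralCFT

open scoped TensorProduct

/-! ### Calculus of Laurent polynomials -/

namespace LaurentPolynomial

section Calculus

variable {A : Type*} [CommRing A]

/-- The `j`-th divided derivative `z ^ p ↦ (p choose j) z ^ (p - j)` of Laurent polynomials. -/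
noncomputable def hasse (j : ℕ) : A[T;T⁻¹] →ₗ[A] A[T;T⁻¹] :=
  Finsupp.linearCombination A (fun p : ℤ => (Ring.choose p j : ℤ) • (T (p - j) : A[T;T⁻¹])) ∘ₗ
    (AddMonoidAlgebra.coeffLinearEquiv A).toLinearMap

theorem hasse_C_mul_T (j : ℕ) (a : A) (p : ℤ) :
    hasse j (C a * T p) = a • (Ring.choose p j : ℤ) • (T (p - j) : A[T;T⁻¹]) := by
  rw [← single_eq_C_mul_T]
  exact Finsupp.linearCombination_single A a p

theorem hasse_zero (g : A[T;T⁻¹]) : hasse 0 g = g := by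
  induction g using LaurentPolynomial.induction_on' with
  | add p q hp hq => rw [map_add, hp, hq]
  | C_mul_T n a => rw [hasse_C_mul_T]; simp [smul_eq_C_mul]

/-- The derivation `d/dz`. -/
noncomputable def deriv : Derivation A A[T;T⁻¹] A[T;T⁻¹] :=
  Derivation.mk' (hasse 1) fun f g => by
    induction f using LaurentPolynomial.induction_on' with
    | add p q hp hq => rw [add_mul, map_add, hp, hq, map_add]; simp only [smul_eq_mul]; ring
    | C_mul_T n a =>
      induction g using LaurentPolynomial.induction_on' with
      | add p q hp hq => rw [mul_add, map_add, hp, hq, map_add]; simp only [smul_eq_mul]; ring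
      | C_mul_T m b =>
        rw [show (C a * T n * (C b * T m) : A[T;T⁻¹]) = C (a * b) * T (n + m) by
          rw [T_add, map_mul]; ring]
        rw [hasse_C_mul_T, hasse_C_mul_T, hasse_C_mul_T]
        simp only [Ring.choose_one_right, smul_eq_mul, smul_eq_C_mul, T_sub, T_add,
          zsmul_eq_mul, map_mul, Nat.cast_one]
        push_cast
        ring

theorem deriv_apply (g : A[T;T⁻¹]) : deriv g = hasse 1 g := rfl

theorem deriv_T_one : deriv (T 1 : A[T;T⁻¹]) = 1 := by
  have := hasse_C_mul_T 1 (1 : A) 1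
  rw [deriv_apply]
  simpa using this

theorem deriv_C (a : A) : deriv (C a : A[T;T⁻¹]) = 0 :=
  deriv.map_algebraMap a

/-- The Laurent polynomials of degree at most `d`, that is, of order `O(z ^ d)` at infinity. -/
noncomputable def growth (A : Type*) [CommRing A] (d : ℤ) : Submodule A A[T;T⁻¹] where
  carrier := {g | ∀ m, d < m → g.coeff m = 0}
  add_mem' {f g} hf hg m hm := by simp [hf m hm, hg m hm]
  zero_mem' := by simp
  smul_mem' c g hg m hm := by simp [hg m hm]

theorem mem_growth {d : ℤ} {g : A[T;T⁻¹]} : g ∈ growth A d ↔ ∀ m, d < m → g.coeff m = 0 := Iff.rfl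

theorem growth_mono {d e : ℤ} (h : d ≤ e) : growth A d ≤ growth A e :=
  fun _ hg m hm => hg m (by omega)

theorem C_mul_T_mem_growth (a : A) {n d : ℤ} (h : n ≤ d) : (C a * T n : A[T;T⁻¹]) ∈ growth A d := by
  intro m hm
  rw [← single_eq_C_mul_T, AddMonoidAlgebra.coeff_single, Finsupp.single_eq_of_ne (by omega)]

theorem eq_sum_C_mul_T (g : A[T;T⁻¹]) : g = ∑ m ∈ g.coeff.support, C (g.coeff m) * T m := by
  conv_lhs => rw [← AddMonoidAlgebra.sum_coeff_single g]
  simp only [Finsupp.sum, single_eq_C_mul_T]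

theorem mul_mem_growth {d e : ℤ} {f g : A[T;T⁻¹]} (hf : f ∈ growth A d) (hg : g ∈ growth A e) :
    f * g ∈ growth A (d + e) := by
  rw [eq_sum_C_mul_T f, eq_sum_C_mul_T g, Finset.sum_mul_sum]
  refine Submodule.sum_mem _ fun m hm => Submodule.sum_mem _ fun n hn => ?_
  have hm' : m ≤ d := by
    by_contra h
    exact (Finsupp.mem_support_iff.1 hm) (hf m (by omega))
  have hn' : n ≤ e := by
    by_contra h
    exact (Finsupp.mem_support_iff.1 hn) (hg n (by omega))
  rw [show (C (f.coeff m) * T m * (C (g.coeff n) * T n) : A[T;T⁻¹]) =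
    C (f.coeff m * g.coeff n) * T (m + n) by rw [T_add, map_mul]; ring]
  exact C_mul_T_mem_growth _ (by omega)

theorem pow_mem_growth {d : ℤ} {f : A[T;T⁻¹]} (hf : f ∈ growth A d) (n : ℕ) :
    f ^ n ∈ growth A (n * d) := by
  induction n with
  | zero => simpa using C_mul_T_mem_growth (1 : A) (n := 0) (d := 0) le_rfl
  | succ n ih =>
    have := mul_mem_growth ih hf
    rwa [← pow_succ, show (n : ℤ) * d + d = (n + 1 : ℕ) * d by push_cast; ring] at this

/-- The ideal of Laurent polynomials vanishing to order at least `h` at each of the points `u l`. -/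
noncomputable def vanishing {ι : Type*} (u : ι → A) (h : ℕ) : Ideal A[T;T⁻¹] :=
  ⨅ l, Ideal.span {(T 1 - C (u l)) ^ h}

theorem mem_vanishing {ι : Type*} {u : ι → A} {h : ℕ} {g : A[T;T⁻¹]} :
    g ∈ vanishing u h ↔ ∀ l, (T 1 - C (u l)) ^ h ∣ g := by
  simp [vanishing, Ideal.mem_span_singleton]

theorem vanishing_anti {ι : Type*} (u : ι → A) {h h' : ℕ} (hh : h ≤ h') :
    vanishing u h' ≤ vanishing u h := fun _ hg =>
  mem_vanishing.2 fun l => (pow_dvd_pow _ hh).trans (mem_vanishing.1 hg l)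

theorem deriv_mem_vanishing {ι : Type*} {u : ι → A} {h : ℕ} {g : A[T;T⁻¹]}
    (hg : g ∈ vanishing u (h + 1)) : deriv g ∈ vanishing u h := by
  refine mem_vanishing.2 fun l => ?_
  obtain ⟨q, rfl⟩ := mem_vanishing.1 hg l
  rw [Derivation.leibniz, Derivation.leibniz_pow, smul_eq_mul, smul_eq_mul, add_tsub_cancel_right,
    nsmul_eq_mul, smul_eq_mul, pow_succ]
  exact Dvd.intro ((T 1 - C (u l)) * deriv q + q * (((h + 1 : ℕ) : A[T;T⁻¹]) *
    deriv (T 1 - C (u l)))) (by ring)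

variable [Algebra ℂ A]

/-- The extension of a derivation of `A` to `A[z, z⁻¹]` that kills `z`. -/
noncomputable def mapDerivation (d : Derivation ℂ A A) : Derivation ℂ A[T;T⁻¹] A[T;T⁻¹] :=
  Derivation.mk' ((AddMonoidAlgebra.coeffLinearEquiv ℂ).symm.toLinearMap ∘ₗ
    Finsupp.mapRange.linearMap d.toLinearMap ∘ₗ
    (AddMonoidAlgebra.coeffLinearEquiv ℂ).toLinearMap) fun f g => by
    have key : ∀ (a : A) (n : ℤ), ((AddMonoidAlgebra.coeffLinearEquiv ℂ).symm.toLinearMap ∘ₗ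
      Finsupp.mapRange.linearMap d.toLinearMap ∘ₗ
      (AddMonoidAlgebra.coeffLinearEquiv ℂ).toLinearMap) (C a * T n : A[T;T⁻¹]) =
        C (d a) * T n := fun a n => by
      rw [← single_eq_C_mul_T, ← single_eq_C_mul_T]
      simp only [LinearMap.comp_apply]
      apply AddMonoidAlgebra.coeff_injective
      exact Finsupp.mapRange_single (hf := map_zero d)
    induction f using LaurentPolynomial.induction_on' with
    | add p q hp hq => rw [add_mul, map_add, hp, hq, map_add]; simp only [smul_eq_mul]; ring
    | C_mul_T n a =>
      induction g using LaurentPolynomial.induction_on' with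
      | add p q hp hq => rw [mul_add, map_add, hp, hq, map_add]; simp only [smul_eq_mul]; ring
      | C_mul_T m b =>
        rw [show (C a * T n * (C b * T m) : A[T;T⁻¹]) = C (a * b) * T (n + m) by
          rw [T_add, map_mul]; ring, key, key, key, d.leibniz]
        simp only [smul_eq_mul, T_add, map_add, map_mul]
        ring

theorem coeff_mapDerivation (d : Derivation ℂ A A) (g : A[T;T⁻¹]) (m : ℤ) :
    (mapDerivation d g).coeff m = d (g.coeff m) := rfl

theorem mapDerivation_C_mul_T (d : Derivation ℂ A A) (a : A) (n : ℤ) :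
    mapDerivation d (C a * T n) = C (d a) * T n := by
  apply AddMonoidAlgebra.coeff_injective
  ext m
  rw [coeff_mapDerivation, ← single_eq_C_mul_T, ← single_eq_C_mul_T,
    AddMonoidAlgebra.coeff_single, AddMonoidAlgebra.coeff_single, Finsupp.single_apply,
    Finsupp.single_apply, apply_ite d, map_zero]

theorem mapDerivation_C (d : Derivation ℂ A A) (a : A) : mapDerivation d (C a) = C (d a) := by
  simpa using mapDerivation_C_mul_T d a 0

theorem mapDerivation_T (d : Derivation ℂ A A) (n : ℤ) :
    mapDerivation d (T n : A[T;T⁻¹]) = 0 := by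
  simpa using mapDerivation_C_mul_T d 1 n

theorem mapDerivation_mem_growth (d : Derivation ℂ A A) {e : ℤ} {g : A[T;T⁻¹]}
    (hg : g ∈ growth A e) : mapDerivation d g ∈ growth A e := fun m hm => by
  rw [coeff_mapDerivation, hg m hm, map_zero]

end Calculus

section Derivation

/-- A derivation that preserves the ideal generated by `x` preserves the ideals generated by the
powers of `x`. -/
theorem _root_.Derivation.pow_dvd_apply {S R : Type*} [CommRing S] [CommRing R] [Algebra R S]
    (δ : Derivation R S S) {x g : S} (hx : x ∣ δ x) {n : ℕ} (hg : x ^ n ∣ g) : x ^ n ∣ δ g := by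
  obtain ⟨q, rfl⟩ := hg
  rw [Derivation.leibniz, Derivation.leibniz_pow]
  refine dvd_add (Dvd.intro _ rfl) (Dvd.dvd.mul_left ?_ _)
  rcases n with _ | n
  · simp
  · obtain ⟨y, hy⟩ := hx
    rw [hy, add_tsub_cancel_right, nsmul_eq_mul, smul_eq_mul, pow_succ]
    exact Dvd.intro (((n + 1 : ℕ) : S) * y) (by ring)

end Derivation

end LaurentPolynomial

namespace ChiralCFT

open LaurentPolynomial

variable {H : Type*} [AddCommGroup H] [Module ℂ H] (T : ChiralCFT H)
  {A : Type*} [CommRing A] [Algebra ℂ A]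

/-! ### States with coefficients in a ring of parameters -/

/-- The `A`-module `A ⊗ H` of families of states that depend on parameters through the `ℂ`-algebra
`A`. -/
def States (A H : Type*) [CommRing A] [Algebra ℂ A] [AddCommGroup H] [Module ℂ H] : Type _ :=
  A ⊗[ℂ] H

namespace States

noncomputable instance : AddCommGroup (States A H) := inferInstanceAs (AddCommGroup (A ⊗[ℂ] H))
noncomputable instance : Module A (States A H) := inferInstanceAs (Module A (A ⊗[ℂ] H))
noncomputable instance : Module ℂ (States A H) := inferInstanceAs (Module ℂ (A ⊗[ℂ] H))
instance : IsScalarTower ℂ A (States A H) := inferInstanceAs (IsScalarTower ℂ A (A ⊗[ℂ] H))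

variable (A) in
/-- The constant family `1 ⊗ χ`. -/
noncomputable def const : H →ₗ[ℂ] States A H where
  toFun χ := (1 : A) ⊗ₜ[ℂ] χ
  map_add' := TensorProduct.tmul_add 1
  map_smul' c χ := (TensorProduct.tmul_smul c 1 χ)

theorem induction_on {p : States A H → Prop} (x : States A H) (zero : p 0)
    (smul : ∀ (a : A) (χ : H), p (a • const A χ)) (add : ∀ x y, p x → p y → p (x + y)) : p x := by
  refine TensorProduct.induction_on (motive := p) x zero (fun a χ => ?_) add
  have h : (a • (1 : A) ⊗ₜ[ℂ] χ : A ⊗[ℂ] H) = a ⊗ₜ χ := by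
    rw [TensorProduct.smul_tmul', smul_eq_mul, mul_one]
  rw [← h]
  exact smul a χ

/-- The universal property of `A ⊗ H`. -/
noncomputable def lift {N : Type*} [AddCommGroup N] [Module A N] [Module ℂ N] [IsScalarTower ℂ A N]
    (f : H →ₗ[ℂ] N) : States A H →ₗ[A] N :=
  TensorProduct.AlgebraTensorModule.lift
    ((LinearMap.toSpanSingleton A (H →ₗ[ℂ] N) f : A →ₗ[A] H →ₗ[ℂ] N))

theorem lift_const {N : Type*} [AddCommGroup N] [Module A N] [Module ℂ N] [IsScalarTower ℂ A N]
    (f : H →ₗ[ℂ] N) (χ : H) : lift f (const A χ) = f χ := by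
  refine (TensorProduct.lift.tmul _ _).trans ?_
  simp

theorem hom_ext {N : Type*} [AddCommGroup N] [Module A N] {f g : States A H →ₗ[A] N}
    (h : ∀ χ, f (const A χ) = g (const A χ)) : f = g := by
  ext x
  induction x using induction_on with
  | zero => simp
  | smul a χ => rw [map_smul, map_smul, h]
  | add x y hx hy => rw [map_add, map_add, hx, hy]

variable (A) in
/-- The `A`-linear extension of an operator on `H`. -/
noncomputable def extend : Module.End ℂ H →+* Module.End A (States A H) where
  toFun f := lift (const A ∘ₗ f)
  map_zero' := hom_ext fun χ => by rw [lift_const]; simp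
  map_one' := hom_ext fun χ => by rw [lift_const]; simp
  map_add' f g := hom_ext fun χ => by simp [lift_const]
  map_mul' f g := hom_ext fun χ => by simp [lift_const]

theorem extend_const (f : Module.End ℂ H) (χ : H) : extend A f (const A χ) = const A (f χ) :=
  lift_const _ _

theorem extend_smul (c : ℂ) (f : Module.End ℂ H) :
    extend A (c • f) = algebraMap ℂ A c • extend A f :=
  hom_ext fun χ => by
    rw [extend_const, LinearMap.smul_apply, LinearMap.smul_apply, extend_const, map_smul,
      algebraMap_smul]

end States

open States

/-! ### Smeared fields over a ring of parameters -/

/-- The residue `(2πi)⁻¹ ∮₀ dz g(z) V(a, z)` for a Laurent polynomial `g` with coefficients in a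
`ℂ`-algebra `A`, acting on `A ⊗ H`. -/
noncomputable def smear (a : H) : A[T;T⁻¹] →ₗ[A] Module.End A (States A H) :=
  Finsupp.linearCombination A (fun m : ℤ => extend A ((T.Y a)[[m]])) ∘ₗ
    (AddMonoidAlgebra.coeffLinearEquiv A).toLinearMap

theorem smear_apply (a : H) (g : A[T;T⁻¹]) : T.smear a g =
    ∑ m ∈ g.coeff.support, g.coeff m • extend A ((T.Y a)[[m]]) := rfl

theorem smear_T (a : H) (n : ℤ) : T.smear a (LaurentPolynomial.T n : A[T;T⁻¹]) =
    extend A ((T.Y a)[[n]]) := by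
  have := Finsupp.linearCombination_single A (1 : A) n
    (v := fun m : ℤ => extend A ((T.Y a)[[m]]))
  rw [one_smul] at this
  exact this

theorem smear_C_mul_T (a : H) (c : A) (n : ℤ) :
    T.smear a (C c * LaurentPolynomial.T n : A[T;T⁻¹]) = c • extend A ((T.Y a)[[n]]) := by
  rw [← smul_eq_C_mul, map_smul, smear_T]

theorem smear_add_left (a b : H) (g : A[T;T⁻¹]) :
    T.smear (a + b) g = T.smear a g + T.smear b g := by
  simp [smear_apply, Finset.sum_add_distrib]

theorem smear_smul_left (c : ℂ) (a : H) (g : A[T;T⁻¹]) :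
    T.smear (c • a) g = T.smear a (algebraMap ℂ A c • g) := by
  rw [map_smul]
  simp only [smear_apply, map_smul, Pi.smul_apply, Finset.smul_sum]
  refine Finset.sum_congr rfl fun m _ => ?_
  rw [extend_smul, smul_comm]

theorem smear_zero_left (g : A[T;T⁻¹]) : T.smear 0 g = 0 := by
  simp [smear_apply]

/-- The commutator formula for smeared fields. -/
theorem smear_commutator (a b : H) (f g : A[T;T⁻¹]) (J : ℕ)
    (hJ : ∀ j : ℕ, J ≤ j → ((T.Y a)[[(j : ℤ)]]) b = 0) :
    T.smear a f * T.smear b g - T.smear b g * T.smear a f =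
      ∑ j ∈ Finset.range J, T.smear (((T.Y a)[[(j : ℤ)]]) b) (hasse j f * g) := by
  induction f using LaurentPolynomial.induction_on' with
  | add p q hp hq =>
    simp only [map_add, add_mul, mul_add, Finset.sum_add_distrib, ← hp, ← hq]
    abel
  | C_mul_T p c =>
    induction g using LaurentPolynomial.induction_on' with
    | add p q hp hq =>
      simp only [map_add, add_mul, mul_add, Finset.sum_add_distrib, ← hp, ← hq]
      abel
    | C_mul_T q e =>
      have h : ((T.Y a)[[p]]) * ((T.Y b)[[q]]) - ((T.Y b)[[q]]) * ((T.Y a)[[p]]) =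
          ∑ j ∈ Finset.range J,
            (Ring.choose p j : ℤ) • ((T.Y (((T.Y a)[[(j : ℤ)]]) b))[[p + q - j]]) := by
        ext d
        simpa using T.mode_commutator a b d p q J hJ
      rw [smear_C_mul_T, smear_C_mul_T, smul_mul_smul_comm, smul_mul_smul_comm, mul_comm e c,
        ← smul_sub, ← map_mul, ← map_mul, ← map_sub, h, map_sum, Finset.smul_sum]
      refine Finset.sum_congr rfl fun j _ => ?_
      rw [hasse_C_mul_T, map_zsmul, ← T.smear_T, ← map_zsmul, ← map_smul]
      congr 1
      rw [smul_eq_C_mul, smul_eq_C_mul, map_mul, show p + q - j = (p - j) + q by ring, T_add,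
        zsmul_eq_mul, zsmul_eq_mul]
      ring

/-- Integration by parts. -/
theorem smear_L_neg_one (a : H) (g : A[T;T⁻¹]) :
    T.smear (T.L (-1) a) g = -T.smear a (deriv g) := by
  induction g using LaurentPolynomial.induction_on' with
  | add p q hp hq => rw [map_add, hp, hq, map_add, map_add]; abel
  | C_mul_T n c =>
    have h : ((T.Y (T.L (-1) a))[[n]]) = -(n • ((T.Y a)[[n - 1]])) := by
      ext d
      simpa using T.Y_L_neg_one a d n
    rw [smear_C_mul_T, h, deriv_apply, hasse_C_mul_T, map_smul, map_zsmul, Nat.cast_one, smear_T,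
      map_neg, map_zsmul, Ring.choose_one_right, smul_neg]

/-- The extension of a derivation of `A` to `A ⊗ H`. -/
noncomputable def tensorDerivation (H : Type*) [AddCommGroup H] [Module ℂ H]
    (d : Derivation ℂ A A) : States A H →ₗ[ℂ] States A H :=
  LinearMap.rTensor H d.toLinearMap

theorem tensorDerivation_smul_const (d : Derivation ℂ A A) (a : A) (χ : H) :
    tensorDerivation H d (a • const A χ) = d a • const A χ := by
  change LinearMap.rTensor H d.toLinearMap (a • (1 : A) ⊗ₜ[ℂ] χ) = d a • (1 : A) ⊗ₜ[ℂ] χ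
  simp only [TensorProduct.smul_tmul', smul_eq_mul, mul_one]
  rfl

theorem tensorDerivation_const (d : Derivation ℂ A A) (χ : H) :
    tensorDerivation H d (const A χ) = 0 := by
  simpa using tensorDerivation_smul_const d (1 : A) χ

theorem tensorDerivation_smul (d : Derivation ℂ A A) (a : A) (x : States A H) :
    tensorDerivation H d (a • x) = d a • x + a • tensorDerivation H d x := by
  induction x using States.induction_on with
  | zero => simp
  | smul b χ =>
    rw [smul_smul, tensorDerivation_smul_const, tensorDerivation_smul_const, d.leibniz, add_smul,
      smul_smul, smul_smul, smul_eq_mul, smul_eq_mul, mul_comm b, add_comm]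
  | add x y hx hy =>
    rw [smul_add, map_add, hx, hy, smul_add, map_add, smul_add]
    abel

theorem tensorDerivation_smear (d : Derivation ℂ A A) (a : H) (g : A[T;T⁻¹]) (x : States A H) :
    tensorDerivation H d (T.smear a g x) =
      T.smear a (mapDerivation d g) x + T.smear a g (tensorDerivation H d x) := by
  induction g using LaurentPolynomial.induction_on' with
  | add p q hp hq => simp only [map_add, LinearMap.add_apply, hp, hq]; abel
  | C_mul_T n c =>
    rw [mapDerivation_C_mul_T, smear_C_mul_T, smear_C_mul_T]
    induction x using States.induction_on with
    | zero => simp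
    | smul b χ =>
      simp only [LinearMap.smul_apply, map_smul, extend_const, tensorDerivation_smul,
        tensorDerivation_const, smul_zero, add_zero]
      exact add_comm _ _
    | add x y hx hy => simp only [map_add, hx, hy]; abel

/-- The vacuum expectation value with coefficients in `A`. -/
noncomputable def vevA : States A H →ₗ[A] A :=
  lift (Algebra.linearMap ℂ A ∘ₗ T.vev)

theorem vevA_const (χ : H) : T.vevA (const A χ) = algebraMap ℂ A (T.vev χ) :=
  lift_const _ _

theorem vevA_smear_const (a : H) (g : A[T;T⁻¹]) (χ : H) :
    T.vevA (T.smear a g (const A χ)) =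
      ∑ m ∈ g.coeff.support, T.vev (((T.Y a)[[m]]) χ) • g.coeff m := by
  simp [smear_apply, LinearMap.sum_apply, extend_const, vevA_const, Algebra.smul_def, mul_comm]

/-- A smeared quasiprimary field that is regular at infinity has vanishing vacuum expectation
values. -/
theorem vevA_smear_eq_zero {h : ℕ} {ψ : H} (hψ : ψ ∈ T.quasiprimary h) {g : A[T;T⁻¹]}
    (hg : g ∈ growth A (2 * h - 2)) (x : States A H) : T.vevA (T.smear ψ g x) = 0 := by
  induction x using States.induction_on with
  | zero => simp
  | smul b χ =>
    rw [map_smul, map_smul, vevA_smear_const]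
    refine smul_eq_zero_of_right _ ?_
    refine Finset.sum_eq_zero fun m hm => ?_
    rw [T.vev_mode_eq_zero hψ, zero_smul]
    by_contra h
    exact (Finsupp.mem_support_iff.1 hm) (hg m (by omega))
  | add x y hx hy => rw [map_add, map_add, hx, hy, add_zero]

/-! ### Operators with the prescribed zeros -/

variable {ι : Type*} (u : ι → A)

/-- The span of the operators `(2πi)⁻¹ ∮₀ dz g(z) V(a, z)`, where `a` is any state of weight `h` and
`g` vanishes to order `h` at the points `u l`, without a condition at infinity. -/
noncomputable def localOps : Submodule A (Module.End A (States A H)) :=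
  Submodule.span A {B | ∃ (h : ℕ) (a : H) (g : A[T;T⁻¹]),
    a ∈ T.wt h ∧ g ∈ vanishing u h ∧ B = T.smear a g}

/-- The family of the spaces `O_u` over the ring of parameters `A`. -/
noncomputable def familyO : Submodule A (States A H) :=
  Submodule.span A {x | ∃ (h : ℕ) (ψ : H) (g : A[T;T⁻¹]) (y : States A H),
    ψ ∈ T.quasiprimary h ∧ g ∈ vanishing u h ∧ g ∈ growth A (2 * h - 2) ∧ x = T.smear ψ g y}

variable {u}

theorem smear_mem_localOps {d : ℤ} {h : ℕ} (hd : d ≤ h) {a : H} (ha : a ∈ T.wt d) {g : A[T;T⁻¹]}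
    (hg : g ∈ vanishing u h) : T.smear a g ∈ T.localOps u := by
  rcases lt_or_ge d 0 with hneg | hpos
  · rw [T.wt_eq_bot_of_neg hneg, Submodule.mem_bot] at ha
    rw [ha, smear_zero_left]
    exact zero_mem _
  · lift d to ℕ using hpos
    exact Submodule.subset_span ⟨d, a, g, ha, vanishing_anti u (by exact_mod_cast hd) hg, rfl⟩

/-- Modulo total derivatives only quasiprimary states are needed. -/
theorem smear_mem_span_quasiprimary (h : ℕ) (a : H) (g : A[T;T⁻¹]) (ha : a ∈ T.wt h)
    (hg : g ∈ vanishing u h) :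
    T.smear a g ∈ Submodule.span A {B | ∃ (h : ℕ) (ψ : H) (g : A[T;T⁻¹]),
      ψ ∈ T.quasiprimary h ∧ g ∈ vanishing u h ∧ B = T.smear ψ g} := by
  induction h generalizing a g with
  | zero =>
    exact Submodule.subset_span ⟨0, a, g, T.mem_quasiprimary_zero.2 (by simpa using ha), hg, rfl⟩
  | succ h ih =>
    obtain ⟨y, hy, ψ, hψ, rfl⟩ := T.exists_quasiprimary_add ha
    rw [smear_add_left, smear_L_neg_one]
    exact add_mem (neg_mem (ih y _ hy (deriv_mem_vanishing hg)))
      (Submodule.subset_span ⟨_, ψ, g, hψ, hg, rfl⟩)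

/-- The matrix elements of a smeared quasiprimary field between the out-vacuum and a descendant of a
quasiprimary state give the coefficients that have to vanish for regularity at infinity. -/
theorem vevA_smear_descendant {h h' : ℕ} {ψ φ : H} (hψ : ψ ∈ T.quasiprimary h)
    (hφ : φ ∈ T.quasiprimary h') (g : A[T;T⁻¹]) (s : ℕ) :
    T.vevA (T.smear ψ g (const A ((T.L (-1) ^ s) φ))) =
      if h = h' then ((∏ i ∈ Finset.range s, (((2 * h' - 1 + s : ℤ) : ℂ) - i)) *
        T.vev (((T.Y ψ)[[2 * (h' : ℤ) - 1]]) φ)) • g.coeff (2 * h' - 1 + s) else 0 := by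
  rw [vevA_smear_const]
  have h0 : ∀ m : ℤ, ¬ (h = h' ∧ m = 2 * h' - 1 + s) →
      T.vev (((T.Y ψ)[[m]]) ((T.L (-1) ^ s) φ)) = 0 := fun m hm => by
    rw [vev_mode_L_neg_one_pow, T.vev_quasiprimary hψ hφ _ (by omega), mul_zero]
  split_ifs with hh
  · rw [Finset.sum_eq_single (2 * h' - 1 + s : ℤ), vev_mode_L_neg_one_pow]
    · simp
    · intro m _ hm
      rw [h0 m (by tauto), zero_smul]
    · intro hm
      rw [Finsupp.notMem_support_iff.1 hm]
      simp
  · refine Finset.sum_eq_zero fun m _ => ?_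
    rw [h0 m (by tauto), zero_smul]

/-- A quasiprimary state of weight zero is a multiple of the vacuum, whose field is the identity. So
only the coefficient of `z⁻¹` matters. -/
theorem smear_vac_eq_zero {ψ : H} (hψ : ψ ∈ T.quasiprimary 0) {g : A[T;T⁻¹]}
    (hg : g.coeff (-1) = 0) : T.smear ψ g = 0 := by
  have h2 : ψ ∈ Module.End.eigenspace ((T.Y T.conf)[[1]]) 0 := by
    simpa [wt, L] using (T.mem_quasiprimary_zero.1 hψ)
  rw [T.unique_vacuum, Submodule.mem_span_singleton] at h2
  obtain ⟨c, rfl⟩ := h2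
  rw [smear_smul_left, map_smul, smear_apply, Finset.sum_eq_zero, smul_zero]
  intro m _
  by_cases hm : m = -1
  · rw [hm, hg, zero_smul]
  · have : ((T.Y T.vac)[[m]]) = 0 := by
      ext b
      rw [T.vacuum, if_neg hm]
      rfl
    rw [this, map_zero, smul_zero]

theorem smear_sum_left {κ : Type*} (s : Finset κ) (a : κ → H) (g : A[T;T⁻¹]) :
    T.smear (∑ i ∈ s, a i) g = ∑ i ∈ s, T.smear (a i) g := by
  classical
  induction s using Finset.induction_on with
  | empty => simp [smear_zero_left]
  | insert i s hi ih => rw [Finset.sum_insert hi, Finset.sum_insert hi, smear_add_left, ih]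

instance (h : ℕ) : FiniteDimensional ℂ (T.quasiprimary h) := T.finite_quasiprimary h

/-- The index set of a basis of the direct sum of the spaces of quasiprimary states. -/
abbrev QuasiIndex : Type := Σ h : ℕ, Fin (Module.finrank ℂ (T.quasiprimary h))

/-- A basis of the direct sum of the spaces of quasiprimary states. -/
noncomputable def quasi (i : T.QuasiIndex) : H := Module.finBasis ℂ (T.quasiprimary i.1) i.2

theorem quasi_mem (i : T.QuasiIndex) : T.quasi i ∈ T.quasiprimary i.1 :=
  (Module.finBasis ℂ (T.quasiprimary i.1) i.2).2

/-- Test states that separate the basis `quasi`. -/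
theorem exists_quasi_dual (i : T.QuasiIndex) : ∃ φ ∈ T.quasiprimary i.1,
    ∀ α, T.vev (((T.Y (T.quasi ⟨i.1, α⟩))[[2 * (i.1 : ℤ) - 1]]) φ) = if α = i.2 then 1 else 0 := by
  obtain ⟨φ, hφ, h⟩ :=
    T.exists_quasiprimary_dual ((Module.finBasis ℂ (T.quasiprimary i.1)).coord i.2)
  refine ⟨φ, hφ, fun α => ?_⟩
  have := h (Module.finBasis ℂ (T.quasiprimary i.1) α)
  rw [Module.Basis.coord_apply, Module.Basis.repr_self, Finsupp.single_apply] at this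
  exact this

theorem smear_mem_span_quasi {h : ℕ} {ψ : H} {g : A[T;T⁻¹]} (hψ : ψ ∈ T.quasiprimary h)
    (hg : g ∈ vanishing u h) :
    T.smear ψ g ∈ Submodule.span A {B | ∃ (i : T.QuasiIndex) (g : A[T;T⁻¹]),
      g ∈ vanishing u i.1 ∧ B = T.smear (T.quasi i) g} := by
  have hsum := (Module.finBasis ℂ (T.quasiprimary h)).sum_repr ⟨ψ, hψ⟩
  have hsum' := congrArg Subtype.val hsum
  rw [AddSubmonoidClass.coe_finsetSum] at hsum'
  have h1 : ψ = ∑ α, (Module.finBasis ℂ (T.quasiprimary h)).repr ⟨ψ, hψ⟩ α • T.quasi ⟨h, α⟩ :=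
    hsum'.symm
  rw [h1, smear_sum_left]
  refine Submodule.sum_mem _ fun α _ => ?_
  rw [smear_smul_left]
  refine Submodule.subset_span ⟨⟨h, α⟩, _, ?_, rfl⟩
  rw [smul_eq_C_mul]
  exact Ideal.mul_mem_left _ _ hg

/-- Normal form of the operators with the prescribed zeros. -/
theorem exists_eq_sum_quasi {B : Module.End A (States A H)} (hB : B ∈ T.localOps u) :
    ∃ x : T.QuasiIndex →₀ A[T;T⁻¹], (∀ i, x i ∈ vanishing u i.1) ∧
      B = x.sum fun i g => T.smear (T.quasi i) g := by
  have hle : T.localOps u ≤ Submodule.span A {B | ∃ (i : T.QuasiIndex) (g : A[T;T⁻¹]),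
      g ∈ vanishing u i.1 ∧ B = T.smear (T.quasi i) g} := by
    refine Submodule.span_le.2 ?_
    rintro B ⟨h, a, g, ha, hg, rfl⟩
    refine (Submodule.span_le.2 ?_) (T.smear_mem_span_quasiprimary h a g ha hg)
    rintro B ⟨h, ψ, g, hψ, hg, rfl⟩
    exact T.smear_mem_span_quasi hψ hg
  have hB' := hle hB
  clear hle hB
  induction hB' using Submodule.span_induction with
  | mem B hB =>
    obtain ⟨i, g, hg, rfl⟩ := hB
    refine ⟨Finsupp.single i g, fun j => ?_, by simp⟩
    classical
    rw [Finsupp.single_apply]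
    split_ifs with hij
    · exact hij ▸ hg
    · exact zero_mem _
  | zero => exact ⟨0, fun i => zero_mem _, by simp⟩
  | add B B' _ _ h h' =>
    obtain ⟨x, hx, rfl⟩ := h
    obtain ⟨y, hy, rfl⟩ := h'
    refine ⟨x + y, fun i => add_mem (hx i) (hy i), ?_⟩
    classical
    rw [Finsupp.sum_add_index] <;> simp
  | smul c B _ h =>
    obtain ⟨x, hx, rfl⟩ := h
    refine ⟨c • x, fun i => ?_, ?_⟩
    · rw [Finsupp.smul_apply, smul_eq_C_mul]
      exact Ideal.mul_mem_left _ _ (hx i)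
    · rw [Finsupp.sum_smul_index' (by simp), Finsupp.smul_sum]
      simp

/-- An operator with the prescribed zeros whose adjoint annihilates the out-vacuum is regular at
infinity, so that its range lies in `O_u`. -/
theorem apply_mem_familyO {B : Module.End A (States A H)} (hB : B ∈ T.localOps u)
    (hv : ∀ x, T.vevA (B x) = 0) (y : States A H) : B y ∈ T.familyO u := by
  obtain ⟨x, hx, rfl⟩ := T.exists_eq_sum_quasi hB
  -- Testing against the descendants of a dual state isolates one coefficient at a time.
  have hcoeff : ∀ (i : T.QuasiIndex) (s : ℕ),
      (∏ j ∈ Finset.range s, (((2 * (i.1 : ℤ) - 1 + s : ℤ) : ℂ) - j)) •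
        (x i).coeff (2 * i.1 - 1 + s) = 0 := by
    intro i s
    obtain ⟨φ, hφ, hφα⟩ := T.exists_quasi_dual i
    have h1 := hv (const A ((T.L (-1) ^ s) φ))
    rw [Finsupp.sum, LinearMap.sum_apply, map_sum, Finset.sum_eq_single i] at h1
    · have := hφα i.2
      rw [T.vevA_smear_descendant (T.quasi_mem i) hφ, if_pos rfl] at h1
      rw [if_pos rfl] at this
      rwa [this, mul_one] at h1
    · rintro ⟨h', β⟩ _ hne
      rw [T.vevA_smear_descendant (T.quasi_mem _) hφ]
      split_ifs with hh
      · obtain ⟨h, α⟩ := i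
        obtain rfl : h' = h := hh
        have hβ : β ≠ α := fun hβ => hne (by rw [hβ])
        have := hφα β
        rw [if_neg hβ] at this
        rw [this, mul_zero, zero_smul]
      · rfl
    · intro hi
      rw [Finsupp.notMem_support_iff.1 hi]
      simp
  rw [Finsupp.sum, LinearMap.sum_apply]
  refine Submodule.sum_mem _ fun i _ => ?_
  rcases Nat.eq_zero_or_pos i.1 with hi | hi
  · rw [T.smear_vac_eq_zero (by simpa [hi] using T.quasi_mem i) (by simpa [hi] using hcoeff i 0)]
    exact zero_mem _
  · refine Submodule.subset_span ⟨i.1, T.quasi i, x i, y, T.quasi_mem i, hx i, fun m hm => ?_, rfl⟩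
    obtain ⟨s, rfl⟩ : ∃ s : ℕ, m = 2 * i.1 - 1 + s := ⟨(m - (2 * i.1 - 1)).toNat, by omega⟩
    refine (smul_eq_zero.1 (hcoeff i s)).resolve_left ?_
    refine Finset.prod_ne_zero_iff.2 fun j hj => ?_
    rw [Finset.mem_range] at hj
    have : (2 * (i.1 : ℤ) - 1 + s - j : ℤ) ≠ 0 := by omega
    exact_mod_cast this

end ChiralCFT

/-! ### The connection over the ring of parameters -/

open LaurentPolynomial in
/-- Parameters `u i ∈ A` with commuting derivations `∂ / ∂ u i` of `A` and Laurent polynomials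
`f i ∈ A[z, z⁻¹]` satisfying the conditions of `IsKZFunction`. -/
structure KZData (A : Type*) [CommRing A] [Algebra ℂ A] (k : ℕ) where
  /-- the marked points -/
  u : Fin k → A
  /-- the partial derivatives -/
  d : Fin k → Derivation ℂ A A
  /-- the coefficient functions of the connection -/
  f : Fin k → A[T;T⁻¹]
  d_u : ∀ i j, d i (u j) = if i = j then 1 else 0
  d_comm : ∀ i j a, d i (d j a) = d j (d i a)
  f_growth : ∀ i, f i ∈ growth A (-2)
  f_vanishing : ∀ i l, (LaurentPolynomial.T 1 - C (u l)) ^ 2 ∣ f i - if i = l then 1 else 0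

namespace KZData

open LaurentPolynomial

variable {A : Type*} [CommRing A] [Algebra ℂ A] {k : ℕ} (K : KZData A k)

/-- The derivation `∂ᵢ + fⁱ d/dz`, which moves the point `u i` along with the parameter, so that it
preserves the orders of vanishing at all the points `u l`. -/
noncomputable def flow (i : Fin k) : Derivation ℂ A[T;T⁻¹] A[T;T⁻¹] :=
  mapDerivation (K.d i) + K.f i • deriv.restrictScalars ℂ

theorem flow_apply (i : Fin k) (g : A[T;T⁻¹]) :
    K.flow i g = mapDerivation (K.d i) g + K.f i * deriv g := rfl

theorem flow_sub (i l : Fin k) : K.flow i (LaurentPolynomial.T 1 - C (K.u l)) =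
    K.f i - if i = l then 1 else 0 := by
  rw [flow_apply, map_sub, map_sub, mapDerivation_T, mapDerivation_C, deriv_T_one, deriv_C, K.d_u,
    apply_ite C, map_one, map_zero]
  ring

theorem dvd_flow_sub (i l : Fin k) :
    (LaurentPolynomial.T 1 - C (K.u l)) ∣ K.flow i (LaurentPolynomial.T 1 - C (K.u l)) := by
  rw [flow_sub]
  exact (dvd_pow_self _ two_ne_zero).trans (K.f_vanishing i l)

theorem flow_mem_vanishing (i : Fin k) {h : ℕ} {g : A[T;T⁻¹]} (hg : g ∈ vanishing K.u h) :
    K.flow i g ∈ vanishing K.u h :=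
  mem_vanishing.2 fun l => (K.flow i).pow_dvd_apply (K.dvd_flow_sub i l) (mem_vanishing.1 hg l)

theorem flow_f_mem_vanishing (i j : Fin k) : K.flow i (K.f j) ∈ vanishing K.u 2 := by
  refine mem_vanishing.2 fun l => ?_
  have h := (K.flow i).pow_dvd_apply (K.dvd_flow_sub i l) (K.f_vanishing j l)
  have h0 : K.flow i (if j = l then 1 else 0) = 0 := by
    split_ifs
    · exact (K.flow i).map_one_eq_zero
    · exact map_zero _
  rwa [map_sub, h0, sub_zero] at h

end KZData

namespace ChiralCFT

open LaurentPolynomial States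

variable {H : Type*} [AddCommGroup H] [Module ℂ H] (T : ChiralCFT H)
  {A : Type*} [CommRing A] [Algebra ℂ A]

/-- The commutator of the smeared Virasoro field with a smeared quasiprimary field. The terms with
`L_{j+2} ψ` measure the deviation of `f` from a global conformal vector field. -/
theorem smear_conf_commutator {h : ℕ} {ψ : H} (hψ : ψ ∈ T.quasiprimary h) (f g : A[T;T⁻¹]) :
    ∃ J : ℕ, T.smear T.conf f * T.smear ψ g - T.smear ψ g * T.smear T.conf f =
      T.smear ψ ((h : A) • (deriv f * g) - deriv (f * g)) +
        ∑ j ∈ Finset.range J, T.smear (T.L (j + 2) ψ) (hasse (j + 3) f * g) := by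
  obtain ⟨J, hJ⟩ := T.exists_modes_vanish T.conf ψ
  refine ⟨J, ?_⟩
  rw [T.smear_commutator T.conf ψ f g (J + 3) (fun j hj => hJ j (by omega)),
    Finset.sum_range_succ', Finset.sum_range_succ', Finset.sum_range_succ']
  obtain ⟨h0, h1⟩ := T.mem_quasiprimary.1 hψ
  have e0 : ((T.Y T.conf)[[((0 : ℕ) : ℤ)]]) ψ = T.L (-1) ψ := rfl
  have e1 : ((T.Y T.conf)[[((0 + 1 : ℕ) : ℤ)]]) ψ = (h : ℂ) • ψ := T.mem_wt.1 h0
  have e2 : ((T.Y T.conf)[[((0 + 1 + 1 : ℕ) : ℤ)]]) ψ = 0 := h1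
  have e3 : ∀ j : ℕ, ((T.Y T.conf)[[((j + 1 + 1 + 1 : ℕ) : ℤ)]]) ψ = T.L (j + 2) ψ := fun j => by
    rw [L]
    congr 2
  rw [e0, e1, e2, smear_L_neg_one, smear_zero_left, smear_smul_left, hasse_zero, zero_add,
    ← deriv_apply, map_sub, add_zero, map_natCast]
  simp only [e3]
  abel

/-- The covariant derivative `∂ᵢ + Lⁱ(u)` on families of states. -/
noncomputable def nabla {k : ℕ} (K : KZData A k) (i : Fin k) : States A H →ₗ[ℂ] States A H :=
  tensorDerivation H (K.d i) - (T.smear T.conf (K.f i)).restrictScalars ℂ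

variable {k : ℕ} (K : KZData A k)

theorem nabla_apply (i : Fin k) (x : States A H) :
    T.nabla K i x = tensorDerivation H (K.d i) x - T.smear T.conf (K.f i) x := rfl

theorem nabla_smul (i : Fin k) (a : A) (x : States A H) :
    T.nabla K i (a • x) = K.d i a • x + a • T.nabla K i x := by
  rw [nabla_apply, nabla_apply, tensorDerivation_smul, map_smul, smul_sub]
  abel

theorem nabla_smear (i : Fin k) (a : H) (g : A[T;T⁻¹]) (x : States A H) :
    T.nabla K i (T.smear a g x) = T.smear a g (T.nabla K i x) +
      (T.smear a (mapDerivation (K.d i) g) -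
        (T.smear T.conf (K.f i) * T.smear a g - T.smear a g * T.smear T.conf (K.f i))) x := by
  rw [nabla_apply, nabla_apply, tensorDerivation_smear]
  simp only [LinearMap.sub_apply, Module.End.mul_apply, map_sub]
  abel

theorem vevA_smear_conf (i : Fin k) (x : States A H) :
    T.vevA (T.smear T.conf (K.f i) x) = 0 :=
  T.vevA_smear_eq_zero T.conf_mem_quasiprimary (growth_mono (by norm_num) (K.f_growth i)) x

/-- The family of the spaces `O_u` is stable under the connection. -/
theorem nabla_mem_familyO (i : Fin k) {x : States A H} (hx : x ∈ T.familyO K.u) :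
    T.nabla K i x ∈ T.familyO K.u := by
  induction hx using Submodule.span_induction with
  | mem x hx =>
    obtain ⟨h, ψ, g, y, hψ, hg, hgr, rfl⟩ := hx
    rw [nabla_smear]
    refine add_mem (Submodule.subset_span ⟨h, ψ, g, _, hψ, hg, hgr, rfl⟩)
      (T.apply_mem_familyO ?_ (fun z => ?_) y)
    · obtain ⟨J, hJ⟩ := T.smear_conf_commutator hψ (K.f i) g
      rw [hJ, ← sub_sub, ← map_sub]
      refine sub_mem (T.smear_mem_localOps le_rfl (T.mem_quasiprimary.1 hψ).1 ?_)
        (Submodule.sum_mem _ fun j _ => ?_)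
      · have h1 : mapDerivation (K.d i) g - ((h : A) • (deriv (K.f i) * g) - deriv (K.f i * g)) =
            K.flow i g + ((1 - (h : A)) • deriv (K.f i)) * g := by
          rw [K.flow_apply, Derivation.leibniz, smul_eq_mul, smul_eq_mul, sub_smul, sub_mul,
            one_smul, smul_mul_assoc]
          ring
        rw [h1]
        exact add_mem (K.flow_mem_vanishing i hg) (Ideal.mul_mem_left _ _ hg)
      · exact T.smear_mem_localOps (by omega)
          (T.L_mem_wt (T.mem_quasiprimary.1 hψ).1 T.conf_mem_wt _) (Ideal.mul_mem_left _ _ hg)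
    · simp only [LinearMap.sub_apply, Module.End.mul_apply, map_sub]
      rw [T.vevA_smear_eq_zero hψ (mapDerivation_mem_growth _ hgr), T.vevA_smear_conf,
        T.vevA_smear_eq_zero hψ hgr]
      simp
  | zero => rw [map_zero]; exact zero_mem _
  | add x y _ _ hx hy => rw [map_add]; exact add_mem hx hy
  | smul a x hx' hx =>
    rw [nabla_smul]
    exact add_mem (Submodule.smul_mem _ _ hx') (Submodule.smul_mem _ _ hx)

/-- The connection is flat on the quotient by the family of the spaces `O_u`. -/
theorem nabla_comm_mem_familyO (i j : Fin k) (x : States A H) :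
    T.nabla K i (T.nabla K j x) - T.nabla K j (T.nabla K i x) ∈ T.familyO K.u := by
  have hd : tensorDerivation H (K.d i) (tensorDerivation H (K.d j) x) =
      tensorDerivation H (K.d j) (tensorDerivation H (K.d i) x) := by
    induction x using States.induction_on with
    | zero => simp
    | smul a χ => simp only [tensorDerivation_smul_const, K.d_comm i j]
    | add x y hx hy => simp only [map_add, hx, hy]
  have key : T.nabla K i (T.nabla K j x) - T.nabla K j (T.nabla K i x) =
      (T.smear T.conf (mapDerivation (K.d j) (K.f i)) -
        T.smear T.conf (mapDerivation (K.d i) (K.f j)) +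
        (T.smear T.conf (K.f i) * T.smear T.conf (K.f j) -
          T.smear T.conf (K.f j) * T.smear T.conf (K.f i))) x := by
    simp only [nabla_apply, map_sub, tensorDerivation_smear, hd, LinearMap.add_apply,
      LinearMap.sub_apply, Module.End.mul_apply]
    abel
  rw [key]
  refine T.apply_mem_familyO ?_ (fun z => ?_) x
  · obtain ⟨J, hJ⟩ := T.smear_conf_commutator T.conf_mem_quasiprimary (K.f i) (K.f j)
    rw [hJ, ← add_assoc, ← map_sub, ← map_add]
    refine add_mem (T.smear_mem_localOps (h := 2) le_rfl T.conf_mem_wt ?_)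
      (Submodule.sum_mem _ fun m _ => ?_)
    · have h1 : mapDerivation (K.d j) (K.f i) - mapDerivation (K.d i) (K.f j) +
          (((2 : ℕ) : A) • (deriv (K.f i) * K.f j) - deriv (K.f i * K.f j)) =
            K.flow j (K.f i) - K.flow i (K.f j) := by
        rw [K.flow_apply, K.flow_apply, Derivation.leibniz, smul_eq_mul, smul_eq_mul, Nat.cast_two,
          two_smul]
        ring
      rw [h1]
      exact sub_mem (K.flow_f_mem_vanishing j i) (K.flow_f_mem_vanishing i j)
    · -- These states have weight `-m ≤ 0`, so that no zeros are required.
      refine T.smear_mem_localOps (h := 0) (d := 2 - (m + 2)) (by omega)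
        (T.L_mem_wt T.conf_mem_wt T.conf_mem_wt _) (mem_vanishing.2 fun l => ?_)
      rw [pow_zero]
      exact one_dvd _
  · simp only [LinearMap.sub_apply, LinearMap.add_apply, Module.End.mul_apply, map_sub, map_add]
    have hg : ∀ i j, mapDerivation (K.d j) (K.f i) ∈ growth A (2 * (2 : ℕ) - 2) := fun i j =>
      growth_mono (by norm_num) (mapDerivation_mem_growth _ (K.f_growth i))
    rw [T.vevA_smear_eq_zero T.conf_mem_quasiprimary (hg i j),
      T.vevA_smear_eq_zero T.conf_mem_quasiprimary (hg j i), T.vevA_smear_conf, T.vevA_smear_conf]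
    simp

end ChiralCFT

namespace LaurentPolynomial

variable {A : Type*} [CommRing A]

theorem sub_mem_growth (a : A) :
    (T 1 - C a : A[T;T⁻¹]) ∈ growth A 1 := by
  have h1 := C_mul_T_mem_growth (1 : A) (n := 1) (d := 1) le_rfl
  have h2 := C_mul_T_mem_growth a (n := 0) (d := 1) zero_le_one
  rw [map_one, one_mul] at h1
  rw [T_zero, mul_one] at h2
  exact sub_mem h1 h2

theorem prod_sub_pow_mem_growth {ι : Type*} (u : ι → A) (h : ℕ)
    (s : Finset ι) :
    ∏ l ∈ s, (T 1 - C (u l)) ^ h ∈ growth A ((s.card : ℤ) * h) := by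
  classical
  induction s using Finset.induction_on with
  | empty =>
    have := C_mul_T_mem_growth (1 : A) (n := 0) (d := 0) le_rfl
    simpa using this
  | insert a s ha ih =>
    rw [Finset.prod_insert ha, Finset.card_insert_of_notMem ha]
    refine growth_mono (le_of_eq ?_) (mul_mem_growth (pow_mem_growth (sub_mem_growth (u a)) h) ih)
    push_cast
    ring

end LaurentPolynomial

namespace ChiralCFT

open LaurentPolynomial States

variable {H : Type*} [AddCommGroup H] [Module ℂ H] (T : ChiralCFT H)
  {A : Type*} [CommRing A] [Algebra ℂ A]

/-! ### Finite generation -/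

/-- The projection to the states of weight `n`. -/
noncomputable def proj (n : ℕ) : H →ₗ[ℂ] H :=
  Submodule.subtype _ ∘ₗ DirectSum.component ℂ ℕ
    (fun h : ℕ => Module.End.eigenspace ((T.Y T.conf)[[1]]) (h : ℂ)) n ∘ₗ
    (LinearEquiv.ofBijective (DirectSum.coeLinearMap
      (fun h : ℕ => Module.End.eigenspace ((T.Y T.conf)[[1]]) (h : ℂ))) T.grading).symm.toLinearMap

theorem proj_of_mem {n d : ℕ} {x : H} (hx : x ∈ T.wt d) :
    T.proj n x = if d = n then x else 0 := by
  have hx' : x ∈ Module.End.eigenspace ((T.Y T.conf)[[1]]) (d : ℂ) := by simpa [wt, L] using hx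
  have h1 : (LinearEquiv.ofBijective (DirectSum.coeLinearMap
      (fun h : ℕ => Module.End.eigenspace ((T.Y T.conf)[[1]]) (h : ℂ))) T.grading).symm x =
      DirectSum.lof ℂ ℕ (fun h : ℕ => Module.End.eigenspace ((T.Y T.conf)[[1]]) (h : ℂ)) d
        ⟨x, hx'⟩ := by
    rw [LinearEquiv.symm_apply_eq]
    exact (DirectSum.coeLinearMap_lof
      (fun h : ℕ => Module.End.eigenspace ((T.Y T.conf)[[1]]) (h : ℂ)) d ⟨x, hx'⟩).symm
  rw [proj, LinearMap.comp_apply, LinearMap.comp_apply, LinearEquiv.coe_coe, h1]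
  split_ifs with hd
  · subst hd
    rw [DirectSum.component.lof_self]
    rfl
  · rw [DirectSum.component.of, dif_neg (by omega)]
    rfl

theorem proj_of_mem_int {n : ℕ} {d : ℤ} {x : H} (hx : x ∈ T.wt d) :
    T.proj n x = if d = n then x else 0 := by
  rcases lt_or_ge d 0 with hd | hd
  · rw [T.wt_eq_bot_of_neg hd, Submodule.mem_bot] at hx
    rw [hx]
    simp
  · lift d to ℕ using hd
    rw [T.proj_of_mem hx]
    simp

theorem wt_induction {p : H → Prop} (x : H) (zero : p 0)
    (add : ∀ x y, p x → p y → p (x + y)) (mem : ∀ (d : ℕ) (x : H), x ∈ T.wt d → p x) : p x := by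
  have hx : x ∈ ⨆ h : ℕ, T.wt h := by rw [T.iSup_wt]; trivial
  induction hx using Submodule.iSup_induction' with
  | mem n x hx => exact mem n x hx
  | zero => exact zero
  | add x y _ _ hx hy => exact add _ _ hx hy

/-- The homogeneous components of `a ₍ₘ₎ x` lie in the range of the same mode, since it is
homogeneous. -/
theorem proj_mode {h : ℕ} {a : H} (ha : a ∈ T.wt h) (m : ℤ) (n : ℕ) (x : H) :
    ∃ y ∈ T.wt (n - h + m + 1), T.proj n (((T.Y a)[[m]]) x) = ((T.Y a)[[m]]) y := by
  induction x using T.wt_induction with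
  | zero => exact ⟨0, zero_mem _, by simp⟩
  | add x y hx hy =>
    obtain ⟨x', hx', hx⟩ := hx
    obtain ⟨y', hy', hy⟩ := hy
    exact ⟨x' + y', add_mem hx' hy', by simp only [map_add, hx, hy]⟩
  | mem d x hx =>
    have h1 := T.proj_of_mem_int (n := n) (T.mode_mem_wt ha hx m)
    by_cases hd : (d : ℤ) + h - m - 1 = n
    · exact ⟨x, by rwa [show (n : ℤ) - h + m + 1 = d by omega], by rw [h1, if_pos hd]⟩
    · exact ⟨0, zero_mem _, by rw [h1, if_neg hd, map_zero]⟩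

theorem finite_proj (x : H) : {n : ℕ | T.proj n x ≠ 0}.Finite := by
  induction x using T.wt_induction with
  | zero => simp
  | add x y hx hy =>
    refine (hx.union hy).subset fun n hn => ?_
    by_contra h
    simp only [Set.mem_union, Set.mem_ofPred_eq, not_or, not_not] at h
    exact hn (by rw [map_add, h.1, h.2, add_zero])
  | mem d x hx =>
    refine (Set.finite_singleton d).subset fun n hn => ?_
    by_contra h
    refine hn ?_
    rw [T.proj_of_mem hx, if_neg (fun h' => h h'.symm)]

/-- If `H / C_k` is finite-dimensional, finitely many constant families generate `A ⊗ H` modulo the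
family of the spaces `O_u`. The function `z ^ m ∏ l, (z - u l) ^ h` trades the mode of a
generator of `C_k` for modes that raise the weight less; its lowest coefficient is a unit of `A`
because the points `u l` are invertible. -/
theorem exists_finite_span_sup_familyO {k : ℕ} (hC : FiniteDimensional ℂ (H ⧸ T.zhuC k))
    (u : Fin k → A) (hu : ∀ l, IsUnit (u l)) :
    ∃ S : Set H, S.Finite ∧ Submodule.span A (const A '' S) ⊔ T.familyO u = ⊤ := by
  obtain ⟨S₀, hS₀⟩ : ∃ S₀ : Finset H, Submodule.span ℂ (S₀ : Set H) ⊔ T.zhuC k = ⊤ := by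
    obtain ⟨s, hs⟩ := hC.fg_top
    classical
    refine ⟨s.image Quotient.out, ?_⟩
    have h1 : (Submodule.span ℂ ((s.image Quotient.out : Finset H) : Set H)).map (T.zhuC k).mkQ =
        ⊤ := by
      rw [Submodule.map_span, ← hs]
      congr 1
      ext x
      simp only [Finset.coe_image, Set.mem_image, Finset.mem_coe, exists_exists_and_eq_and,
        Submodule.mkQ_apply]
      constructor
      · rintro ⟨y, hy, rfl⟩
        rwa [show (Submodule.Quotient.mk (Quotient.out y) : H ⧸ T.zhuC k) = y from
          Quotient.out_eq y]
      · intro hx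
        exact ⟨x, hx, Quotient.out_eq x⟩
    rw [sup_comm]
    exact (Submodule.map_mkQ_eq_top _ _).1 h1
  let S : Set H := ⋃ s ∈ (S₀ : Set H), (fun n => T.proj n s) '' {n | T.proj n s ≠ 0}
  refine ⟨S, S₀.finite_toSet.biUnion fun s _ => (T.finite_proj s).image _, ?_⟩
  set M := Submodule.span A (const A '' S) ⊔ T.familyO u with hM
  have hw : ∀ (n : ℕ), ∀ w ∈ Submodule.span ℂ (S₀ : Set H), const A (T.proj n w) ∈ M := by
    intro n w hw
    induction hw using Submodule.span_induction with
    | mem s hs =>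
      by_cases h0 : T.proj n s = 0
      · rw [h0, map_zero]
        exact zero_mem _
      · exact Submodule.mem_sup_left (Submodule.subset_span
          ⟨_, Set.mem_biUnion hs ⟨n, h0, rfl⟩, rfl⟩)
    | zero => simp
    | add x y _ _ hx hy => simpa only [map_add] using add_mem hx hy
    | smul c x _ hx =>
      rw [map_smul, map_smul, ← algebraMap_smul A c]
      exact Submodule.smul_mem _ _ hx
  -- Induction on the weight: modulo `O_u`, the component of weight `n` of an element of `C_k` is a
  -- combination of states of smaller weight.
  have key : ∀ n : ℕ, ∀ χ ∈ T.wt n, const A χ ∈ M := by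
    intro n
    induction n using Nat.strong_induction_on with
    | _ n ih =>
    have ih' : ∀ d : ℤ, d < n → ∀ χ ∈ T.wt d, const A χ ∈ M := by
      intro d hd χ hχ
      rcases lt_or_ge d 0 with h0 | h0
      · rw [T.wt_eq_bot_of_neg h0, Submodule.mem_bot] at hχ
        rw [hχ, map_zero]
        exact zero_mem _
      · lift d to ℕ using h0
        exact ih d (by exact_mod_cast hd) χ hχ
    have hc : ∀ c ∈ T.zhuC k, const A (T.proj n c) ∈ M := by
      intro c hc
      induction hc using Submodule.span_induction with
      | mem c hc =>
        obtain ⟨h, ψ, N, χ, hψ, hN, rfl⟩ := hc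
        obtain ⟨y, hy, hyc⟩ := T.proj_mode (T.mem_quasiprimary.1 hψ).1
          (-(N : ℤ) - ((k : ℤ) - 1) * h + h - 1) n χ
        rw [mode, hyc]
        generalize hm : -(N : ℤ) - ((k : ℤ) - 1) * h + h - 1 = m at *
        let p : Polynomial A := ∏ l, (Polynomial.X - Polynomial.C (u l)) ^ h
        have hp0 : IsUnit (p.coeff 0) := by
          rw [Polynomial.coeff_zero_eq_eval_zero, Polynomial.eval_prod]
          refine IsUnit.prod_univ_iff.2 fun l => ?_
          simpa using ((hu l).neg).pow h
        have hp : Polynomial.toLaurent p = ∏ l, (LaurentPolynomial.T 1 - C (u l)) ^ h := by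
          simp [p]
        have hO : T.smear ψ (LaurentPolynomial.T m * Polynomial.toLaurent p) (const A y) ∈
            T.familyO u := by
          refine Submodule.subset_span ⟨h, ψ, _, _, hψ, Ideal.mul_mem_left _ _ ?_, ?_, rfl⟩
          · rw [hp]
            exact mem_vanishing.2 fun l => Finset.dvd_prod_of_mem _ (Finset.mem_univ l)
          · rw [hp, ← one_mul (LaurentPolynomial.T m), ← map_one C]
            exact growth_mono
              (by subst hm; simp only [Finset.card_univ, Fintype.card_fin]; linarith)
              (mul_mem_growth (C_mul_T_mem_growth 1 le_rfl) (prod_sub_pow_mem_growth u h _))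
        have hlow : ∀ q : Polynomial A,
            T.smear ψ (LaurentPolynomial.T (m + 1) * Polynomial.toLaurent q) (const A y) ∈ M := by
          intro q
          induction q using Polynomial.induction_on' with
          | add p q hp hq =>
            rw [map_add, mul_add, map_add, LinearMap.add_apply]
            exact add_mem hp hq
          | monomial i a =>
            rw [Polynomial.toLaurent_C_mul_T, mul_left_comm, ← T_add, smear_C_mul_T,
              LinearMap.smul_apply, extend_const]
            exact Submodule.smul_mem _ _ (ih' _ (by omega)
              _ (T.mode_mem_wt (T.mem_quasiprimary.1 hψ).1 hy (m + 1 + i)))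
        have hsplit : LaurentPolynomial.T m * Polynomial.toLaurent p =
            LaurentPolynomial.T (m + 1) * Polynomial.toLaurent p.divX +
              C (p.coeff 0) * LaurentPolynomial.T m := by
          conv_lhs => rw [← Polynomial.divX_mul_X_add p]
          rw [map_add, map_mul, Polynomial.toLaurent_X, Polynomial.toLaurent_C, T_add]
          ring
        have h2 := sub_mem (Submodule.mem_sup_right hO : _ ∈ M) (hlow p.divX)
        rw [hsplit, map_add, LinearMap.add_apply, add_sub_cancel_left, smear_C_mul_T,
          LinearMap.smul_apply, extend_const] at h2
        obtain ⟨e, he⟩ := hp0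
        rw [← he] at h2
        exact (Submodule.smul_mem_iff_of_isUnit M e.isUnit).1 h2
      | zero => simp
      | add x y _ _ hx hy => simpa only [map_add] using add_mem hx hy
      | smul c x _ hx =>
        rw [map_smul, map_smul, ← algebraMap_smul A c]
        exact Submodule.smul_mem _ _ hx
    intro χ hχ
    obtain ⟨w, hw', c, hc', rfl⟩ := Submodule.mem_sup.1
      (show χ ∈ Submodule.span ℂ (S₀ : Set H) ⊔ T.zhuC k by rw [hS₀]; trivial)
    have h1 := T.proj_of_mem (n := n) hχ
    rw [if_pos rfl, map_add] at h1
    rw [← h1, map_add]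
    exact add_mem (hw n w hw') (hc c hc')
  refine eq_top_iff.2 fun x _ => ?_
  induction x using States.induction_on with
  | zero => exact zero_mem _
  | add x y hx hy => exact add_mem (hx trivial) (hy trivial)
  | smul a χ =>
    refine Submodule.smul_mem _ _ ?_
    exact T.wt_induction (p := fun χ => const A χ ∈ M) χ (by simp)
      (fun x y hx hy => by simpa only [map_add] using add_mem hx hy) key

end ChiralCFT

/-! ### Specialization of the parameters -/

namespace LaurentPolynomial

section Specialize

variable {A B : Type*} [CommRing A] [CommRing B]

/-- The Laurent polynomial obtained by applying a ring homomorphism to the coefficients. -/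
noncomputable abbrev mapCoeff (e : A →+* B) : A[T;T⁻¹] →+* B[T;T⁻¹] :=
  AddMonoidAlgebra.mapRingHom ℤ e

theorem mapCoeff_T (e : A →+* B) (n : ℤ) : mapCoeff e (T n) = T n := by
  rw [T, AddMonoidAlgebra.mapRingHom_single, map_one, T]

theorem mapCoeff_C (e : A →+* B) (a : A) : mapCoeff e (C a) = C (e a) := by
  rw [← single_eq_C, AddMonoidAlgebra.mapRingHom_single, single_eq_C]

theorem mapCoeff_mem_growth (e : A →+* B) {d : ℤ} {g : A[T;T⁻¹]} (hg : g ∈ growth A d) :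
    mapCoeff e g ∈ growth B d := fun m hm => by
  rw [AddMonoidAlgebra.coeff_mapRingHom, mem_growth.1 hg m hm, map_zero]

theorem coeff_sub_mul (w : A) (q : A[T;T⁻¹]) (m : ℤ) :
    ((T 1 - C w) * q).coeff (m + 1) = q.coeff m - w * q.coeff (m + 1) := by
  rw [sub_mul, AddMonoidAlgebra.coeff_sub, Finsupp.sub_apply, ← smul_eq_C_mul,
    AddMonoidAlgebra.coeff_smul, Finsupp.smul_apply, smul_eq_mul, T,
    AddMonoidAlgebra.coeff_single_mul_apply, one_mul]
  congr 2
  ring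

/-- Division by the monic polynomial `z - w` lowers the degree by one. -/
theorem mem_growth_of_sub_mul {d : ℤ} (w : A) {q : A[T;T⁻¹]}
    (hq : (T 1 - C w) * q ∈ growth A (d + 1)) : q ∈ growth A d := by
  -- Above degree `d` a nonzero coefficient forces the next one to be nonzero.
  by_contra h
  rw [mem_growth] at h
  push Not at h
  obtain ⟨m, hm, hm0⟩ := h
  have key : ∀ n : ℕ, q.coeff (m + n) ≠ 0 := by
    intro n
    induction n with
    | zero => simpa using hm0
    | succ n ih =>
      intro h0
      have h1 := coeff_sub_mul w q (m + n)
      rw [mem_growth.1 hq _ (by omega), show m + (n : ℤ) + 1 = m + (n + 1 : ℕ) by push_cast; ring,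
        h0, mul_zero, sub_zero] at h1
      exact ih h1.symm
  refine Set.infinite_of_injective_forall_mem (f := fun n : ℕ => m + (n : ℤ))
    (fun a b hab => ?_) (fun n => ?_) q.coeff.support.finite_toSet
  · simpa using hab
  · simpa using key n

theorem mem_growth_of_sub_pow_mul {d : ℤ} (w : A) (h : ℕ) {q : A[T;T⁻¹]}
    (hq : (T 1 - C w) ^ h * q ∈ growth A (d + h)) : q ∈ growth A d := by
  induction h with
  | zero => simpa using hq
  | succ h ih =>
    refine ih (mem_growth_of_sub_mul w ?_)
    rw [← mul_assoc, ← pow_succ']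
    exact growth_mono (by push_cast; linarith) hq

theorem mem_growth_of_prod_mul {ι : Type*} {d : ℤ} (w : ι → A) (h : ℕ) (s : Finset ι)
    {q : A[T;T⁻¹]} (hq : (∏ l ∈ s, (T 1 - C (w l)) ^ h) * q ∈ growth A (d + s.card * h)) :
    q ∈ growth A d := by
  classical
  induction s using Finset.induction_on with
  | empty => simpa using hq
  | insert a s ha ih =>
    refine ih (mem_growth_of_sub_pow_mul (w a) h ?_)
    rw [← mul_assoc, ← Finset.prod_insert (f := fun l => (T 1 - C (w l)) ^ h) ha]
    refine growth_mono (le_of_eq ?_) hq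
    rw [Finset.card_insert_of_notMem ha]
    push_cast
    ring

theorem isCoprime_sub {K : Type*} [Field K] {a b : K} (h : a ≠ b) :
    IsCoprime (T 1 - C a : K[T;T⁻¹]) (T 1 - C b) := by
  refine ⟨C (b - a)⁻¹, -C (b - a)⁻¹, ?_⟩
  have h1 : (b - a)⁻¹ * (b - a) = 1 := inv_mul_cancel₀ (sub_ne_zero.2 h.symm)
  calc (C (b - a)⁻¹ * (T 1 - C a) + -C (b - a)⁻¹ * (T 1 - C b) : K[T;T⁻¹])
      = C ((b - a)⁻¹ * (b - a)) := by rw [map_mul, map_sub]; ring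
    _ = 1 := by rw [h1, map_one]

variable [Algebra ℂ A]

theorem isZhuFunction_iff {k : ℕ} {w : Fin k → ℂ} {h : ℕ} {g : ℂ[T;T⁻¹]} :
    IsZhuFunction w h g ↔ g ∈ vanishing w h ∧ g ∈ growth ℂ (2 * h - 2) := by
  refine and_congr mem_vanishing.symm ?_
  rw [mem_growth]
  constructor
  · intro H m hm
    by_contra h0
    exact absurd (H m (Finsupp.mem_support_iff.2 h0)) (not_le.2 hm)
  · intro H m hm
    by_contra h0
    exact Finsupp.mem_support_iff.1 hm (H m (not_le.1 h0))

theorem isKZFunction_iff {k : ℕ} {w : Fin k → ℂ} {i : Fin k} {f : ℂ[T;T⁻¹]} :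
    IsKZFunction w i f ↔
      f ∈ growth ℂ (-2) ∧ ∀ l, (T 1 - C (w l)) ^ 2 ∣ f - if i = l then 1 else 0 := by
  refine and_congr ?_ Iff.rfl
  rw [mem_growth]
  constructor
  · intro H m hm
    by_contra h0
    exact absurd (H m (Finsupp.mem_support_iff.2 h0)) (not_le.2 hm)
  · intro H m hm
    by_contra h0
    exact Finsupp.mem_support_iff.1 hm (H m (not_le.1 h0))

theorem isZhuFunction_mapCoeff {k : ℕ} (e : A →ₐ[ℂ] ℂ) {u : Fin k → A} {h : ℕ} {g : A[T;T⁻¹]}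
    (hg : g ∈ vanishing u h) (hg' : g ∈ growth A (2 * h - 2)) :
    IsZhuFunction (fun l => e (u l)) h (mapCoeff (e : A →+* ℂ) g) := by
  refine isZhuFunction_iff.2 ⟨mem_vanishing.2 fun l => ?_, mapCoeff_mem_growth _ hg'⟩
  have := map_dvd (mapCoeff (e : A →+* ℂ)) (mem_vanishing.1 hg l)
  rwa [map_pow, map_sub, mapCoeff_T, mapCoeff_C] at this

/-- At distinct points every function that occurs in the definition of `O_u` is the specialization
of one with coefficients in the ring of parameters: it is the product of `∏ l, (z - u l) ^ h` and a
Laurent polynomial, whose coefficients may be taken constant. -/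
theorem exists_mapCoeff_eq {k : ℕ} (e : A →ₐ[ℂ] ℂ) {u : Fin k → A}
    (hu : Function.Injective fun l => e (u l)) {h : ℕ} {g : ℂ[T;T⁻¹]}
    (hg : IsZhuFunction (fun l => e (u l)) h g) :
    ∃ G ∈ vanishing u h, G ∈ growth A (2 * h - 2) ∧ mapCoeff (e : A →+* ℂ) G = g := by
  obtain ⟨hv, hgr⟩ := isZhuFunction_iff.1 hg
  obtain ⟨q, rfl⟩ : ∏ l, (T 1 - C (e (u l))) ^ h ∣ g :=
    Finset.prod_dvd_of_coprime (fun i _ j _ hij => (isCoprime_sub (hu.ne hij)).pow)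
      fun l _ => mem_vanishing.1 hv l
  have hq : q ∈ growth ℂ (2 * h - 2 - (k : ℤ) * h) := by
    refine mem_growth_of_prod_mul _ h Finset.univ (growth_mono (le_of_eq ?_) hgr)
    rw [Finset.card_univ, Fintype.card_fin]
    ring
  refine ⟨(∏ l, (T 1 - C (u l)) ^ h) * mapCoeff (algebraMap ℂ A) q, ?_, ?_, ?_⟩
  · exact mem_vanishing.2 fun l =>
      (Finset.dvd_prod_of_mem (fun l => (T 1 - C (u l)) ^ h) (Finset.mem_univ l)).mul_right _
  · refine growth_mono (le_of_eq ?_) (mul_mem_growth (prod_sub_pow_mem_growth u h Finset.univ)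
      (mapCoeff_mem_growth (algebraMap ℂ A) hq))
    rw [Finset.card_univ, Fintype.card_fin]
    ring
  · rw [map_mul, map_prod]
    congr 1
    · refine Finset.prod_congr rfl fun l _ => ?_
      rw [map_pow, map_sub, mapCoeff_T, mapCoeff_C]
      rfl
    · apply LaurentPolynomial.ext
      intro m
      rw [AddMonoidAlgebra.coeff_mapRingHom, AddMonoidAlgebra.coeff_mapRingHom]
      exact e.commutes _

end Specialize

end LaurentPolynomial

namespace ChiralCFT

open LaurentPolynomial States

variable {H : Type*} [AddCommGroup H] [Module ℂ H] (T : ChiralCFT H)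
  {A : Type*} [CommRing A] [Algebra ℂ A]

theorem residue_add (f g : ℂ[T;T⁻¹]) (a : H) :
    T.residue (f + g) a = T.residue f a + T.residue g a :=
  Finsupp.sum_add_index' (h := fun m c => c • (T.Y a)[[m]]) (fun _ => zero_smul _ _)
    fun _ _ _ => add_smul _ _ _

theorem residue_C_mul_T (c : ℂ) (n : ℤ) (a : H) :
    T.residue (C c * LaurentPolynomial.T n) a = c • (T.Y a)[[n]] := by
  rw [← single_eq_C_mul_T]
  exact Finsupp.sum_single_index (h := fun m c => c • (T.Y a)[[m]]) (zero_smul _ _)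

theorem residue_sub (f g : ℂ[T;T⁻¹]) (a : H) :
    T.residue (f - g) a = T.residue f a - T.residue g a := by
  rw [eq_sub_iff_add_eq, ← residue_add, sub_add_cancel]

/-- The value of a family of states at a point of the parameter space. -/
noncomputable def evalStates (e : A →ₐ[ℂ] ℂ) : States A H →ₗ[ℂ] H :=
  (TensorProduct.lid ℂ H).toLinearMap ∘ₗ LinearMap.rTensor H e.toLinearMap

theorem evalStates_smul_const (e : A →ₐ[ℂ] ℂ) (a : A) (χ : H) :
    evalStates e (a • const A χ) = e a • χ := by
  have h : (a • (1 : A) ⊗ₜ[ℂ] χ : A ⊗[ℂ] H) = a ⊗ₜ χ := by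
    rw [TensorProduct.smul_tmul', smul_eq_mul, mul_one]
  refine (congrArg (evalStates e) (h : a • const A χ = _)).trans ?_
  refine (congrArg (TensorProduct.lid ℂ H) (LinearMap.rTensor_tmul H e.toLinearMap χ a)).trans ?_
  exact TensorProduct.lid_tmul _ _

theorem evalStates_const (e : A →ₐ[ℂ] ℂ) (χ : H) : evalStates e (const A χ) = χ := by
  rw [← one_smul A (const A χ), evalStates_smul_const, map_one, one_smul]

theorem evalStates_smul (e : A →ₐ[ℂ] ℂ) (a : A) (x : States A H) :
    evalStates e (a • x) = e a • evalStates e x := by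
  induction x using States.induction_on with
  | zero => simp
  | smul b χ => rw [smul_smul, evalStates_smul_const, evalStates_smul_const, map_mul, smul_smul]
  | add x y hx hy => rw [smul_add, map_add, map_add, hx, hy, smul_add]

theorem evalStates_smear (e : A →ₐ[ℂ] ℂ) (a : H) (g : A[T;T⁻¹]) (x : States A H) :
    evalStates e (T.smear a g x) = T.residue (mapCoeff (e : A →+* ℂ) g) a (evalStates e x) := by
  induction x using States.induction_on with
  | zero => simp
  | add x y hx hy => simp only [map_add, hx, hy]
  | smul b χ =>
    rw [map_smul, evalStates_smul, evalStates_smul_const, map_smul]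
    congr 1
    induction g using LaurentPolynomial.induction_on' with
    | add f g hf hg => rw [map_add, LinearMap.add_apply, map_add, map_add, hf, hg, residue_add,
        LinearMap.add_apply]
    | C_mul_T n c =>
      rw [smear_C_mul_T, LinearMap.smul_apply, extend_const, evalStates_smul_const, map_mul,
        mapCoeff_T, mapCoeff_C, residue_C_mul_T]
      rfl

theorem evalStates_mem_zhuO {k : ℕ} (e : A →ₐ[ℂ] ℂ) {u : Fin k → A} {x : States A H}
    (hx : x ∈ T.familyO u) : evalStates e x ∈ T.zhuO fun l => e (u l) := by
  induction hx using Submodule.span_induction with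
  | mem x hx =>
    obtain ⟨h, ψ, g, y, hψ, hg, hgr, rfl⟩ := hx
    rw [evalStates_smear]
    exact Submodule.subset_span ⟨h, ψ, _, _, hψ, isZhuFunction_mapCoeff e hg hgr, rfl⟩
  | zero => rw [map_zero]; exact zero_mem _
  | add x y _ _ hx hy => rw [map_add]; exact add_mem hx hy
  | smul a x _ hx => rw [evalStates_smul]; exact Submodule.smul_mem _ _ hx

/-- The space `O_u` at a point consists of the values of the family of the spaces `O_u`. -/
theorem exists_evalStates_eq {k : ℕ} (e : A →ₐ[ℂ] ℂ) {u : Fin k → A}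
    (hu : Function.Injective fun l => e (u l)) {χ : H} (hχ : χ ∈ T.zhuO fun l => e (u l)) :
    ∃ x ∈ T.familyO u, evalStates e x = χ := by
  induction hχ using Submodule.span_induction with
  | mem χ hχ =>
    obtain ⟨h, ψ, g, χ, hψ, hg, rfl⟩ := hχ
    obtain ⟨G, hG, hGr, rfl⟩ := exists_mapCoeff_eq e hu hg
    refine ⟨T.smear ψ G (const A χ), Submodule.subset_span ⟨h, ψ, G, _, hψ, hG, hGr, rfl⟩, ?_⟩
    rw [evalStates_smear, evalStates_const]
  | zero => exact ⟨0, zero_mem _, map_zero _⟩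
  | add x y _ _ hx hy =>
    obtain ⟨x', hx', rfl⟩ := hx
    obtain ⟨y', hy', rfl⟩ := hy
    exact ⟨x' + y', add_mem hx' hy', map_add _ _ _⟩
  | smul c x _ hx =>
    obtain ⟨x', hx', rfl⟩ := hx
    exact ⟨c • x', by rw [← algebraMap_smul A c]; exact Submodule.smul_mem _ _ hx', map_smul _ _ _⟩

/-- Modulo `O_u` the operator `Lⁱ(u)` does not depend on the choice of `fⁱ_u`. -/
theorem connectionOp_sub_mem_zhuO {k : ℕ} {w : Fin k → ℂ} {i : Fin k} {f g : ℂ[T;T⁻¹]}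
    (hf : IsKZFunction w i f) (hg : IsKZFunction w i g) (χ : H) :
    T.connectionOp f χ - T.connectionOp g χ ∈ T.zhuO w := by
  obtain ⟨hf, hf'⟩ := isKZFunction_iff.1 hf
  obtain ⟨hg, hg'⟩ := isKZFunction_iff.1 hg
  refine Submodule.subset_span ⟨2, T.conf, g - f, χ, T.conf_mem_quasiprimary,
    isZhuFunction_iff.2 ⟨mem_vanishing.2 fun l => ?_,
      growth_mono (by norm_num) (sub_mem hg hf)⟩, ?_⟩
  · simpa using dvd_sub (hg' l) (hf' l)
  · rw [residue_sub, connectionOp, connectionOp, LinearMap.neg_apply, LinearMap.neg_apply,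
      LinearMap.sub_apply]
    abel

end ChiralCFT

/-! ### Linear systems with constraints: local theory -/

namespace LinearSystem

set_option maxSynthPendingDepth 3

open Set Metric

variable {X E : Type*} [NormedAddCommGroup X] [NormedSpace ℂ X] [NormedAddCommGroup E]
  [NormedSpace ℂ E]

theorem hasDerivAt_segment (p ξ : X) (t : ℝ) :
    HasDerivAt (fun t : ℝ => p + t • ξ) ξ t := by
  simpa using ((hasDerivAt_id t).smul_const ξ).const_add p

theorem hasDerivAt_comp_segment {f : X → E} {f' : X →L[ℂ] E} {p ξ : X} {t : ℝ}
    (hf : HasFDerivAt f f' (p + t • ξ)) : HasDerivAt (fun t : ℝ => f (p + t • ξ)) (f' ξ) t :=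
  HasFDerivAt.comp_hasDerivAt (l := f) (l' := f'.restrictScalars ℝ) t (hf.restrictScalars ℝ)
    (hasDerivAt_segment p ξ t)

theorem segment_mem_ball {x p ξ : X} {R : ℝ} (hp : p ∈ ball x R) (hq : p + ξ ∈ ball x R) {t : ℝ}
    (ht : t ∈ Icc (0 : ℝ) 1) : p + t • ξ ∈ ball x R :=
  (convex_ball x R).add_smul_mem hp hq ht

/-- Grönwall's inequality on `[0, 1]`. -/
theorem norm_le_of_hasDerivWithinAt {f f' : ℝ → E} {δ K ε : ℝ}
    (hf : ∀ t ∈ Icc (0 : ℝ) 1, HasDerivWithinAt f (f' t) (Icc 0 1) t) (h0 : ‖f 0‖ ≤ δ)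
    (bound : ∀ t ∈ Icc (0 : ℝ) 1, ‖f' t‖ ≤ K * ‖f t‖ + ε) :
    ∀ t ∈ Icc (0 : ℝ) 1, ‖f t‖ ≤ gronwallBound δ K ε t := by
  intro t ht
  have := norm_le_gronwallBound_of_norm_deriv_right_le (f := f) (f' := f')
    (fun t ht => (hf t ht).continuousWithinAt)
    (fun t ht => (hf t (Ico_subset_Icc_self ht)).mono_of_mem_nhdsWithin
      (Icc_mem_nhdsGE_of_mem ht)) h0
    (fun t ht => bound t (Ico_subset_Icc_self ht)) t ht
  rwa [sub_zero] at this

/-- A solution of a linear total differential equation on a ball that vanishes at one point is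
zero. -/
theorem eq_zero_of_mem_ball {y : X → E} {y' : X → X →L[ℂ] E} {x p : X} {R C : ℝ}
    (hy : ∀ u ∈ ball x R, HasFDerivAt y (y' u) u)
    (hC : ∀ u ∈ ball x R, ∀ ξ, ‖y' u ξ‖ ≤ C * ‖ξ‖ * ‖y u‖) (hp : p ∈ ball x R) (h0 : y p = 0) :
    ∀ u ∈ ball x R, y u = 0 := by
  intro u hu
  have hseg : ∀ t ∈ Icc (0 : ℝ) 1, p + t • (u - p) ∈ ball x R := fun t ht =>
    segment_mem_ball hp (by rwa [add_sub_cancel]) ht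
  have h := norm_le_of_hasDerivWithinAt (f := fun t : ℝ => y (p + t • (u - p)))
    (f' := fun t => y' (p + t • (u - p)) (u - p)) (δ := 0) (K := C * ‖u - p‖) (ε := 0)
    (fun t ht => (hasDerivAt_comp_segment (hy _ (hseg t ht))).hasDerivWithinAt) (by simp [h0])
    (fun t ht => by simpa using hC _ (hseg t ht) (u - p)) 1 (right_mem_Icc.2 zero_le_one)
  rw [gronwallBound_ε0_δ0, one_smul, add_sub_cancel] at h
  exact norm_le_zero_iff.1 h

theorem exists_ball_norm_le {X G : Type*} [NormedAddCommGroup X] [NormedAddCommGroup G] {N : X → G}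
    {V : Set X} (hV : IsOpen V) (hN : ContinuousOn N V) {x : X} (hx : x ∈ V) :
    ∃ R > 0, ball x R ⊆ V ∧ ∀ u ∈ ball x R, ‖N u‖ ≤ ‖N x‖ + 1 := by
  have h1 : ∀ᶠ u in nhds x, ‖N u‖ < ‖N x‖ + 1 :=
    ((hN.continuousAt (hV.mem_nhds hx)).norm).eventually_lt continuousAt_const (lt_add_one _)
  obtain ⟨R, hR, hball⟩ := Metric.mem_nhds_iff.1 (Filter.inter_mem (hV.mem_nhds hx) h1)
  exact ⟨R, hR, fun u hu => (hball hu).1, fun u hu => le_of_lt (hball hu).2⟩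

/-- A solution on a connected open set of a linear total differential equation that vanishes at one
point is zero. -/
theorem eq_zero_of_isPreconnected {y : X → E} {N : X → X →L[ℂ] E →L[ℂ] E} {V : Set X}
    (hV : IsOpen V) (hVc : IsPreconnected V) (hN : ContinuousOn N V)
    (hy : ∀ u ∈ V, HasFDerivAt y ((N u).flip (y u)) u) {p : X} (hp : p ∈ V) (h0 : y p = 0) :
    ∀ u ∈ V, y u = 0 := by
  have hc : ContinuousOn y V := fun u hu => (hy u hu).continuousAt.continuousWithinAt
  have h1 : IsOpen (V ∩ {u | y u = 0}) := by
    rw [isOpen_iff_mem_nhds]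
    rintro x ⟨hx, hx0⟩
    obtain ⟨R, hR, hball, hb⟩ := exists_ball_norm_le (G := X →L[ℂ] E →L[ℂ] E) hV hN hx
    refine Filter.mem_of_superset (ball_mem_nhds x hR) fun u hu => ⟨hball hu, ?_⟩
    refine eq_zero_of_mem_ball (C := ‖N x‖ + 1) (fun u hu => hy u (hball hu)) (fun u hu ξ => ?_)
      (mem_ball_self hR) hx0 u hu
    rw [ContinuousLinearMap.flip_apply]
    exact (N u).le_of_opNorm₂_le_of_le (hb u hu) le_rfl le_rfl
  have h2 : IsOpen (V ∩ {u | y u ≠ 0}) := hc.isOpen_inter_preimage hV isOpen_ne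
  have h3 := hVc.subset_left_of_subset_union h1 h2
    (Set.disjoint_left.2 fun u hu hu' => hu'.2 hu.2)
    (fun u hu => by
      by_cases h : y u = 0
      · exact Or.inl ⟨hu, h⟩
      · exact Or.inr ⟨hu, h⟩) ⟨p, hp, hp, h0⟩
  exact fun u hu => (h3 hu).2

/-- Existence of solutions of a linear ordinary differential equation along a segment. -/
theorem exists_solution_segment [CompleteSpace E] {N : X → X →L[ℂ] E →L[ℂ] E} {x p ξ : X}
    {R C : ℝ} (hN : ContinuousOn N (ball x R)) (hC : ∀ u ∈ ball x R, ‖N u‖ ≤ C)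
    (hξ : C * ‖ξ‖ ≤ 1 / 2) (hp : p ∈ ball x R) (hq : p + ξ ∈ ball x R) (y₀ : E) :
    ∃ y : ℝ → E, y 0 = y₀ ∧ (∀ t ∈ Icc (0 : ℝ) 1,
      HasDerivWithinAt y (N (p + t • ξ) ξ (y t)) (Icc 0 1) t) ∧
      ∀ t ∈ Icc (0 : ℝ) 1, ‖y t‖ ≤ ‖y₀‖ * Real.exp 1 := by
  have hseg : ∀ t ∈ Icc (0 : ℝ) 1, p + t • ξ ∈ ball x R := fun t ht => segment_mem_ball hp hq ht
  have hbd : ∀ t ∈ Icc (0 : ℝ) 1, ∀ e : E, ‖N (p + t • ξ) ξ e‖ ≤ 1 / 2 * ‖e‖ := fun t ht e =>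
    ((N _).le_of_opNorm₂_le_of_le (hC _ (hseg t ht)) le_rfl le_rfl).trans
      (mul_le_mul_of_nonneg_right hξ (norm_nonneg e))
  have hPL : IsPicardLindelof (fun t e => N (p + t • ξ) ξ e) (tmin := 0) (tmax := 1)
      ⟨0, left_mem_Icc.2 zero_le_one⟩ y₀ ‖y₀‖₊ 0 ‖y₀‖₊ (1 / 2) := by
    refine ⟨fun t ht => ?_, fun e _ => ?_, fun t ht e he => ?_, ?_⟩
    · refine LipschitzWith.lipschitzOnWith (LipschitzWith.of_dist_le_mul fun a b => ?_)
      rw [dist_eq_norm, dist_eq_norm, ← map_sub]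
      exact hbd t ht _
    · have h1 : ContinuousOn (fun t : ℝ => N (p + t • ξ)) (Icc 0 1) :=
        hN.comp (by fun_prop) hseg
      exact (h1.clm_apply continuousOn_const).clm_apply continuousOn_const
    · refine (hbd t ht e).trans ?_
      have h1 : ‖e‖ ≤ ‖y₀‖ + ‖y₀‖ := by
        have h2 : ‖e - y₀‖ ≤ ‖y₀‖ := by simpa [dist_eq_norm] using he
        have h3 := norm_add_le (e - y₀) y₀
        rw [sub_add_cancel] at h3
        linarith
      rw [coe_nnnorm]
      linarith
    · simp
  obtain ⟨y, hy0, hy⟩ := hPL.exists_eq_forall_mem_Icc_hasDerivWithinAt₀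
  refine ⟨y, hy0, hy, fun t ht => ?_⟩
  refine (norm_le_of_hasDerivWithinAt (K := 1 / 2) (ε := 0) hy (le_of_eq (congrArg norm hy0))
    (fun t ht => by simpa using hbd t ht (y t)) t ht).trans ?_
  rw [gronwallBound_ε0]
  gcongr
  linarith [ht.1, ht.2]

/-- The comparison function `z = y + t M(p + t ξ)(δ) y` for the solution `y` of the radial equation
in the direction `ξ` satisfies the radial equation in the direction `ξ + δ` up to `O(‖δ‖ ^ 2)`, if
the curvature annihilates `y`. Here `m = M(p + t ξ)`, `m' = M(p + t (ξ + δ))`, the derivative of `M`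
at `p + t ξ` is `D`, and `e` is the value of `y`. -/
theorem norm_comparison_le {m m' : X →L[ℂ] E →L[ℂ] E} {D : X →L[ℂ] X →L[ℂ] E →L[ℂ] E} {ξ δ : X}
    {e : E} {t C : ℝ} (ht0 : 0 ≤ t) (ht1 : t ≤ 1) (hm : ‖m‖ ≤ C) (hD : ‖D‖ ≤ C)
    (hm' : ‖m' - m - D (t • δ)‖ ≤ C * ‖δ‖ ^ 2) (hξ : C * ‖ξ + δ‖ ≤ 1) (hδ : C * ‖δ‖ ≤ 1)
    (hcurv : D ξ δ e - D δ ξ e + m δ (m ξ e) - m ξ (m δ e) = 0) :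
    ‖m δ e + t • (D ξ δ e + m δ (m ξ e)) + m ξ e - m' (ξ + δ) (e + t • m δ e)‖ ≤
      (2 * (C * ‖ξ + δ‖) + C ^ 2 + C + C) * ‖e‖ * ‖δ‖ ^ 2 := by
  have hC0 : 0 ≤ C := (norm_nonneg m).trans hm
  have htn : ‖t‖ ≤ 1 := by rwa [Real.norm_of_nonneg ht0]
  have hmδ : ∀ a : E, ‖m δ a‖ ≤ C * ‖δ‖ * ‖a‖ := fun a =>
    m.le_of_opNorm₂_le_of_le hm le_rfl le_rfl
  have hz : ‖e + t • m δ e‖ ≤ 2 * ‖e‖ := by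
    refine (norm_add_le _ _).trans ?_
    rw [norm_smul, two_mul]
    gcongr
    calc ‖t‖ * ‖m δ e‖ ≤ 1 * (C * ‖δ‖ * ‖e‖) := by gcongr; exact hmδ e
      _ ≤ 1 * (1 * ‖e‖) := by gcongr
      _ = ‖e‖ := by ring
  have hDD : ∀ (a : X) (b : E), ‖D δ a b‖ ≤ C * ‖δ‖ * ‖a‖ * ‖b‖ := fun a b =>
    (D δ).le_of_opNorm₂_le_of_le (D.le_of_opNorm_le hD δ) le_rfl le_rfl
  have key : m δ e + t • (D ξ δ e + m δ (m ξ e)) + m ξ e - m' (ξ + δ) (e + t • m δ e) =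
      -((m' - m - D (t • δ)) (ξ + δ) (e + t • m δ e)) - t • m δ (m δ e) - t • D δ δ e -
        t • t • D δ (ξ + δ) (m δ e) := by
    have h1 : D ξ δ e = D δ ξ e - m δ (m ξ e) + m ξ (m δ e) := by
      rw [← sub_eq_zero, ← hcurv]
      abel
    rw [h1]
    simp only [map_add, sub_apply, add_apply, ContinuousLinearMap.map_smul_of_tower, smul_apply,
      smul_add, smul_sub]
    abel
  rw [key]
  have e1 : ‖(m' - m - D (t • δ)) (ξ + δ) (e + t • m δ e)‖ ≤
      C * ‖δ‖ ^ 2 * ‖ξ + δ‖ * (2 * ‖e‖) :=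
    ContinuousLinearMap.le_of_opNorm₂_le_of_le _ hm' le_rfl hz
  have e2 : ‖t • m δ (m δ e)‖ ≤ 1 * (C * ‖δ‖ * (C * ‖δ‖ * ‖e‖)) := by
    rw [norm_smul]
    gcongr
    exact (hmδ _).trans (by gcongr; exact hmδ e)
  have e3 : ‖t • D δ δ e‖ ≤ 1 * (C * ‖δ‖ * ‖δ‖ * ‖e‖) := by
    rw [norm_smul]
    gcongr
    exact hDD δ e
  have e4 : ‖t • t • D δ (ξ + δ) (m δ e)‖ ≤ 1 * (1 * (‖δ‖ * 1 * (C * ‖δ‖ * ‖e‖))) := by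
    rw [norm_smul, norm_smul]
    gcongr
    refine (hDD _ _).trans ?_
    calc C * ‖δ‖ * ‖ξ + δ‖ * ‖m δ e‖ = ‖δ‖ * (C * ‖ξ + δ‖) * ‖m δ e‖ := by ring
      _ ≤ ‖δ‖ * 1 * (C * ‖δ‖ * ‖e‖) := by gcongr; exact hmδ e
  calc _ ≤ _ := norm_sub_le _ _
    _ ≤ _ := add_le_add ((norm_sub_le _ _).trans (add_le_add ((norm_sub_le _ _).trans
        (add_le_add ((norm_neg _).le.trans e1) e2)) e3)) e4
    _ = _ := by ring

/-- The second order Taylor estimate along a segment. -/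
theorem norm_sub_sub_fderiv_le {G : Type*} [NormedAddCommGroup G] [NormedSpace ℂ G] {f : X → G}
    {x a b : X} {R C : ℝ} (hf : ∀ u ∈ ball x R, DifferentiableAt ℂ f u) (hC : 0 ≤ C)
    (hlip : ∀ u ∈ ball x R, ∀ u' ∈ ball x R, ‖fderiv ℂ f u - fderiv ℂ f u'‖ ≤ C * ‖u - u'‖)
    (ha : a ∈ ball x R) (hb : b ∈ ball x R) :
    ‖f b - f a - fderiv ℂ f a (b - a)‖ ≤ C * ‖b - a‖ ^ 2 := by
  have hsub : segment ℝ a b ⊆ ball x R := (convex_ball x R).segment_subset ha hb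
  refine ((convex_segment a b).norm_image_sub_le_of_norm_fderiv_le' (𝕜 := ℂ)
    (C := C * ‖b - a‖) (fun u hu => hf u (hsub hu)) (fun u hu => ?_) (left_mem_segment ℝ a b)
    (right_mem_segment ℝ a b)).trans (le_of_eq (by ring))
  refine (hlip u (hsub hu) a ha).trans (mul_le_mul_of_nonneg_left ?_ hC)
  obtain ⟨t, ht, rfl⟩ := (segment_eq_image' ℝ a b ▸ hu)
  rw [add_sub_cancel_left, norm_smul, Real.norm_of_nonneg ht.1]
  exact mul_le_of_le_one_left (norm_nonneg _) ht.2

theorem hasFDerivAt_of_norm_sub_le {f : X → E} {f' : X →L[ℂ] E} {u x : X} {R K : ℝ}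
    (hu : u ∈ ball x R)
    (h : ∀ δ : X, u + δ ∈ ball x R → ‖f (u + δ) - f u - f' δ‖ ≤ K * ‖δ‖ ^ 2) :
    HasFDerivAt f f' u := by
  rw [hasFDerivAt_iff_isLittleO_nhds_zero]
  refine Asymptotics.IsBigO.trans_isLittleO (g := fun δ => ‖δ‖ ^ 2) ?_
    (Asymptotics.isLittleO_norm_pow_id one_lt_two)
  refine Asymptotics.IsBigO.of_bound K ?_
  have h1 : ∀ᶠ δ in nhds (0 : X), u + δ ∈ ball x R := by
    refine ContinuousAt.eventually_mem (f := fun δ => u + δ) (by fun_prop) ?_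
    rw [add_zero]
    exact isOpen_ball.mem_nhds hu
  filter_upwards [h1] with δ hδ
  simpa using h δ hδ

/-- Local existence of solutions `y` of the total differential equation `dy = M y` through any
initial value that satisfies the constraint `ρ y = 0`, if the equation preserves the constraint and
its curvature vanishes where the constraint holds. The solution is obtained by solving the equation
along the segments that start at the initial point. -/
theorem exists_solution_ball [CompleteSpace E] {F : Type*} [NormedAddCommGroup F] [NormedSpace ℂ F]
    {M : X → X →L[ℂ] E →L[ℂ] E} {ρ : X → E →L[ℂ] F} {c : X → X →L[ℂ] F →L[ℂ] F} {x : X} {R C : ℝ}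
    (hM : ∀ u ∈ ball x R, DifferentiableAt ℂ M u) (hρ : ∀ u ∈ ball x R, DifferentiableAt ℂ ρ u)
    (hMC : ∀ u ∈ ball x R, ‖M u‖ ≤ C) (hDC : ∀ u ∈ ball x R, ‖fderiv ℂ M u‖ ≤ C)
    (hlip : ∀ u ∈ ball x R, ∀ u' ∈ ball x R, ‖fderiv ℂ M u - fderiv ℂ M u'‖ ≤ C * ‖u - u'‖)
    (hcC : ∀ u ∈ ball x R, ‖c u‖ ≤ C) (hR : C * (2 * R) ≤ 1 / 2)
    (hpres : ∀ u ∈ ball x R, ∀ ξ e, fderiv ℂ ρ u ξ e + ρ u (M u ξ e) = c u ξ (ρ u e))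
    (hcurv : ∀ u ∈ ball x R, ∀ e, ρ u e = 0 → ∀ ξ δ, fderiv ℂ M u ξ δ e - fderiv ℂ M u δ ξ e +
      M u δ (M u ξ e) - M u ξ (M u δ e) = 0)
    {p : X} (hp : p ∈ ball x R) {y₀ : E} (hy₀ : ρ p y₀ = 0) :
    ∃ y : X → E, y p = y₀ ∧ ∀ u ∈ ball x R, HasFDerivAt y ((M u).flip (y u)) u := by
  have hC0 : 0 ≤ C := (norm_nonneg _).trans (hMC p hp)
  have hcM : ContinuousOn M (ball x R) := fun u hu => (hM u hu).continuousAt.continuousWithinAt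
  have hlen : ∀ u ∈ ball x R, ∀ q ∈ ball x R, C * ‖u - q‖ ≤ 1 / 2 := fun u hu q hq => by
    refine le_trans (mul_le_mul_of_nonneg_left ?_ hC0) hR
    rw [← dist_eq_norm, two_mul]
    exact (dist_triangle_right u q x).trans (add_le_add (le_of_lt hu) (le_of_lt hq))
  have hex : ∀ u ∈ ball x R, ∃ y : ℝ → E, y 0 = y₀ ∧ (∀ t ∈ Icc (0 : ℝ) 1,
      HasDerivWithinAt y (M (p + t • (u - p)) (u - p) (y t)) (Icc 0 1) t) ∧
      ∀ t ∈ Icc (0 : ℝ) 1, ‖y t‖ ≤ ‖y₀‖ * Real.exp 1 := fun u hu =>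
    exists_solution_segment hcM hMC (hlen u hu p hp) hp (by rwa [add_sub_cancel]) y₀
  choose! Y hY0 hY hYB using hex
  have hseg : ∀ u ∈ ball x R, ∀ t ∈ Icc (0 : ℝ) 1, p + t • (u - p) ∈ ball x R := fun u hu t ht =>
    segment_mem_ball hp (by rwa [add_sub_cancel]) ht
  -- The radial solutions satisfy the constraint.
  have hK : ∀ u ∈ ball x R, ∀ t ∈ Icc (0 : ℝ) 1, ρ (p + t • (u - p)) (Y u t) = 0 := by
    intro u hu t ht
    have h := norm_le_of_hasDerivWithinAt (f := fun t : ℝ => ρ (p + t • (u - p)) (Y u t))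
      (f' := fun t => c (p + t • (u - p)) (u - p) (ρ (p + t • (u - p)) (Y u t)))
      (δ := 0) (K := 1 / 2) (ε := 0)
      (fun t ht => by
        have h1 := (hasDerivAt_comp_segment
          (hρ _ (hseg u hu t ht)).hasFDerivAt).hasDerivWithinAt (s := Icc 0 1)
        have h2 :=
          (ContinuousLinearMap.restrictScalarsL ℂ E F ℝ ℝ).hasFDerivAt.comp_hasDerivWithinAt t h1
        have h3 := h2.clm_apply (hY u hu t ht)
        rw [← hpres _ (hseg u hu t ht)]
        exact h3) (by simp [hY0 u hu, hy₀])
      (fun t ht => by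
        rw [add_zero]
        exact ((c _).le_of_opNorm₂_le_of_le (hcC _ (hseg u hu t ht)) le_rfl le_rfl).trans
          (mul_le_mul_of_nonneg_right (hlen u hu p hp) (norm_nonneg _))) t ht
    rw [gronwallBound_ε0_δ0] at h
    exact norm_le_zero_iff.1 h
  refine ⟨fun u => Y u 1, ?_, fun u hu => ?_⟩
  · have h1 := constant_of_has_deriv_right_zero (f := Y p)
      (fun t ht => (hY p hp t ht).continuousWithinAt)
      (fun t ht => by
        have := (hY p hp t (Ico_subset_Icc_self ht)).mono_of_mem_nhdsWithin
          (Icc_mem_nhdsGE_of_mem ht)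
        simpa using this) 1 (right_mem_Icc.2 zero_le_one)
    exact h1.trans (hY0 p hp)
  · set B := ‖y₀‖ * Real.exp 1 with hB
    set ε := (2 * (1 / 2) + C ^ 2 + C + C) * B with hε
    refine hasFDerivAt_of_norm_sub_le (R := R) (K := ε * gronwallBound 0 (1 / 2) 1 1) hu
      fun δ hδ => ?_
    have hδ' : C * ‖δ‖ ≤ 1 / 2 := by simpa using hlen _ hδ u hu
    set ξ := u - p with hξ
    have huδ : u + δ - p = ξ + δ := by rw [hξ]; abel
    set m := fun t : ℝ => M (p + t • ξ)
    set m' := fun t : ℝ => M (p + t • (ξ + δ))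
    set D := fun t : ℝ => fderiv ℂ M (p + t • ξ)
    -- The solution in the direction `ξ + δ` is compared with the first order approximation that the
    -- full system predicts.
    have hw := norm_le_of_hasDerivWithinAt
      (f := fun t : ℝ => Y (u + δ) t - (Y u t + t • m t δ (Y u t)))
      (f' := fun t => m' t (ξ + δ) (Y (u + δ) t) - (m t ξ (Y u t) +
        (t • (D t ξ δ (Y u t) + m t δ (m t ξ (Y u t))) + (1 : ℝ) • m t δ (Y u t))))
      (δ := 0) (K := 1 / 2) (ε := ε * ‖δ‖ ^ 2) (fun t ht => ?_) ?_ (fun t ht => ?_) 1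
      (right_mem_Icc.2 zero_le_one)
    · have hm1 : m 1 = M u := by simp [m, hξ]
      simp only [one_smul, ← sub_sub, hm1] at hw
      refine hw.trans (le_of_eq ?_)
      rw [gronwallBound_of_K_ne_0 (by norm_num), gronwallBound_of_K_ne_0 (by norm_num)]
      ring
    · have hD : HasDerivAt (fun t => m t δ) (D t ξ δ) t :=
        hasDerivAt_comp_segment (f' := (ContinuousLinearMap.apply ℂ (E →L[ℂ] E) δ).comp (D t))
          ((ContinuousLinearMap.apply ℂ (E →L[ℂ] E) δ).hasFDerivAt.comp _
            (hM _ (hseg u hu t ht)).hasFDerivAt)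
      have h2 := (ContinuousLinearMap.restrictScalarsL ℂ E E ℝ ℝ).hasFDerivAt.comp_hasDerivWithinAt
        t (hD.hasDerivWithinAt (s := Icc 0 1))
      have h3 := h2.clm_apply (hY u hu t ht)
      have h4 := (hasDerivWithinAt_id t (Icc 0 1)).smul h3
      have h5 := hY _ hδ t ht
      rw [huδ] at h5
      exact h5.sub ((hY u hu t ht).add h4)
    · simp [hY0 u hu, hY0 _ hδ]
    · have hm1 : p + t • (ξ + δ) ∈ ball x R := huδ ▸ hseg _ hδ t ht
      have htay := norm_sub_sub_fderiv_le hM hC0 hlip (hseg u hu t ht) hm1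
      have hsub : p + t • (ξ + δ) - (p + t • ξ) = t • δ := by rw [smul_add]; abel
      rw [hsub] at htay
      have hξδ : C * ‖ξ + δ‖ ≤ 1 / 2 := huδ ▸ hlen _ hδ p hp
      have hcmp := norm_comparison_le ht.1 ht.2 (hMC _ (hseg u hu t ht)) (hDC _ (hseg u hu t ht))
        (htay.trans (mul_le_mul_of_nonneg_left (pow_le_pow_left₀ (norm_nonneg _)
          (by rw [norm_smul, Real.norm_of_nonneg ht.1]
              exact mul_le_of_le_one_left (norm_nonneg _) ht.2) 2) hC0))
        (hξδ.trans (by norm_num)) (hδ'.trans (by norm_num))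
        (hcurv _ (hseg u hu t ht) _ (hK u hu t ht) ξ δ)
      have hsplit : m' t (ξ + δ) (Y (u + δ) t) - (m t ξ (Y u t) +
          (t • (D t ξ δ (Y u t) + m t δ (m t ξ (Y u t))) + (1 : ℝ) • m t δ (Y u t))) =
          m' t (ξ + δ) (Y (u + δ) t - (Y u t + t • m t δ (Y u t))) -
            (m t δ (Y u t) + t • (D t ξ δ (Y u t) + m t δ (m t ξ (Y u t))) + m t ξ (Y u t) -
              m' t (ξ + δ) (Y u t + t • m t δ (Y u t))) := by
        rw [map_sub (m' t (ξ + δ)), one_smul]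
        abel
      rw [hsplit]
      refine (norm_sub_le _ _).trans (add_le_add ?_ (hcmp.trans ?_))
      · exact ((m' t).le_of_opNorm₂_le_of_le (hMC _ hm1) le_rfl le_rfl).trans
          (mul_le_mul_of_nonneg_right hξδ (norm_nonneg _))
      · rw [hε]
        gcongr
        exact hYB u hu t ht

end LinearSystem

/-! ### Continuation over simply connected spaces -/

/-- The monodromy principle. A locally constant family of bijections onto the sets `K w` is given:
the sections `Φ x f` (`f ∈ F`) over the neighbourhood `B x` of `x` pass through every value exactly
once, and two of them that agree at one point agree where both are defined. Then over a simply
connected space every value extends to a global section. -/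
theorem exists_global_section {W F E : Type*} [TopologicalSpace W] [SimplyConnectedSpace W]
    [LocallyPathConnectedSpace W] {B : W → Set W} (hB : ∀ x, IsOpen (B x)) (hxB : ∀ x, x ∈ B x)
    {K : W → Set E} {Φ : W → F → W → E}
    (hinj : ∀ x, ∀ w ∈ B x, Function.Injective fun f => Φ x f w)
    (hrange : ∀ x, ∀ w ∈ B x, Set.range (fun f => Φ x f w) = K w)
    (huniq : ∀ x y f g, ∀ w ∈ B x ∩ B y, Φ x f w = Φ y g w → ∀ w' ∈ B x ∩ B y, Φ x f w' = Φ y g w')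
    {v : W} {e : E} (he : e ∈ K v) :
    ∃ s : W → E, s v = e ∧ ∀ x, ∃ f : F, ∀ᶠ w in nhds x, s w = Φ x f w := by
  obtain ⟨f₀, hf₀⟩ : ∃ f, Φ v f v = e := by
    have := (hrange v v (hxB v)).symm ▸ he
    exact this
  have : Nonempty F := ⟨f₀⟩
  let _ : TopologicalSpace F := ⊥
  have : DiscreteTopology F := ⟨rfl⟩
  have hinv : ∀ x y f, ∀ w ∈ B x ∩ B y,
      Φ y (Function.invFun (fun g => Φ y g w) (Φ x f w)) w = Φ x f w := by
    intro x y f w hw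
    have h1 : Φ x f w ∈ Set.range fun g => Φ y g w := by
      rw [hrange y w hw.2, ← hrange x w hw.1]
      exact ⟨f, rfl⟩
    exact Function.invFun_eq h1
  -- The local sections are the sheets of a covering space, the bundle with discrete fibre `F`.
  let Z : FiberBundleCore W W F :=
    { baseSet := B
      isOpen_baseSet := hB
      indexAt := id
      mem_baseSet_at := hxB
      coordChange := fun x y w f => Function.invFun (fun g => Φ y g w) (Φ x f w)
      coordChange_self := fun x w hw f => hinj x w hw (hinv x x f w ⟨hw, hw⟩)
      continuousOn_coordChange := fun x y => by
        -- The transition functions are locally constant, as sections that agree at `w` agree.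
        rintro ⟨w, f⟩ ⟨hw, -⟩
        refine ContinuousAt.continuousWithinAt ?_
        have h1 : ∀ᶠ p : W × F in nhds (w, f), p.1 ∈ B x ∩ B y ∧ p.2 = f :=
          prod_mem_nhds (((hB x).inter (hB y)).mem_nhds hw)
            (mem_nhds_discrete.2 (Set.mem_singleton f))
        refine continuousAt_const.congr (f := fun _ =>
          Function.invFun (fun g => Φ y g w) (Φ x f w)) ?_
        filter_upwards [h1] with p hp
        obtain ⟨hp1, hp2⟩ := hp
        refine hinj y p.1 hp1.2 ?_
        simp only
        rw [hinv x y p.2 p.1 hp1, hp2]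
        exact huniq y x _ f w ⟨hw.2, hw.1⟩ (hinv x y f w hw) p.1 ⟨hp1.2, hp1.1⟩
      coordChange_comp := fun x y z w hw f => by
        refine hinj z w hw.2 ?_
        simp only
        rw [hinv y z _ w ⟨hw.1.2, hw.2⟩, hinv x y f w hw.1, hinv x z f w ⟨hw.1.1, hw.2⟩] }
  have hcov : IsCoveringMap (Bundle.TotalSpace.proj : Bundle.TotalSpace F Z.Fiber → W) :=
    FiberBundle.isCoveringMap
  obtain ⟨s, ⟨hs0, hs⟩, -⟩ := hcov.existsUnique_continuousMap_lifts (ContinuousMap.id W) v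
    (⟨v, f₀⟩ : Bundle.TotalSpace F Z.Fiber) rfl
  have hproj : ∀ w, (s w).1 = w := fun w => congrFun hs w
  refine ⟨fun w => Φ (s w).1 (s w).2 w, ?_, fun x => ?_⟩
  · have h0 : ∀ q : Bundle.TotalSpace F Z.Fiber, q = ⟨v, f₀⟩ → Φ q.1 q.2 v = e := by
      rintro _ rfl
      exact hf₀
    exact h0 _ hs0
  · have hmem : s x ∈ (Z.localTriv x).source := by
      rw [Z.mem_localTriv_source, hproj]
      exact hxB x
    have hcont : ContinuousAt (fun w => (Z.localTriv x (s w)).2) x :=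
      continuousAt_snd.comp (((Z.localTriv x).continuousAt hmem).comp s.continuous.continuousAt)
    have hev : ∀ᶠ w in nhds x, (Z.localTriv x (s w)).2 = (Z.localTriv x (s x)).2 :=
      hcont (mem_nhds_discrete.2 (Set.mem_singleton _))
    refine ⟨(Z.localTriv x (s x)).2, ?_⟩
    filter_upwards [hev, (hB x).mem_nhds (hxB x)] with w hw hwx
    rw [← hw, Z.localTriv_apply]
    have h2 := hinv (s w).1 x (s w).2 w ⟨by rw [hproj]; exact hxB w, hwx⟩
    refine h2.symm.trans ?_
    change _ = Φ x (Function.invFun (fun g => Φ x g (s w).1) (Φ (s w).1 (s w).2 (s w).1)) w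
    rw [hproj]

/-! ### Linear systems with constraints: global theory -/

namespace LinearSystem

set_option maxSynthPendingDepth 3

open Set Metric

variable {X E F : Type*} [NormedAddCommGroup X] [NormedSpace ℂ X] [NormedAddCommGroup E]
  [NormedSpace ℂ E] [NormedAddCommGroup F] [NormedSpace ℂ F]
  {M : X → X →L[ℂ] E →L[ℂ] E} {ρ : X → E →L[ℂ] F} {c : X → X →L[ℂ] F →L[ℂ] F}

theorem eqOn_of_isPreconnected {y z : X → E} {V : Set X} (hV : IsOpen V) (hVc : IsPreconnected V)
    (hM : ContinuousOn M V) (hy : ∀ u ∈ V, HasFDerivAt y ((M u).flip (y u)) u)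
    (hz : ∀ u ∈ V, HasFDerivAt z ((M u).flip (z u)) u) {p : X} (hp : p ∈ V) (h : y p = z p) :
    ∀ u ∈ V, y u = z u := fun u hu => sub_eq_zero.1 <|
  eq_zero_of_isPreconnected (y := fun u => y u - z u) hV hVc hM
    (fun u hu => by rw [map_sub]; exact (hy u hu).sub (hz u hu)) hp (sub_eq_zero.2 h) u hu

/-- Solutions of the system stay in the constraint. -/
theorem constraint_of_isPreconnected {y : X → E} {V : Set X} (hV : IsOpen V)
    (hVc : IsPreconnected V) (hρ : ∀ u ∈ V, DifferentiableAt ℂ ρ u) (hc : ContinuousOn c V)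
    (hpres : ∀ u ∈ V, ∀ ξ e, fderiv ℂ ρ u ξ e + ρ u (M u ξ e) = c u ξ (ρ u e))
    (hy : ∀ u ∈ V, HasFDerivAt y ((M u).flip (y u)) u) {p : X} (hp : p ∈ V) (h : ρ p (y p) = 0) :
    ∀ u ∈ V, ρ u (y u) = 0 := by
  refine eq_zero_of_isPreconnected (y := fun u => ρ u (y u)) hV hVc hc (fun u hu => ?_) hp h
  convert! (hρ u hu).hasFDerivAt.clm_apply (hy u hu) using 1
  ext ξ
  simp [← hpres u hu, add_comm]

/-- Around every point there is one ball that works for all initial points and all initial values.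
-/
theorem exists_ball_solution [CompleteSpace E] {U : Set X} (hU : IsOpen U)
    (hM : ContDiffOn ℂ 2 M U) (hρ : ∀ u ∈ U, DifferentiableAt ℂ ρ u) (hc : ContinuousOn c U)
    (hpres : ∀ u ∈ U, ∀ ξ e, fderiv ℂ ρ u ξ e + ρ u (M u ξ e) = c u ξ (ρ u e))
    (hcurv : ∀ u ∈ U, ∀ e, ρ u e = 0 → ∀ ξ δ, fderiv ℂ M u ξ δ e - fderiv ℂ M u δ ξ e +
      M u δ (M u ξ e) - M u ξ (M u δ e) = 0) {x : X} (hx : x ∈ U) :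
    ∃ R > 0, ball x R ⊆ U ∧ ∀ p ∈ ball x R, ∀ y₀, ρ p y₀ = 0 →
      ∃ y : X → E, y p = y₀ ∧ ∀ u ∈ ball x R, HasFDerivAt y ((M u).flip (y u)) u := by
  have hMx : ContDiffAt ℂ 2 M x := hM.contDiffAt (hU.mem_nhds hx)
  have hDx : ContDiffAt ℂ 1 (fderiv ℂ M) x := hMx.fderiv_right (by norm_num)
  obtain ⟨L, s, hs, hL⟩ := hDx.exists_lipschitzOnWith
  obtain ⟨r, hr, hrs⟩ := Metric.mem_nhds_iff.1 hs
  obtain ⟨R₁, hR₁, hU₁, hb₁⟩ := exists_ball_norm_le (G := X →L[ℂ] E →L[ℂ] E) hU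
    hM.continuousOn hx
  obtain ⟨R₂, hR₂, hU₂, hb₂⟩ := exists_ball_norm_le (G := X →L[ℂ] X →L[ℂ] E →L[ℂ] E) hU
    (hM.continuousOn_fderiv_of_isOpen hU (by norm_num)) hx
  obtain ⟨R₃, hR₃, hU₃, hb₃⟩ := exists_ball_norm_le (G := X →L[ℂ] F →L[ℂ] F) hU hc hx
  set C : ℝ := L + (‖M x‖ + 1) + (‖fderiv ℂ M x‖ + 1) + (‖c x‖ + 1) with hC
  have hL0 : (0 : ℝ) ≤ L := L.2
  have h1 := norm_nonneg (M x)
  have h2 := norm_nonneg (fderiv ℂ M x)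
  have h3 := norm_nonneg (c x)
  have hC0 : 0 < C := by positivity
  set R : ℝ := min (min r (1 / (4 * C))) (min R₁ (min R₂ R₃)) with hR
  have hRr : R ≤ r := (min_le_left _ _).trans (min_le_left _ _)
  have hRC : R ≤ 1 / (4 * C) := (min_le_left _ _).trans (min_le_right _ _)
  have hRR₁ : R ≤ R₁ := (min_le_right _ _).trans (min_le_left _ _)
  have hRR₂ : R ≤ R₂ := (min_le_right _ _).trans ((min_le_right _ _).trans (min_le_left _ _))
  have hRR₃ : R ≤ R₃ := (min_le_right _ _).trans ((min_le_right _ _).trans (min_le_right _ _))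
  have hRU : ball x R ⊆ U := (ball_subset_ball hRR₁).trans hU₁
  refine ⟨R, by positivity, hRU, fun p hp y₀ hy₀ => ?_⟩
  refine exists_solution_ball (C := C) (ρ := ρ) (c := c)
    (fun u hu => (hM.contDiffAt (hU.mem_nhds (hRU hu))).differentiableAt (by norm_num))
    (fun u hu => hρ u (hRU hu)) (fun u hu => ?_) (fun u hu => ?_) (fun u hu u' hu' => ?_)
    (fun u hu => ?_) ?_ (fun u hu => hpres u (hRU hu)) (fun u hu => hcurv u (hRU hu)) hp hy₀
  · exact (hb₁ u (ball_subset_ball hRR₁ hu)).trans (by rw [hC]; linarith)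
  · exact (hb₂ u (ball_subset_ball hRR₂ hu)).trans (by rw [hC]; linarith)
  · have h4 := hL.dist_le_mul u (hrs (ball_subset_ball hRr hu)) u'
      (hrs (ball_subset_ball hRr hu'))
    rw [dist_eq_norm, dist_eq_norm] at h4
    exact h4.trans (mul_le_mul_of_nonneg_right (by rw [hC]; linarith) (norm_nonneg _))
  · exact (hb₃ u (ball_subset_ball hRR₃ hu)).trans (by rw [hC]; linarith)
  · calc C * (2 * R) ≤ C * (2 * (1 / (4 * C))) := by gcongr
      _ = 1 / 2 := by field_simp; norm_num

/-- Over a simply connected open set every initial value that satisfies the constraint extends to a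
solution. -/
theorem exists_solution [CompleteSpace E] {U : Set X} (hU : IsOpen U) (hUs : IsSimplyConnected U)
    (hM : ContDiffOn ℂ 2 M U) (hρ : ∀ u ∈ U, DifferentiableAt ℂ ρ u) (hc : ContinuousOn c U)
    (hpres : ∀ u ∈ U, ∀ ξ e, fderiv ℂ ρ u ξ e + ρ u (M u ξ e) = c u ξ (ρ u e))
    (hcurv : ∀ u ∈ U, ∀ e, ρ u e = 0 → ∀ ξ δ, fderiv ℂ M u ξ δ e - fderiv ℂ M u δ ξ e +
      M u δ (M u ξ e) - M u ξ (M u δ e) = 0) {v : X} (hv : v ∈ U) {y₀ : E} (hy₀ : ρ v y₀ = 0) :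
    ∃ y : X → E, y v = y₀ ∧ (∀ u ∈ U, HasFDerivAt y ((M u).flip (y u)) u) ∧
      ∀ u ∈ U, ρ u (y u) = 0 := by
  have hUpc : IsPathConnected U := hUs.isPathConnected
  have := hUs.simplyConnectedSpace
  have := hU.locallyPathConnectedSpace
  have hMc := hM.continuousOn
  have hex := fun x : U => exists_ball_solution hU hM hρ hc hpres hcurv x.2
  choose R hR hRU S hS0 hS using hex
  have hcb : ∀ (x : U) (y : X → E), (∀ u ∈ ball (x : X) (R x), HasFDerivAt y ((M u).flip (y u)) u) →
      ∀ p ∈ ball (x : X) (R x), ρ p (y p) = 0 → ∀ u ∈ ball (x : X) (R x), ρ u (y u) = 0 :=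
    fun x y hy p hp h0 => constraint_of_isPreconnected isOpen_ball (convex_ball _ _).isPreconnected
      (fun u hu => hρ u (hRU x hu)) (hc.mono (hRU x)) (fun u hu => hpres u (hRU x hu)) hy hp h0
  have hub : ∀ (x x' : U) (y z : X → E),
      (∀ u ∈ ball (x : X) (R x), HasFDerivAt y ((M u).flip (y u)) u) →
      (∀ u ∈ ball (x' : X) (R x'), HasFDerivAt z ((M u).flip (z u)) u) →
      ∀ p ∈ ball (x : X) (R x) ∩ ball (x' : X) (R x'), y p = z p →
        ∀ u ∈ ball (x : X) (R x) ∩ ball (x' : X) (R x'), y u = z u :=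
    fun x x' y z hy hz p hp h => eqOn_of_isPreconnected (isOpen_ball.inter isOpen_ball)
      ((convex_ball _ _).inter (convex_ball _ _)).isPreconnected
      (hMc.mono (inter_subset_left.trans (hRU x))) (fun u hu => hy u hu.1) (fun u hu => hz u hu.2)
      hp h
  let K : U → Set E := fun w => {e | ρ w e = 0}
  have hself : ∀ x : U, (x : X) ∈ ball (x : X) (R x) := fun x => mem_ball_self (hR x)
  let S' : (x : U) → K x → X → E := fun x e => S x x (hself x) e e.2
  have hS' : ∀ (x : U) (e : K x), ∀ u ∈ ball (x : X) (R x),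
      HasFDerivAt (S' x e) ((M u).flip (S' x e u)) u := fun x e => hS x x (hself x) e e.2
  have hS'0 : ∀ (x : U) (e : K x), S' x e x = e := fun x e => hS0 x x (hself x) e e.2
  have hS'K : ∀ (x : U) (e : K x), ∀ u ∈ ball (x : X) (R x), ρ u (S' x e u) = 0 := fun x e =>
    hcb x _ (hS' x e) x (hself x) (by rw [hS'0]; exact e.2)
  have hinj : ∀ x : U, ∀ u ∈ ball (x : X) (R x), Function.Injective fun e : K x => S' x e u := by
    intro x u hu e e' h
    have h1 := hub x x _ _ (hS' x e) (hS' x e') u ⟨hu, hu⟩ h x ⟨hself x, hself x⟩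
    rw [hS'0, hS'0] at h1
    exact Subtype.ext h1
  have hsurj : ∀ x : U, ∀ u ∈ ball (x : X) (R x), ∀ e, ρ u e = 0 → ∃ e' : K x, S' x e' u = e := by
    intro x u hu e he
    have h1 := hS x u hu e he
    refine ⟨⟨S x u hu e he x, hcb x _ h1 u hu (by rw [hS0]; exact he) x (hself x)⟩, ?_⟩
    exact (hub x x _ _ (hS' x _) h1 x ⟨hself x, hself x⟩ (hS'0 x _) u ⟨hu, hu⟩).trans
      (hS0 x u hu e he)
  -- The constraint spaces at different points are in bijection, so that one set labels the local
  -- solutions around all points.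
  have hequiv : ∀ x y : U, Nonempty (K x ≃ K y) := by
    have : Std.Symm fun x y : U => Nonempty (K x ≃ K y) := ⟨fun x y ⟨e⟩ => ⟨e.symm⟩⟩
    refine PreconnectedSpace.induction₂ _ (fun x => ?_)
      ⟨fun x y z ⟨e⟩ ⟨e'⟩ => ⟨e.trans e'⟩⟩
    have h1 : ∀ᶠ w : U in nhds x, (w : X) ∈ ball (x : X) (R x) :=
      continuous_subtype_val.continuousAt.eventually_mem (ball_mem_nhds _ (hR x))
    filter_upwards [h1] with w hw
    refine ⟨Equiv.ofBijective (fun e => ⟨S' x e w, hS'K x e w hw⟩) ⟨fun e e' h => ?_, fun e => ?_⟩⟩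
    · exact hinj x w hw (congrArg Subtype.val h)
    · obtain ⟨e', he'⟩ := hsurj x w hw e e.2
      exact ⟨e', Subtype.ext he'⟩
  have τ : ∀ x : U, K ⟨v, hv⟩ ≃ K x := fun x => (hequiv ⟨v, hv⟩ x).some
  obtain ⟨s, hs0, hs⟩ := exists_global_section (W := U) (F := K ⟨v, hv⟩) (K := K) (v := ⟨v, hv⟩)
    (B := fun x => {w | (w : X) ∈ ball (x : X) (R x)}) (e := y₀)
    (Φ := fun x f w => S' x (τ x f) w)
    (fun x => isOpen_ball.preimage continuous_subtype_val) hself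
    (fun x w hw => (hinj x w hw).comp (τ x).injective)
    (fun x w hw => by
      ext e
      constructor
      · rintro ⟨f, rfl⟩
        exact hS'K x _ w hw
      · intro he
        obtain ⟨e', rfl⟩ := hsurj x w hw e he
        exact ⟨(τ x).symm e', by simp⟩)
    (fun x y f g w hw h w' hw' => hub x y _ _ (hS' x _) (hS' y _) w hw h w' hw') hy₀
  classical
  let y : X → E := fun u => if h : u ∈ U then s ⟨u, h⟩ else 0
  have hyU : ∀ w : U, y w = s w := fun w => dif_pos w.2
  have hy : ∀ u ∈ U, HasFDerivAt y ((M u).flip (y u)) u := by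
    intro u hu
    obtain ⟨f, hf⟩ := hs ⟨u, hu⟩
    have h1 : y =ᶠ[nhds u] S' ⟨u, hu⟩ (τ ⟨u, hu⟩ f) := by
      rw [← hU.isOpenEmbedding_subtypeVal.map_nhds_eq ⟨u, hu⟩]
      refine Filter.eventually_map.2 ?_
      filter_upwards [hf] with w hw
      rw [hyU, hw]
    rw [h1.eq_of_nhds]
    exact (hS' _ _ u (hself ⟨u, hu⟩)).congr_of_eventuallyEq h1
  have hyv : y v = y₀ := (hyU ⟨v, hv⟩).trans hs0
  exact ⟨y, hyv, hy, constraint_of_isPreconnected hU hUpc.isConnected.isPreconnected hρ hc hpres hy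
    hv (by rw [hyv]; exact hy₀)⟩

end LinearSystem

/-! ### The ring of parameters -/

section Parameters

open LaurentPolynomial

variable {k : ℕ}

theorem isOpen_configSpace (k : ℕ) : IsOpen (configSpace k) := by
  have h1 : configSpace k =
      (⋂ (i : Fin k) (j : Fin k) (_ : i ≠ j), {u | u i ≠ u j}) ∩ ⋂ i : Fin k, {u | u i ≠ 0} := by
    ext u
    simp only [configSpace, Function.Injective, Set.mem_ofPred_eq, Set.mem_inter_iff,
      Set.mem_iInter]
    refine and_congr_left fun _ => ⟨fun h i j hij h' => hij (h h'), fun h i j hij => ?_⟩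
    by_contra h'
    exact h i j h' hij
  rw [h1]
  refine IsOpen.inter (isOpen_iInter_of_finite fun i => isOpen_iInter_of_finite fun j =>
    isOpen_iInter_of_finite fun _ => ?_) (isOpen_iInter_of_finite fun i => ?_)
  · exact isOpen_ne_fun (continuous_apply i) (continuous_apply j)
  · exact isOpen_ne_fun (continuous_apply i) continuous_const

/-- The coordinate `u i` as a function on the configuration space. -/
def coordFun (i : Fin k) : configSpace k → ℂ := fun u => u.1 i

/-- The ring of functions on the configuration space generated by the coordinates `u i` and the
functions `(u i)⁻¹` and `(u i - u j)⁻¹`. -/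
def paramRing (k : ℕ) : Subalgebra ℂ (configSpace k → ℂ) :=
  Algebra.adjoin ℂ (Set.range coordFun ∪ Set.range (fun i => (coordFun i)⁻¹) ∪
    (fun p : Fin k × Fin k => (coordFun p.1 - coordFun p.2)⁻¹) '' {p | p.1 ≠ p.2})

instance : IsNoetherianRing (paramRing k) := by
  refine isNoetherianRing_of_fg (Subalgebra.fg_def.2 ⟨_, ?_, rfl⟩)
  exact ((Set.finite_range _).union (Set.finite_range _)).union ((Set.toFinite _).image _)

/-- The extension by zero of a function on the configuration space. -/
noncomputable def extendFun (a : configSpace k → ℂ) : (Fin k → ℂ) → ℂ :=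
  Function.extend Subtype.val a 0

theorem extendFun_apply (a : configSpace k → ℂ) (u : configSpace k) : extendFun a u = a u :=
  Subtype.val_injective.extend_apply _ _ _

theorem extendFun_eventuallyEq {a : configSpace k → ℂ} {F : (Fin k → ℂ) → ℂ}
    (h : ∀ u : configSpace k, a u = F u) {u : Fin k → ℂ} (hu : u ∈ configSpace k) :
    extendFun a =ᶠ[nhds u] F := by
  filter_upwards [(isOpen_configSpace k).mem_nhds hu] with w hw
  exact (extendFun_apply a ⟨w, hw⟩).trans (h ⟨w, hw⟩)

/-- The partial derivative `∂ / ∂ u i` of a function on the configuration space. -/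
noncomputable def partialFun (i : Fin k) (a : configSpace k → ℂ) : configSpace k → ℂ :=
  fun u => fderiv ℂ (extendFun a) u (Pi.single i 1)

theorem partialFun_eq {a : configSpace k → ℂ} {F : (Fin k → ℂ) → ℂ}
    (h : ∀ u : configSpace k, a u = F u) (i : Fin k) (u : configSpace k) :
    partialFun i a u = fderiv ℂ F u (Pi.single i 1) := by
  rw [partialFun, (extendFun_eventuallyEq h u.2).fderiv_eq]

theorem contDiffOn_extendFun {a : configSpace k → ℂ} {F : (Fin k → ℂ) → ℂ}
    (h : ∀ u : configSpace k, a u = F u) (hF : ContDiffOn ℂ 2 F (configSpace k)) :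
    ContDiffOn ℂ 2 (extendFun a) (configSpace k) :=
  hF.congr fun u hu => (extendFun_apply a ⟨u, hu⟩).trans (h ⟨u, hu⟩)

theorem differentiableAt_extendFun {a : configSpace k → ℂ}
    (ha : ContDiffOn ℂ 2 (extendFun a) (configSpace k)) {u : Fin k → ℂ} (hu : u ∈ configSpace k) :
    DifferentiableAt ℂ (extendFun a) u :=
  (ha.contDiffAt ((isOpen_configSpace k).mem_nhds hu)).differentiableAt (by norm_num)

theorem partialFun_add {a b : configSpace k → ℂ}
    (ha : ContDiffOn ℂ 2 (extendFun a) (configSpace k))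
    (hb : ContDiffOn ℂ 2 (extendFun b) (configSpace k)) (i : Fin k) :
    partialFun i (a + b) = partialFun i a + partialFun i b := by
  ext u
  rw [partialFun_eq (F := extendFun a + extendFun b) (fun u => by simp [extendFun_apply]),
    fderiv_add (differentiableAt_extendFun ha u.2) (differentiableAt_extendFun hb u.2)]
  rfl

theorem partialFun_mul {a b : configSpace k → ℂ}
    (ha : ContDiffOn ℂ 2 (extendFun a) (configSpace k))
    (hb : ContDiffOn ℂ 2 (extendFun b) (configSpace k)) (i : Fin k) :
    partialFun i (a * b) = a * partialFun i b + b * partialFun i a := by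
  ext u
  rw [partialFun_eq (F := extendFun a * extendFun b) (fun u => by simp [extendFun_apply]),
    fderiv_mul (differentiableAt_extendFun ha u.2) (differentiableAt_extendFun hb u.2)]
  simp [partialFun, extendFun_apply]

theorem partialFun_const (c : ℂ) (i : Fin k) : partialFun i (fun _ => c) = 0 := by
  ext u
  rw [partialFun_eq (F := fun _ => c) (fun u => rfl)]
  simp

theorem partialFun_coordFun (i j : Fin k) :
    partialFun i (coordFun j) = fun _ => if i = j then 1 else 0 := by
  ext u
  rw [partialFun_eq (a := coordFun j) (F := fun u => u j) (fun u => rfl)]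
  rw [show fderiv ℂ (fun u : Fin k → ℂ => u j) u = ContinuousLinearMap.proj j from
    (ContinuousLinearMap.proj (R := ℂ) (φ := fun _ : Fin k => ℂ) j).fderiv]
  simp [Pi.single_apply, eq_comm]

theorem partialFun_inv {b : configSpace k → ℂ} (hb : ContDiffOn ℂ 2 (extendFun b) (configSpace k))
    (hb0 : ∀ u, b u ≠ 0) (i : Fin k) : partialFun i b⁻¹ = -(b⁻¹ ^ 2 * partialFun i b) := by
  ext u
  rw [partialFun_eq (F := fun u => (extendFun b u)⁻¹) (fun u => by simp [extendFun_apply])]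
  have h1 : extendFun b u ≠ 0 := by rw [extendFun_apply]; exact hb0 u
  rw [show fderiv ℂ (fun u => (extendFun b u)⁻¹) u = _ from ((hasDerivAt_inv h1).comp_hasFDerivAt
    u.1 (differentiableAt_extendFun hb u.2).hasFDerivAt).fderiv]
  simp [partialFun, extendFun_apply]

theorem contDiffOn_extendFun_coordFun (j : Fin k) :
    ContDiffOn ℂ 2 (extendFun (coordFun j)) (configSpace k) :=
  contDiffOn_extendFun (F := fun u => u j) (fun _ => rfl) (contDiff_apply ℂ ℂ j).contDiffOn

theorem contDiffOn_extendFun_inv {b : configSpace k → ℂ}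
    (hb : ContDiffOn ℂ 2 (extendFun b) (configSpace k)) (hb0 : ∀ u, b u ≠ 0) :
    ContDiffOn ℂ 2 (extendFun b⁻¹) (configSpace k) :=
  contDiffOn_extendFun (F := fun u => (extendFun b u)⁻¹) (fun u => by simp [extendFun_apply])
    (hb.inv fun u hu => by rw [extendFun_apply b ⟨u, hu⟩]; exact hb0 _)

theorem contDiffOn_extendFun_sub {a b : configSpace k → ℂ}
    (ha : ContDiffOn ℂ 2 (extendFun a) (configSpace k))
    (hb : ContDiffOn ℂ 2 (extendFun b) (configSpace k)) :
    ContDiffOn ℂ 2 (extendFun (a - b)) (configSpace k) :=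
  contDiffOn_extendFun (F := fun u => extendFun a u - extendFun b u)
    (fun u => by simp [extendFun_apply]) (ha.sub hb)

theorem coordFun_mem (j : Fin k) : coordFun j ∈ paramRing k :=
  Algebra.subset_adjoin (Or.inl (Or.inl ⟨j, rfl⟩))

theorem coordFun_inv_mem (j : Fin k) : (coordFun j)⁻¹ ∈ paramRing k :=
  Algebra.subset_adjoin (Or.inl (Or.inr ⟨j, rfl⟩))

theorem coordFun_sub_inv_mem {j l : Fin k} (h : j ≠ l) :
    (coordFun j - coordFun l)⁻¹ ∈ paramRing k :=
  Algebra.subset_adjoin (Or.inr ⟨(j, l), h, rfl⟩)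

theorem coordFun_sub_ne_zero {j l : Fin k} (h : j ≠ l) (u : configSpace k) :
    (coordFun j - coordFun l) u ≠ 0 :=
  sub_ne_zero.2 (u.2.1.ne h)

theorem partialFun_coordFun_sub (i j l : Fin k) : partialFun i (coordFun j - coordFun l) =
    fun _ => (if i = j then 1 else 0) - if i = l then 1 else 0 := by
  ext u
  rw [partialFun_eq (F := extendFun (coordFun j) - extendFun (coordFun l))
    (fun u => by simp [extendFun_apply]),
    fderiv_sub (differentiableAt_extendFun (contDiffOn_extendFun_coordFun j) u.2)
      (differentiableAt_extendFun (contDiffOn_extendFun_coordFun l) u.2)]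
  have h1 := congrFun (partialFun_coordFun i j) u
  have h2 := congrFun (partialFun_coordFun i l) u
  exact congrArg₂ (· - ·) h1 h2

/-- The functions in the ring of parameters are twice continuously differentiable, and the ring is
stable under the partial derivatives. -/
theorem contDiffOn_and_partialFun_mem {a : configSpace k → ℂ} (ha : a ∈ paramRing k) :
    ContDiffOn ℂ 2 (extendFun a) (configSpace k) ∧ ∀ i, partialFun i a ∈ paramRing k := by
  have hconst : ∀ c : ℂ, (fun _ => c) ∈ paramRing k := fun c => (paramRing k).algebraMap_mem c
  induction ha using Algebra.adjoin_induction with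
  | mem a ha =>
    rcases ha with (⟨j, rfl⟩ | ⟨j, rfl⟩) | ⟨⟨j, l⟩, hjl, rfl⟩
    · exact ⟨contDiffOn_extendFun_coordFun j, fun i => by
        rw [partialFun_coordFun]; exact hconst _⟩
    · have h0 : ∀ u, coordFun j u ≠ 0 := fun u => u.2.2 j
      refine ⟨contDiffOn_extendFun_inv (contDiffOn_extendFun_coordFun j) h0, fun i => ?_⟩
      rw [partialFun_inv (contDiffOn_extendFun_coordFun j) h0, partialFun_coordFun]
      exact neg_mem (mul_mem (pow_mem (coordFun_inv_mem j) 2) (hconst _))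
    · have h0 := coordFun_sub_ne_zero (k := k) hjl
      have h1 := contDiffOn_extendFun_sub (contDiffOn_extendFun_coordFun j)
        (contDiffOn_extendFun_coordFun l)
      refine ⟨contDiffOn_extendFun_inv h1 h0, fun i => ?_⟩
      rw [partialFun_inv h1 h0, partialFun_coordFun_sub]
      exact neg_mem (mul_mem (pow_mem (coordFun_sub_inv_mem hjl) 2) (hconst _))
  | algebraMap c =>
    refine ⟨contDiffOn_extendFun (F := fun _ => c) (fun u => rfl) contDiffOn_const, fun i => ?_⟩
    rw [show (algebraMap ℂ (configSpace k → ℂ)) c = fun _ => c from rfl, partialFun_const]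
    exact zero_mem _
  | add a b _ _ ha hb =>
    refine ⟨contDiffOn_extendFun (F := fun u => extendFun a u + extendFun b u)
      (fun u => by simp [extendFun_apply]) (ha.1.add hb.1), fun i => ?_⟩
    rw [partialFun_add ha.1 hb.1]
    exact add_mem (ha.2 i) (hb.2 i)
  | mul a b ha' hb' ha hb =>
    refine ⟨contDiffOn_extendFun (F := fun u => extendFun a u * extendFun b u)
      (fun u => by simp [extendFun_apply]) (ha.1.mul hb.1), fun i => ?_⟩
    rw [partialFun_mul ha.1 hb.1]
    exact add_mem (mul_mem ha' (hb.2 i)) (mul_mem hb' (ha.2 i))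

/-- The partial derivative `∂ / ∂ u i` as a derivation of the ring of parameters. -/
noncomputable def paramDerivation (i : Fin k) : Derivation ℂ (paramRing k) (paramRing k) :=
  Derivation.mk'
    { toFun := fun a => ⟨partialFun i a, (contDiffOn_and_partialFun_mem a.2).2 i⟩
      map_add' := fun a b => Subtype.ext (partialFun_add (contDiffOn_and_partialFun_mem a.2).1
        (contDiffOn_and_partialFun_mem b.2).1 i)
      map_smul' := fun c a => Subtype.ext <| by
        ext u
        change partialFun i (c • a.1) u = c • partialFun i a u
        rw [partialFun_eq (F := c • extendFun a.1) (fun u => by simp [extendFun_apply]),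
          fderiv_const_smul (differentiableAt_extendFun (contDiffOn_and_partialFun_mem a.2).1 u.2)]
        rfl }
    fun a b => Subtype.ext (partialFun_mul (contDiffOn_and_partialFun_mem a.2).1
      (contDiffOn_and_partialFun_mem b.2).1 i)

theorem coe_paramDerivation (i : Fin k) (a : paramRing k) :
    (paramDerivation i a : configSpace k → ℂ) = partialFun i a := rfl

theorem clm_apply_eq_sum {G : Type*} [AddCommGroup G] [Module ℂ G] [TopologicalSpace G]
    (f : (Fin k → ℂ) →L[ℂ] G) (ξ : Fin k → ℂ) : f ξ = ∑ i, ξ i • f (Pi.single i 1) := by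
  conv_lhs => rw [← Finset.univ_sum_single ξ, map_sum]
  refine Finset.sum_congr rfl fun i _ => ?_
  rw [← f.map_smul, ← Pi.single_smul, smul_eq_mul, mul_one]

theorem hasFDerivAt_extendFun (a : paramRing k) {u : Fin k → ℂ} (hu : u ∈ configSpace k) :
    HasFDerivAt (extendFun a.1) (∑ i, extendFun (paramDerivation i a).1 u •
      ContinuousLinearMap.proj (R := ℂ) (φ := fun _ : Fin k => ℂ) i) u := by
  have h1 := (differentiableAt_extendFun (contDiffOn_and_partialFun_mem a.2).1 hu).hasFDerivAt
  suffices h : (∑ i, extendFun (paramDerivation i a).1 u •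
      ContinuousLinearMap.proj (R := ℂ) (φ := fun _ : Fin k => ℂ) i) =
      fderiv ℂ (extendFun a.1) u by rw [h]; exact h1
  refine ContinuousLinearMap.ext fun ξ => ?_
  rw [sum_apply, clm_apply_eq_sum (fderiv ℂ (extendFun a.1) u) ξ]
  refine Finset.sum_congr rfl fun j _ => ?_
  have h2 : extendFun (partialFun j a.1) u = fderiv ℂ (extendFun a.1) u (Pi.single j 1) :=
    extendFun_apply _ ⟨u, hu⟩
  rw [coe_paramDerivation, h2]
  simp [mul_comm]

theorem paramDerivation_comm (i j : Fin k) (a : paramRing k) :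
    paramDerivation i (paramDerivation j a) = paramDerivation j (paramDerivation i a) := by
  have hC := (contDiffOn_and_partialFun_mem a.2).1
  have key : ∀ (i j : Fin k) (u : configSpace k), partialFun i (partialFun j a.1) u =
      fderiv ℂ (fderiv ℂ (extendFun a.1)) u (Pi.single i 1) (Pi.single j 1) := by
    intro i j u
    have hd : DifferentiableAt ℂ (fderiv ℂ (extendFun a.1)) u :=
      ((hC.contDiffAt ((isOpen_configSpace k).mem_nhds u.2)).fderiv_right
        (m := 1) (by norm_num)).differentiableAt (by norm_num)
    rw [partialFun_eq (a := partialFun j a.1)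
      (F := fun u => fderiv ℂ (extendFun a.1) u (Pi.single j 1)) (fun u => rfl),
      (hd.hasFDerivAt.clm_apply (hasFDerivAt_const _ _)).fderiv]
    simp
  refine Subtype.ext (funext fun u => ?_)
  rw [coe_paramDerivation, coe_paramDerivation, coe_paramDerivation, coe_paramDerivation, key, key]
  exact (hC.contDiffAt ((isOpen_configSpace k).mem_nhds u.2)).isSymmSndFDerivAt (by simp) _ _

/-- The evaluation of the functions in the ring of parameters at a configuration. -/
def paramEval (u : configSpace k) : paramRing k →ₐ[ℂ] ℂ :=
  (Pi.evalAlgHom ℂ (fun _ => ℂ) u).comp (paramRing k).val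

theorem paramEval_apply (u : configSpace k) (a : paramRing k) : paramEval u a = a.1 u := rfl

/-- The coordinates as elements of the ring of parameters. -/
def paramCoord (i : Fin k) : paramRing k := ⟨coordFun i, coordFun_mem i⟩

theorem isUnit_paramCoord (i : Fin k) : IsUnit (paramCoord i) :=
  IsUnit.of_mul_eq_one ⟨_, coordFun_inv_mem i⟩
    (Subtype.ext (funext fun u => mul_inv_cancel₀ (u.2.2 i)))

theorem isUnit_paramCoord_sub {i j : Fin k} (h : i ≠ j) :
    IsUnit (paramCoord i - paramCoord j) :=
  IsUnit.of_mul_eq_one ⟨_, coordFun_sub_inv_mem h⟩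
    (Subtype.ext (funext fun u => mul_inv_cancel₀ (coordFun_sub_ne_zero h u)))

end Parameters

/-! ### Existence of the coefficient functions -/

namespace LaurentPolynomial

section

variable {A : Type*} [CommRing A]

/-- Modulo `s ^ 2` the elements invertible by a linear polynomial `b + c s` are closed under
products. -/
theorem exists_linear_inverse_mul {s f g : A[T;T⁻¹]}
    (hf : ∃ b c : A, s ^ 2 ∣ f * (C b + C c * s) - 1)
    (hg : ∃ b c : A, s ^ 2 ∣ g * (C b + C c * s) - 1) :
    ∃ b c : A, s ^ 2 ∣ f * g * (C b + C c * s) - 1 := by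
  obtain ⟨b, c, q, hq⟩ := hf
  obtain ⟨b', c', q', hq'⟩ := hg
  refine ⟨b * b', b * c' + c * b', q * (g * (C b' + C c' * s)) + q' - f * g * C c * C c', ?_⟩
  simp only [map_add, map_mul]
  linear_combination (g * (C b' + C c' * s)) * hq + hq'

theorem exists_linear_inverse_pow {s f : A[T;T⁻¹]}
    (hf : ∃ b c : A, s ^ 2 ∣ f * (C b + C c * s) - 1) (n : ℕ) :
    ∃ b c : A, s ^ 2 ∣ f ^ n * (C b + C c * s) - 1 := by
  induction n with
  | zero => exact ⟨1, 0, by simp⟩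
  | succ n ih => rw [pow_succ]; exact exists_linear_inverse_mul ih hf

/-- Functions that satisfy the conditions of `IsKZFunction` exist over any ring in which the
differences of the points are invertible. -/
theorem exists_kz_function {k : ℕ} {u : Fin k → A} (hu : ∀ i j, i ≠ j → IsUnit (u i - u j))
    (i : Fin k) :
    ∃ f ∈ growth A (-2), ∀ l, (T 1 - C (u l)) ^ 2 ∣ f - if i = l then 1 else 0 := by
  set s : A[T;T⁻¹] := T 1 - C (u i) with hs
  -- The function is the product of `z ^ (-2 k - 1) ∏ l ≠ i, (z - u l) ^ 2`, which has the zeros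
  -- at `u l`, and the inverse of this product modulo `(z - u i) ^ 2`.
  have h1 : ∃ b c : A, s ^ 2 ∣ T (-1) ^ (2 * k + 1) * (C b + C c * s) - 1 := by
    refine exists_linear_inverse_pow ⟨u i, 1, 0, ?_⟩ _
    rw [map_one, one_mul, hs, add_sub_cancel, ← T_add]
    simp
  have h2 : ∃ b c : A, s ^ 2 ∣
      (∏ l ∈ Finset.univ.erase i, (T 1 - C (u l)) ^ 2) * (C b + C c * s) - 1 := by
    refine Finset.prod_induction _ (fun f : A[T;T⁻¹] => ∃ b c : A, s ^ 2 ∣ f * (C b + C c * s) - 1)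
      (fun f g hf hg => exists_linear_inverse_mul hf hg) ⟨1, 0, by simp⟩ fun l hl => ?_
    refine exists_linear_inverse_pow ?_ 2
    obtain ⟨w, hw⟩ := hu i l (Finset.ne_of_mem_erase hl).symm
    refine ⟨(w⁻¹ : Aˣ), -((w⁻¹ : Aˣ) : A) ^ 2, -C ((w⁻¹ : Aˣ) : A) ^ 2, ?_⟩
    have h3 : (C (w : A) : A[T;T⁻¹]) * C ((w⁻¹ : Aˣ) : A) = 1 := by
      rw [← map_mul, Units.mul_inv, map_one]
    have h4 : (T 1 - C (u l) : A[T;T⁻¹]) = s + C (w : A) := by rw [hw, hs, map_sub]; ring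
    rw [h4, map_neg, map_pow]
    linear_combination (1 - C ((w⁻¹ : Aˣ) : A) * s) * h3
  obtain ⟨b, c, hbc⟩ := exists_linear_inverse_mul h1 h2
  refine ⟨T (-1) ^ (2 * k + 1) * (∏ l ∈ Finset.univ.erase i, (T 1 - C (u l)) ^ 2) *
    (C b + C c * s), ?_, fun l => ?_⟩
  · have g1 : (T (-1) : A[T;T⁻¹]) ∈ growth A (-1) := by
      simpa using C_mul_T_mem_growth (1 : A) (n := -1) (d := -1) le_rfl
    have g2 : C b + C c * s ∈ growth A 1 := by
      refine add_mem ?_ ?_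
      · simpa using C_mul_T_mem_growth b (n := 0) (d := 1) zero_le_one
      · rw [← smul_eq_C_mul]
        exact Submodule.smul_mem _ _ (sub_mem_growth _)
    refine growth_mono ?_ (mul_mem_growth (mul_mem_growth (pow_mem_growth g1 (2 * k + 1))
      (prod_sub_pow_mem_growth u 2 (Finset.univ.erase i))) g2)
    rw [Finset.card_erase_of_mem (Finset.mem_univ i), Finset.card_univ, Fintype.card_fin]
    have := i.pos
    push_cast [Nat.cast_sub this]
    linarith
  · split_ifs with h
    · subst h
      exact hbc
    · rw [sub_zero]
      exact ((Finset.dvd_prod_of_mem (fun l => (T 1 - C (u l)) ^ 2)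
        (Finset.mem_erase.2 ⟨Ne.symm h, Finset.mem_univ l⟩)).mul_left _).mul_right _

end

end LaurentPolynomial

/-- The ring of parameters with the coordinates, the partial derivatives and a choice of coefficient
functions of the connection. -/
noncomputable def paramKZ (k : ℕ) : KZData (paramRing k) k where
  u := paramCoord
  d := paramDerivation
  f i := (LaurentPolynomial.exists_kz_function (fun _ _ => isUnit_paramCoord_sub) i).choose
  d_u i j := Subtype.ext <| by
    rw [coe_paramDerivation, paramCoord, partialFun_coordFun]
    split_ifs <;> rfl
  d_comm := paramDerivation_comm
  f_growth i :=
    (LaurentPolynomial.exists_kz_function (fun _ _ => isUnit_paramCoord_sub) i).choose_spec.1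
  f_vanishing i :=
    (LaurentPolynomial.exists_kz_function (fun _ _ => isUnit_paramCoord_sub) i).choose_spec.2

/-! ### The linear system of the connection -/

section Coefficients

set_option maxSynthPendingDepth 3

variable {k : ℕ} {ι κ : Type*} [Fintype ι] [Fintype κ] [DecidableEq ι]

/-- The linear map `ℂ^κ → ℂ^ι` whose matrix has the values at `u` of the functions `r b c` as
entries. -/
noncomputable def rowMap (r : ι → κ → paramRing k) (u : Fin k → ℂ) : (κ → ℂ) →L[ℂ] (ι → ℂ) :=
  ∑ b, ∑ c, extendFun (r b c).1 u •
    (ContinuousLinearMap.proj (R := ℂ) (φ := fun _ : κ => ℂ) c).smulRight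
      (Pi.single b (1 : ℂ) : ι → ℂ)

theorem rowMap_apply (r : ι → κ → paramRing k) (u : Fin k → ℂ) (e : κ → ℂ) (b : ι) :
    rowMap r u e b = ∑ c, extendFun (r b c).1 u * e c := by
  simp only [rowMap, sum_apply, smul_apply, ContinuousLinearMap.smulRight_apply,
    ContinuousLinearMap.proj_apply, Finset.sum_apply, Pi.smul_apply, smul_eq_mul]
  rw [Finset.sum_eq_single b (fun b' _ hb => Finset.sum_eq_zero fun c _ => by
    rw [Pi.single_eq_of_ne hb.symm, mul_zero, mul_zero]) (by simp)]
  simp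

theorem hasFDerivAt_rowMap (r : ι → κ → paramRing k) {u : Fin k → ℂ} (hu : u ∈ configSpace k) :
    HasFDerivAt (rowMap r) (∑ i,
      (ContinuousLinearMap.proj (R := ℂ) (φ := fun _ : Fin k => ℂ) i).smulRight
        (rowMap (fun b c => paramDerivation i (r b c)) u)) u := by
  have h1 : HasFDerivAt (rowMap r) _ u := HasFDerivAt.fun_sum (u := Finset.univ) fun b _ =>
    HasFDerivAt.fun_sum (u := Finset.univ) fun c _ =>
      (hasFDerivAt_extendFun (r b c) hu).smul_const ((ContinuousLinearMap.proj (R := ℂ)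
        (φ := fun _ : κ => ℂ) c).smulRight (Pi.single b (1 : ℂ) : ι → ℂ))
  refine h1.congr_fderiv (ContinuousLinearMap.ext fun ξ => ?_)
  simp only [sum_apply, smul_apply, ContinuousLinearMap.smulRight_apply,
    ContinuousLinearMap.proj_apply, rowMap, Finset.sum_smul, Finset.smul_sum, smul_eq_mul]
  simp_rw [Finset.sum_comm (s := (Finset.univ : Finset (Fin k)))]
  refine Finset.sum_congr rfl fun b _ => Finset.sum_congr rfl fun c _ =>
    Finset.sum_congr rfl fun i _ => ?_
  rw [smul_smul, mul_comm]

theorem contDiffOn_rowMap (r : ι → κ → paramRing k) :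
    ContDiffOn ℂ 2 (rowMap r) (configSpace k) := by
  refine ContDiffOn.sum fun b _ => ContDiffOn.sum fun c _ => ?_
  exact (contDiffOn_and_partialFun_mem (r b c).2).1.smul contDiffOn_const

/-- The linear form on `ℂ^k` with values in the linear maps `ℂ^κ → ℂ^ι` whose components are the
matrices `m i`. -/
noncomputable def formMap (m : Fin k → ι → κ → paramRing k) (u : Fin k → ℂ) :
    (Fin k → ℂ) →L[ℂ] (κ → ℂ) →L[ℂ] (ι → ℂ) :=
  ∑ i, (ContinuousLinearMap.proj (R := ℂ) (φ := fun _ : Fin k => ℂ) i).smulRight (rowMap (m i) u)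

theorem formMap_apply (m : Fin k → ι → κ → paramRing k) (u ξ : Fin k → ℂ) :
    formMap m u ξ = ∑ i, ξ i • rowMap (m i) u := by
  simp [formMap]

theorem contDiffOn_formMap (m : Fin k → ι → κ → paramRing k) :
    ContDiffOn ℂ 2 (formMap m) (configSpace k) := by
  refine ContDiffOn.sum fun i _ => ?_
  exact (ContinuousLinearMap.smulRightL ℂ (Fin k → ℂ) ((κ → ℂ) →L[ℂ] (ι → ℂ))
    (ContinuousLinearMap.proj i)).contDiff.comp_contDiffOn (contDiffOn_rowMap (m i))

theorem fderiv_formMap_apply (m : Fin k → ι → κ → paramRing k) {u : Fin k → ℂ}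
    (hu : u ∈ configSpace k) (ξ δ : Fin k → ℂ) : fderiv ℂ (formMap m) u ξ δ =
      ∑ i, ∑ j, (ξ i * δ j) • rowMap (fun b c => paramDerivation i (m j b c)) u := by
  have h1 : HasFDerivAt (formMap m) _ u := HasFDerivAt.fun_sum (u := Finset.univ) fun j _ =>
    (ContinuousLinearMap.smulRightL ℂ (Fin k → ℂ) ((κ → ℂ) →L[ℂ] (ι → ℂ))
      (ContinuousLinearMap.proj j)).hasFDerivAt.comp u (hasFDerivAt_rowMap (m j) hu)
  rw [h1.fderiv, Finset.sum_comm]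
  have h2 : ∀ (j : Fin k) (B : (κ → ℂ) →L[ℂ] (ι → ℂ)), ContinuousLinearMap.smulRightL ℂ (Fin k → ℂ)
      ((κ → ℂ) →L[ℂ] (ι → ℂ)) (ContinuousLinearMap.proj j) B δ = δ j • B := fun _ _ => rfl
  simp only [sum_apply, ContinuousLinearMap.comp_apply, h2,
    ContinuousLinearMap.smulRight_apply, ContinuousLinearMap.proj_apply, Finset.smul_sum, smul_smul]
  refine Finset.sum_congr rfl fun j _ => Finset.sum_congr rfl fun i _ => ?_
  rw [mul_comm]

end Coefficients

/-! ### Functionals on the quotients and solutions of the linear system -/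

namespace ChiralCFT

open LaurentPolynomial States

section Relations

variable {H : Type*} [AddCommGroup H] [Module ℂ H] (T : ChiralCFT H)
  {A : Type*} [CommRing A] [Algebra ℂ A] {k : ℕ} {ι : Type*} [Fintype ι] (χ : ι → H)

variable (A) in
/-- The combination `∑ b, r b • χ b` of constant families. -/
noncomputable def combination : (ι → A) →ₗ[A] States A H :=
  Fintype.linearCombination A fun b => const A (χ b)

theorem combination_apply (r : ι → A) : combination A χ r = ∑ b, r b • const A (χ b) :=
  Fintype.linearCombination_apply _ _ _

theorem range_combination :
    LinearMap.range (combination A χ) = Submodule.span A (const A '' Set.range χ) := by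
  rw [combination, Fintype.range_linearCombination, ← Set.range_comp]
  rfl

/-- The relations between the constant families `χ b` modulo the family of the spaces `O_u`. -/
noncomputable def relations (u : Fin k → A) : Submodule A (ι → A) :=
  (T.familyO u).comap (combination A χ)

variable {χ}

theorem exists_sub_combination_mem {u : Fin k → A}
    (hgen : Submodule.span A (const A '' Set.range χ) ⊔ T.familyO u = ⊤) (x : States A H) :
    ∃ r, x - combination A χ r ∈ T.familyO u := by
  have hx : x ∈ Submodule.span A (const A '' Set.range χ) ⊔ T.familyO u := by rw [hgen]; trivial
  rw [← range_combination] at hx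
  obtain ⟨_, ⟨r, rfl⟩, o, ho, rfl⟩ := Submodule.mem_sup.1 hx
  exact ⟨r, by rwa [add_sub_cancel_left]⟩

/-- The coefficients of constant families with respect to the generators may be chosen linearly. -/
theorem exists_linear_coefficients {u : Fin k → A}
    (hgen : Submodule.span A (const A '' Set.range χ) ⊔ T.familyO u = ⊤) :
    ∃ s : H →ₗ[ℂ] (ι → A), ∀ φ, const A φ - combination A χ (s φ) ∈ T.familyO u := by
  have hsurj : Function.Surjective
      (((T.familyO u).mkQ ∘ₗ combination A χ).restrictScalars ℂ) := by
    intro q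
    obtain ⟨x, rfl⟩ := Submodule.Quotient.mk_surjective _ q
    obtain ⟨r, hr⟩ := T.exists_sub_combination_mem hgen x
    exact ⟨r, ((Submodule.Quotient.eq _).2 hr).symm⟩
  obtain ⟨s, hs⟩ := Module.projective_lifting_property _
    ((T.familyO u).mkQ.restrictScalars ℂ ∘ₗ const A (H := H)) hsurj
  exact ⟨s, fun φ => (Submodule.Quotient.eq _).1 (LinearMap.congr_fun hs φ).symm⟩

/-- The value of a functional on `H / O_u` at a state, in terms of its values on the generators. -/
theorem dual_evalStates {u : Fin k → A} (e : A →ₐ[ℂ] ℂ)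
    (η : Module.Dual ℂ (H ⧸ T.zhuO fun l => e (u l))) {x : States A H} {r : ι → A}
    (hr : x - combination A χ r ∈ T.familyO u) :
    η (Submodule.Quotient.mk (evalStates e x)) =
      ∑ b, e (r b) * η (Submodule.Quotient.mk (χ b)) := by
  have h1 := (Submodule.Quotient.eq (T.zhuO fun l => e (u l))).2
    ((map_sub (evalStates (H := H) e) _ _).symm ▸ T.evalStates_mem_zhuO e hr)
  rw [h1, combination_apply, map_sum, ← Submodule.mkQ_apply, map_sum, map_sum]
  refine Finset.sum_congr rfl fun b _ => ?_
  rw [evalStates_smul_const, map_smul, map_smul, smul_eq_mul]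
  rfl

/-- Numbers that satisfy the specialized relations are the values on the generators of a functional
on `H / O_u`. -/
theorem exists_dual {u : Fin k → A}
    (hgen : Submodule.span A (const A '' Set.range χ) ⊔ T.familyO u = ⊤) (e : A →ₐ[ℂ] ℂ)
    (hu : Function.Injective fun l => e (u l)) {y : ι → ℂ}
    (hy : ∀ r ∈ T.relations χ u, ∑ b, e (r b) * y b = 0) :
    ∃ η : Module.Dual ℂ (H ⧸ T.zhuO fun l => e (u l)), ∀ (x : States A H) (r : ι → A),
      x - combination A χ r ∈ T.familyO u →
        η (Submodule.Quotient.mk (evalStates e x)) = ∑ b, e (r b) * y b := by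
  obtain ⟨s, hs⟩ := T.exists_linear_coefficients hgen
  let θ : H →ₗ[ℂ] ℂ := ∑ b, y b • (e.toLinearMap ∘ₗ LinearMap.proj b ∘ₗ s)
  have hθ : ∀ φ, θ φ = ∑ b, e (s φ b) * y b := fun φ => by
    simp [θ, mul_comm]
  have h1 : ∀ x : States A H, x - combination A χ (lift s x) ∈ T.familyO u := by
    intro x
    induction x using States.induction_on with
    | zero => simp
    | smul a φ =>
      rw [map_smul, map_smul, lift_const, ← smul_sub]
      exact Submodule.smul_mem _ _ (hs φ)
    | add x y hx hy =>
      rw [map_add, map_add, add_sub_add_comm]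
      exact add_mem hx hy
  have h2 : ∀ x : States A H, θ (evalStates e x) = ∑ b, e (lift s x b) * y b := by
    intro x
    induction x using States.induction_on with
    | zero => simp
    | smul a φ =>
      rw [evalStates_smul_const, map_smul, map_smul, lift_const, hθ, Finset.smul_sum]
      refine Finset.sum_congr rfl fun b _ => ?_
      rw [Pi.smul_apply, smul_eq_mul, smul_eq_mul, map_mul, mul_assoc]
    | add x y hx hy =>
      rw [map_add, map_add, hx, hy, map_add, ← Finset.sum_add_distrib]
      refine Finset.sum_congr rfl fun b _ => ?_
      rw [Pi.add_apply, map_add, add_mul]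
  have h3 : ∀ (x : States A H) (r : ι → A), x - combination A χ r ∈ T.familyO u →
      θ (evalStates e x) = ∑ b, e (r b) * y b := by
    intro x r hr
    have h4 : lift s x - r ∈ T.relations χ u := by
      change combination A χ (lift s x - r) ∈ T.familyO u
      rw [map_sub, ← sub_sub_sub_cancel_left _ _ x]
      exact sub_mem hr (h1 x)
    rw [h2, ← sub_eq_zero, ← Finset.sum_sub_distrib, ← hy _ h4]
    refine Finset.sum_congr rfl fun b _ => ?_
    rw [Pi.sub_apply, map_sub, sub_mul]
  refine ⟨(T.zhuO fun l => e (u l)).liftQ θ fun φ hφ => ?_, fun x r hr => h3 x r hr⟩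
  obtain ⟨x, hx, rfl⟩ := T.exists_evalStates_eq e hu hφ
  rw [LinearMap.mem_ker, h3 x 0 (by simpa using hx)]
  simp

variable (K : KZData A k) {m : Fin k → ι → ι → A}

/-- The connection in terms of coefficients with respect to the generators. -/
theorem nabla_sub_combination_mem
    (hm : ∀ i b, T.nabla K i (const A (χ b)) - combination A χ (m i b) ∈ T.familyO K.u)
    (i : Fin k) {x : States A H} {r : ι → A} (hr : x - combination A χ r ∈ T.familyO K.u) :
    T.nabla K i x - combination A χ (fun c => K.d i (r c) + ∑ b, r b * m i b c) ∈
      T.familyO K.u := by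
  have h1 : (fun c => K.d i (r c) + ∑ b, r b * m i b c) =
      (fun c => K.d i (r c)) + ∑ b, r b • m i b := by
    ext c
    simp
  have h2 : T.nabla K i (combination A χ r) = combination A χ (fun c => K.d i (r c)) +
      ∑ b, r b • T.nabla K i (const A (χ b)) := by
    simp only [combination_apply, map_sum, nabla_smul, Finset.sum_add_distrib]
  have h3 : T.nabla K i x - combination A χ (fun c => K.d i (r c) + ∑ b, r b * m i b c) =
      T.nabla K i (x - combination A χ r) +
        ∑ b, r b • (T.nabla K i (const A (χ b)) - combination A χ (m i b)) := by
    rw [h1, map_sub, h2, map_add, map_sum]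
    simp only [smul_sub, Finset.sum_sub_distrib, map_smul]
    abel
  rw [h3]
  exact add_mem (T.nabla_mem_familyO K i hr)
    (Submodule.sum_mem _ fun b _ => Submodule.smul_mem _ _ (hm i b))

/-- The system preserves the relations, because the connection preserves the family of the spaces
`O_u`. -/
theorem d_add_mem_relations
    (hm : ∀ i b, T.nabla K i (const A (χ b)) - combination A χ (m i b) ∈ T.familyO K.u)
    (i : Fin k) {r : ι → A} (hr : r ∈ T.relations χ K.u) :
    (fun c => K.d i (r c) + ∑ b, r b * m i b c) ∈ T.relations χ K.u := by
  have h1 := T.nabla_sub_combination_mem K hm i (x := 0) (r := r)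
    (by rw [zero_sub]; exact neg_mem hr)
  rw [map_zero, zero_sub] at h1
  exact (T.familyO K.u).neg_mem_iff.1 h1

/-- The curvature of the system is a relation, because the connection is flat modulo the family of
the spaces `O_u`. -/
theorem curvature_mem_relations
    (hm : ∀ i b, T.nabla K i (const A (χ b)) - combination A χ (m i b) ∈ T.familyO K.u)
    (i j : Fin k) (b : ι) :
    (fun c => (K.d i (m j b c) + ∑ a, m j b a * m i a c) -
      (K.d j (m i b c) + ∑ a, m i b a * m j a c)) ∈ T.relations χ K.u := by
  have h1 := T.nabla_sub_combination_mem K hm i (hm j b)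
  have h2 := T.nabla_sub_combination_mem K hm j (hm i b)
  have h3 := sub_mem (T.nabla_comm_mem_familyO K i j (const A (χ b))) (sub_mem h1 h2)
  have h4 : ∀ p q r s : States A H, p - q - (p - r - (q - s)) = r - s := fun p q r s => by abel
  rw [h4, ← map_sub] at h3
  exact h3

end Relations

end ChiralCFT

/-! ### Composition and curvature of the coefficient matrices -/

section Matrices

variable {k : ℕ} {ι κ μ : Type*} [Fintype ι] [Fintype κ] [Fintype μ] [DecidableEq ι]

theorem rowMap_apply_paramEval (r : ι → κ → paramRing k) (w : configSpace k) (e : κ → ℂ) (b : ι) :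
    rowMap r w e b = ∑ c, paramEval w (r b c) * e c := by
  rw [rowMap_apply]
  refine Finset.sum_congr rfl fun c _ => ?_
  rw [extendFun_apply, paramEval_apply]

theorem rowMap_rowMap [DecidableEq κ] (r : ι → κ → paramRing k) (s : κ → μ → paramRing k)
    (w : configSpace k) (e : μ → ℂ) :
    rowMap r w (rowMap s w e) = rowMap (fun a c => ∑ b, r a b * s b c) w e := by
  ext a
  simp only [rowMap_apply_paramEval, map_sum, map_mul, Finset.mul_sum, Finset.sum_mul, mul_assoc]
  rw [Finset.sum_comm]

theorem rowMap_add (r s : ι → κ → paramRing k) (w : configSpace k) (e : κ → ℂ) :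
    rowMap r w e + rowMap s w e = rowMap (fun b c => r b c + s b c) w e := by
  ext a
  simp only [Pi.add_apply, rowMap_apply_paramEval, map_add, add_mul, Finset.sum_add_distrib]

theorem rowMap_sub (r s : ι → κ → paramRing k) (w : configSpace k) (e : κ → ℂ) :
    rowMap r w e - rowMap s w e = rowMap (fun b c => r b c - s b c) w e := by
  ext a
  simp only [Pi.sub_apply, rowMap_apply_paramEval, map_sub, sub_mul, Finset.sum_sub_distrib]

theorem fderiv_rowMap_apply (r : ι → κ → paramRing k) (w : configSpace k) (ξ : Fin k → ℂ)
    (e : κ → ℂ) : fderiv ℂ (rowMap r) w ξ e =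
      ∑ i, ξ i • rowMap (fun b c => paramDerivation i (r b c)) w e := by
  rw [(hasFDerivAt_rowMap r w.2).fderiv]
  simp

/-- The curvature of the linear form of matrices `m`. -/
theorem curvature_formMap (m : Fin k → ι → ι → paramRing k) (w : configSpace k) (ξ δ : Fin k → ℂ)
    (e : ι → ℂ) :
    fderiv ℂ (formMap m) w ξ δ e - fderiv ℂ (formMap m) w δ ξ e +
      formMap m w δ (formMap m w ξ e) - formMap m w ξ (formMap m w δ e) =
    ∑ i, ∑ j, (ξ i * δ j) • rowMap (fun b c =>
      (paramDerivation i (m j b c) + ∑ a, m j b a * m i a c) -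
        (paramDerivation j (m i b c) + ∑ a, m i b a * m j a c)) w e := by
  have h1 : ∀ (n : Fin k → Fin k → ι → ι → paramRing k) (ξ δ : Fin k → ℂ),
      (∑ i, ∑ j, (ξ i * δ j) • rowMap (n i j) w) e = ∑ i, ∑ j, (ξ i * δ j) • rowMap (n i j) w e :=
    fun n ξ δ => by simp
  have h2 : ∀ ξ δ : Fin k → ℂ, formMap m w δ (formMap m w ξ e) =
      ∑ i, ∑ j, (ξ i * δ j) • rowMap (fun b c => ∑ a, m j b a * m i a c) w e := by
    intro ξ δ
    simp only [formMap_apply, sum_apply, smul_apply, map_sum, map_smul, Finset.smul_sum, smul_smul,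
      rowMap_rowMap]
  have h3 : ∀ (n : Fin k → Fin k → (ι → ℂ)), ∑ i, ∑ j, (δ i * ξ j) • n i j =
      ∑ i, ∑ j, (ξ i * δ j) • n j i := by
    intro n
    rw [Finset.sum_comm]
    refine Finset.sum_congr rfl fun i _ => Finset.sum_congr rfl fun j _ => ?_
    rw [mul_comm]
  rw [fderiv_formMap_apply m w.2, fderiv_formMap_apply m w.2, h1, h1, h2 ξ δ, h2 δ ξ, h3, h3]
  simp only [← Finset.sum_sub_distrib, ← Finset.sum_add_distrib, ← smul_sub, ← smul_add]
  refine Finset.sum_congr rfl fun i _ => Finset.sum_congr rfl fun j _ => ?_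
  congr 1
  rw [← rowMap_sub, ← rowMap_add, ← rowMap_add]
  abel

end Matrices

namespace ChiralCFT

open LaurentPolynomial States

variable {H : Type*} [AddCommGroup H] [Module ℂ H] (T : ChiralCFT H)

/-! ### Flat sections -/

theorem evalStates_nabla_const {k : ℕ} (w : configSpace k) (i : Fin k) (φ : H) :
    evalStates (paramEval w) (T.nabla (paramKZ k) i (const (paramRing k) φ)) =
      T.connectionOp (mapCoeff (paramEval w : paramRing k →+* ℂ) ((paramKZ k).f i)) φ := by
  rw [nabla_apply, tensorDerivation_const, zero_sub, map_neg, evalStates_smear, evalStates_const]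
  rfl

theorem isKZFunction_mapCoeff {k : ℕ} (w : configSpace k) (i : Fin k) :
    IsKZFunction w.1 i (mapCoeff (paramEval w : paramRing k →+* ℂ) ((paramKZ k).f i)) := by
  refine isKZFunction_iff.2 ⟨mapCoeff_mem_growth _ ((paramKZ k).f_growth i), fun l => ?_⟩
  have h1 := map_dvd (mapCoeff (paramEval w : paramRing k →+* ℂ)) ((paramKZ k).f_vanishing i l)
  rw [map_pow, map_sub, map_sub, mapCoeff_T, mapCoeff_C, apply_ite (mapCoeff _), map_one,
    map_zero] at h1
  exact h1

/-- A function whose values satisfy the differential equation on the generators satisfies it on all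
states. -/
theorem mk_connectionOp_eq {k : ℕ} (w : configSpace k) {i : Fin k} {f : ℂ[T;T⁻¹]}
    (hf : IsKZFunction w.1 i f) (φ : H) :
    (Submodule.Quotient.mk (T.connectionOp f φ) : H ⧸ T.zhuO w.1) = Submodule.Quotient.mk
      (evalStates (paramEval w) (T.nabla (paramKZ k) i (const (paramRing k) φ))) := by
  rw [evalStates_nabla_const]
  exact (Submodule.Quotient.eq _).2 (T.connectionOp_sub_mem_zhuO hf (isKZFunction_mapCoeff w i) φ)

end ChiralCFT

namespace ChiralCFT

open LaurentPolynomial States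

variable {H : Type*} [AddCommGroup H] [Module ℂ H] (T : ChiralCFT H)

/-- The values of a functional on `H / O_w` are determined by its values on the generators. -/
theorem dual_evalStates_paramEval {k n : ℕ} {χ : Fin n → H} (w : configSpace k)
    (θ : Module.Dual ℂ (H ⧸ T.zhuO w.1)) {x : States (paramRing k) H} {s : Fin n → paramRing k}
    (hs : x - combination (paramRing k) χ s ∈ T.familyO (paramKZ k).u) :
    θ (Submodule.Quotient.mk (evalStates (paramEval w) x)) =
      ∑ b, paramEval w (s b) * θ (Submodule.Quotient.mk (χ b)) :=
  T.dual_evalStates (u := (paramKZ k).u) (paramEval w) θ hs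

/-- The coordinates of a dual section with respect to the generators satisfy the linear system. -/
theorem hasFDerivAt_of_satisfiesKZ {k n : ℕ} {χ : Fin n → H} {U : Set (Fin k → ℂ)} (hU : IsOpen U)
    (hUX : U ⊆ configSpace k) {f : (Fin k → ℂ) → Fin k → ℂ[T;T⁻¹]}
    (hf : ∀ u ∈ U, ∀ i, IsKZFunction u i (f u i)) {m : Fin k → Fin n → Fin n → paramRing k}
    (hm : ∀ i b, T.nabla (paramKZ k) i (const (paramRing k) (χ b)) -
      combination (paramRing k) χ (m i b) ∈ T.familyO (paramKZ k).u)
    {η : (u : Fin k → ℂ) → Module.Dual ℂ (H ⧸ T.zhuO u)} (hη : T.IsDualSection U η)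
    (hKZ : T.SatisfiesKZ U f η) {u : Fin k → ℂ} (hu : u ∈ U) :
    HasFDerivAt (fun u b => η u (Submodule.Quotient.mk (χ b)))
      ((formMap m u).flip fun b => η u (Submodule.Quotient.mk (χ b))) u := by
  set y : (Fin k → ℂ) → Fin n → ℂ := fun u b => η u (Submodule.Quotient.mk (χ b)) with hy
  have hd : DifferentiableAt ℂ y u := differentiableAt_pi.2 fun b =>
    (hη (χ b)).differentiableAt (hU.mem_nhds hu)
  have hpart : ∀ i b, fderiv ℂ y u (Pi.single i 1) b = rowMap (m i) u (y u) b := by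
    intro i b
    have h1 : HasDerivAt (fun t => y (Function.update u i t) b)
        (fderiv ℂ y u (Pi.single i 1) b) (u i) := by
      have h2 : HasFDerivAt y (fderiv ℂ y u) (Function.update u i (u i)) := by
        rw [Function.update_eq_self]
        exact hd.hasFDerivAt
      exact hasDerivAt_pi.1 (h2.comp_hasDerivAt (u i) (hasDerivAt_update u i (u i))) b
    rw [h1.unique (hKZ u hu i (χ b)), T.mk_connectionOp_eq ⟨u, hUX hu⟩ (hf u hu i),
      rowMap_apply_paramEval (m i) ⟨u, hUX hu⟩]
    exact T.dual_evalStates_paramEval ⟨u, hUX hu⟩ (η u) (hm i b)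
  refine hd.hasFDerivAt.congr_fderiv (ContinuousLinearMap.ext fun ξ => ?_)
  rw [clm_apply_eq_sum (fderiv ℂ y u) ξ, ContinuousLinearMap.flip_apply, formMap_apply]
  ext b
  simp only [Finset.sum_apply, sum_apply, smul_apply, Pi.smul_apply, hpart]
  rfl

/-- Existence and uniqueness of flat sections of the bundle dual to `u ↦ H / O_u`. Uniqueness holds
because the values on the generators determine a functional and solve the linear system. -/
theorem exists_unique_flat_section (k : ℕ)
    (hC : FiniteDimensional ℂ (H ⧸ T.zhuC k))
    (v : Fin k → ℂ) (U : Set (Fin k → ℂ)) (hvU : v ∈ U) (hUX : U ⊆ configSpace k)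
    (hUopen : IsOpen U) (hU : IsSimplyConnected U)
    (f : (Fin k → ℂ) → Fin k → ℂ[T;T⁻¹]) (hf : ∀ u ∈ U, ∀ i, IsKZFunction u i (f u i))
    (η : Module.Dual ℂ (H ⧸ T.zhuO v)) :
    ∃ η' : (u : Fin k → ℂ) → Module.Dual ℂ (H ⧸ T.zhuO u),
      (T.IsDualSection U η' ∧ η' v = η ∧ T.SatisfiesKZ U f η') ∧
      ∀ η'' : (u : Fin k → ℂ) → Module.Dual ℂ (H ⧸ T.zhuO u),
        (T.IsDualSection U η'' ∧ η'' v = η ∧ T.SatisfiesKZ U f η'') →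
          ∀ u ∈ U, η'' u = η' u := by
  classical
  set K := paramKZ k with hK
  obtain ⟨S, hS, hgen⟩ := T.exists_finite_span_sup_familyO hC K.u isUnit_paramCoord
  obtain ⟨n, χ, -, rfl⟩ := hS.fin_param
  -- The connection matrices and generators of the module of relations.
  choose m hm using fun (i : Fin k) (b : Fin n) =>
    T.exists_sub_combination_mem hgen (T.nabla K i (const (paramRing k) (χ b)))
  obtain ⟨N, r, hr⟩ := Submodule.fg_iff_exists_fin_generating_family.1
    (IsNoetherian.noetherian (T.relations χ K.u))
  have hrmem : ∀ a, r a ∈ T.relations χ K.u := fun a => hr ▸ Submodule.subset_span ⟨a, rfl⟩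
  have hcoef : ∀ (i : Fin k) (a : Fin N), ∃ c : Fin N → paramRing k, ∑ a', c a' • r a' =
      fun b' => K.d i (r a b') + ∑ b, r a b * m i b b' := fun i a =>
    Submodule.mem_span_range_iff_exists_fun (paramRing k) |>.1
      (hr.symm ▸ T.d_add_mem_relations K hm i (hrmem a))
  choose c hc using hcoef
  -- The finitely many generating relations imply all of them.
  have hρ : ∀ (w : configSpace k) (y : Fin n → ℂ), rowMap r w y = 0 →
      ∀ s ∈ T.relations χ K.u, ∑ b, paramEval w (s b) * y b = 0 := by
    intro w y hy s hs
    rw [← hr] at hs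
    induction hs using Submodule.span_induction with
    | mem s hs =>
      obtain ⟨a, rfl⟩ := hs
      rw [← rowMap_apply_paramEval, hy]
      rfl
    | zero => simp
    | add s t _ _ hs ht => simp [add_mul, Finset.sum_add_distrib, hs, ht]
    | smul a s _ hs => simp [mul_assoc, ← Finset.mul_sum, hs]
  have hpres : ∀ u ∈ U, ∀ ξ e, fderiv ℂ (rowMap r) u ξ e + rowMap r u (formMap m u ξ e) =
      formMap c u ξ (rowMap r u e) := by
    intro u hu ξ e
    lift u to configSpace k using hUX hu
    simp only [fderiv_rowMap_apply, formMap_apply, sum_apply, smul_apply, map_sum, map_smul,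
      rowMap_rowMap, ← Finset.sum_add_distrib, ← smul_add, rowMap_add]
    refine Finset.sum_congr rfl fun i _ => ?_
    congr 3
    ext1 a
    refine (hc i a).symm.trans ?_
    ext1 b
    simp
  have hcurv : ∀ u ∈ U, ∀ e, rowMap r u e = 0 → ∀ ξ δ, fderiv ℂ (formMap m) u ξ δ e -
      fderiv ℂ (formMap m) u δ ξ e + formMap m u δ (formMap m u ξ e) -
        formMap m u ξ (formMap m u δ e) = 0 := by
    intro u hu e he ξ δ
    lift u to configSpace k using hUX hu
    rw [curvature_formMap]
    refine Finset.sum_eq_zero fun i _ => Finset.sum_eq_zero fun j _ => ?_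
    refine smul_eq_zero_of_right _ (funext fun b => ?_)
    rw [rowMap_apply_paramEval]
    exact hρ u e he _ (T.curvature_mem_relations K hm i j b)
  have hη₀ : rowMap r v (fun b => η (Submodule.Quotient.mk (χ b))) = 0 := by
    ext a
    rw [rowMap_apply_paramEval r ⟨v, hUX hvU⟩]
    have h1 := T.dual_evalStates_paramEval ⟨v, hUX hvU⟩ η (x := 0) (s := r a)
      (by rw [zero_sub]; exact neg_mem (hrmem a))
    refine h1.symm.trans ?_
    rw [map_zero]
    exact map_zero η
  obtain ⟨y, hyv, hy, hyρ⟩ := LinearSystem.exists_solution hUopen hU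
    ((contDiffOn_formMap m).mono hUX)
    (fun u hu => (hasFDerivAt_rowMap r (hUX hu)).differentiableAt)
    ((contDiffOn_formMap c).continuousOn.mono hUX) hpres hcurv hvU hη₀
  -- The functional at `u` with the values `y u` on the generators.
  have hdual : ∀ u : Fin k → ℂ, ∃ θ : Module.Dual ℂ (H ⧸ T.zhuO u), ∀ hu : u ∈ U,
      ∀ (x : States (paramRing k) H) (s : Fin n → paramRing k),
        x - combination (paramRing k) χ s ∈ T.familyO K.u →
        θ (Submodule.Quotient.mk (evalStates (paramEval ⟨u, hUX hu⟩) x)) =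
          ∑ b, paramEval ⟨u, hUX hu⟩ (s b) * y u b := by
    intro u
    by_cases hu : u ∈ U
    · obtain ⟨θ, hθ⟩ := T.exists_dual (u := (paramKZ k).u) hgen (paramEval ⟨u, hUX hu⟩) (hUX hu).1
        (hρ ⟨u, hUX hu⟩ (y u) (hyρ u hu))
      exact ⟨θ, fun _ => hθ⟩
    · exact ⟨0, fun h => absurd h hu⟩
  choose η' hη' using hdual
  obtain ⟨s, hs⟩ := T.exists_linear_coefficients hgen
  -- Holomorphic coefficients exhibit `η' u φ` as a holomorphic function of `u`.
  have hval : ∀ u ∈ U, ∀ φ, η' u (Submodule.Quotient.mk φ) =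
      ∑ b, extendFun (s φ b).1 u * y u b := by
    intro u hu φ
    have h1 := hη' u hu (const (paramRing k) φ) (s φ) (hs φ)
    rw [evalStates_const] at h1
    rw [h1]
    refine Finset.sum_congr rfl fun b _ => ?_
    rw [paramEval_apply, extendFun_apply (s φ b).1 ⟨u, hUX hu⟩]
  have hval' : ∀ u ∈ U, ∀ b, η' u (Submodule.Quotient.mk (χ b)) = y u b := by
    intro u hu b
    have h1 := hη' u hu (const (paramRing k) (χ b)) (Pi.single b 1) (by
      rw [combination, Fintype.linearCombination_apply_single, one_smul, sub_self]
      exact zero_mem _)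
    rw [evalStates_const] at h1
    rw [h1, Finset.sum_eq_single b (fun b' _ hb => by rw [Pi.single_eq_of_ne hb]; simp) (by simp)]
    simp
  have hext : ∀ (u : Fin k → ℂ) (hu : u ∈ U) (θ θ' : Module.Dual ℂ (H ⧸ T.zhuO u)),
      (∀ b, θ (Submodule.Quotient.mk (χ b)) = θ' (Submodule.Quotient.mk (χ b))) → θ = θ' := by
    intro u hu θ θ' h
    refine Submodule.linearMap_qext _ (LinearMap.ext fun φ => ?_)
    have h1 := T.dual_evalStates_paramEval ⟨u, hUX hu⟩ θ (hs φ)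
    have h2 := T.dual_evalStates_paramEval ⟨u, hUX hu⟩ θ' (hs φ)
    rw [evalStates_const] at h1 h2
    exact h1.trans ((Finset.sum_congr rfl fun b _ => by rw [h b]).trans h2.symm)
  have hderiv : ∀ u ∈ U, ∀ φ, HasFDerivAt (fun u => η' u (Submodule.Quotient.mk φ))
      (∑ b, (extendFun (s φ b).1 u • (ContinuousLinearMap.proj b).comp ((formMap m u).flip (y u)) +
        y u b • ∑ i, extendFun (paramDerivation i (s φ b)).1 u •
          ContinuousLinearMap.proj (R := ℂ) (φ := fun _ : Fin k => ℂ) i)) u := by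
    intro u hu φ
    have h1 : HasFDerivAt (fun u => ∑ b, extendFun (s φ b).1 u * y u b) _ u :=
      HasFDerivAt.fun_sum (u := Finset.univ) fun b _ =>
        (hasFDerivAt_extendFun (s φ b) (hUX hu)).mul (hasFDerivAt_pi'.1 (hy u hu) b)
    refine h1.congr_of_eventuallyEq ?_
    filter_upwards [hUopen.mem_nhds hu] with w hw using hval w hw φ
  refine ⟨η', ⟨fun φ u hu => (hderiv u hu φ).differentiableAt.differentiableWithinAt,
    hext v hvU _ _ fun b => ?_, fun u hu i φ => ?_⟩, fun η'' hη'' u hu => hext u hu _ _ fun b => ?_⟩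
  · rw [hval' v hvU, hyv]
  · refine ((hderiv u hu φ).comp_hasDerivAt_of_eq (u i) (hasDerivAt_update u i (u i))
      (Function.update_eq_self i u).symm).congr_deriv ?_
    rw [T.mk_connectionOp_eq ⟨u, hUX hu⟩ (hf u hu i)]
    refine Eq.trans ?_ (hη' u hu _ _ (T.nabla_sub_combination_mem K hm i (hs φ))).symm
    simp only [sum_apply, add_apply, smul_apply, ContinuousLinearMap.comp_apply,
      ContinuousLinearMap.flip_apply, formMap_apply, ContinuousLinearMap.proj_apply, add_mul,
      map_add, map_sum, map_mul, smul_eq_mul]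
    have h1 : ∀ x, ∑ j, ((Pi.single i 1 : Fin k → ℂ) j • rowMap (m j) u (y u)) x =
        rowMap (m i) u (y u) x := fun x => by
      rw [Finset.sum_eq_single i (fun j _ hj => by rw [Pi.single_eq_of_ne hj]; simp) (by simp),
        Pi.single_eq_same, one_smul]
    have h2 : ∀ x, ∑ j, extendFun (paramDerivation j (s φ x)).1 u * (Pi.single i 1 : Fin k → ℂ) j =
        extendFun (paramDerivation i (s φ x)).1 u := fun x => by
      rw [Finset.sum_eq_single i (fun j _ hj => by rw [Pi.single_eq_of_ne hj, mul_zero]) (by simp),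
        Pi.single_eq_same, mul_one]
    have h3 : ∀ a : paramRing k, extendFun a.1 u = paramEval ⟨u, hUX hu⟩ a := fun a => by
      rw [paramEval_apply, ← extendFun_apply a.1 ⟨u, hUX hu⟩]
    have h4 : ∀ x, rowMap (m i) u (y u) x = ∑ c, paramEval ⟨u, hUX hu⟩ (m i x c) * y u c :=
      rowMap_apply_paramEval (m i) ⟨u, hUX hu⟩ (y u)
    simp only [h1, h2]
    simp only [h3, h4, Finset.sum_add_distrib, Finset.mul_sum, Finset.sum_mul]
    rw [add_comm, Finset.sum_comm (f := fun b c => paramEval ⟨u, hUX hu⟩ (s φ b) * _)]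
    refine congrArg₂ (· + ·) (Finset.sum_congr rfl fun b _ => mul_comm _ _) ?_
    exact Finset.sum_congr rfl fun b _ => Finset.sum_congr rfl fun c _ => (mul_assoc _ _ _).symm
  · have h1 := LinearSystem.eqOn_of_isPreconnected hUopen
      hU.isPathConnected.isConnected.isPreconnected ((contDiffOn_formMap m).continuousOn.mono hUX)
      (fun u hu => T.hasFDerivAt_of_satisfiesKZ hUopen hUX hf hm hη''.1 hη''.2.2 hu) hy hvU
      (by rw [hη''.2.1, hyv]) u hu
    rw [hval' u hu, ← h1]

end ChiralCFT

theorem theorem3 {H : Type*} [AddCommGroup H] [Module ℂ H] (T : ChiralCFT H) (k : ℕ)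
    (hC : FiniteDimensional ℂ (H ⧸ T.zhuC k))
    (v : Fin k → ℂ) (U : Set (Fin k → ℂ)) (hvU : v ∈ U) (hUX : U ⊆ configSpace k)
    (hUopen : IsOpen U) (hU : IsSimplyConnected U)
    (f : (Fin k → ℂ) → Fin k → ℂ[T;T⁻¹]) (hf : ∀ u ∈ U, ∀ i, IsKZFunction u i (f u i))
    (η : Module.Dual ℂ (H ⧸ T.zhuO v)) :
    ∃ η' : (u : Fin k → ℂ) → Module.Dual ℂ (H ⧸ T.zhuO u),
      (T.IsDualSection U η' ∧ η' v = η ∧ T.SatisfiesKZ U f η') ∧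
      ∀ η'' : (u : Fin k → ℂ) → Module.Dual ℂ (H ⧸ T.zhuO u),
        (T.IsDualSection U η'' ∧ η'' v = η ∧ T.SatisfiesKZ U f η'') →
          ∀ u ∈ U, η'' u = η' u := T.exists_unique_flat_section k hC v U hvU hUX hUopen hU f hf η
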